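/- Let $\rho,\mu,\tilde\lambda>0$. For $N\ge 0$ put $a_N=(\mu/\rho)^N e^{-\mu/\rho}/N!$ and $\gamma_N(\underline v_N)=e^{-\pi|\underline v_N|^2}$ on $\mathbb R^N$, and let $$L^2_s(\mathcal R,\boldsymbol\Gamma)=\bigoplus_{N=0}^\infty L^2_s(\mathbb R^N,a_N\gamma_N)$$ be the real Hilbert space of all sequences $\mathbf h=(h_0,h_1,h_2,\dots)$ of functions $h_N:\mathbb R^N\to\mathbb R$ that are symmetric under permutations of the $v_i$ and satisfy $(\mathbf h,\mathbf h)<\infty$, with the scalar product $$(\mathbf h,\mathbf j)=\sum_{N=0}^\infty a_N\int_{\mathbb R^N} h_N(\underline v_N)\,j_N(\underline v_N)\,\gamma_N(\underline v_N)\,d\underline v_N .$$ Define $$(\mathcal P^+\mathbf h)_N(\underline v_N)=\sum_{i=1}^N h_{N-1}(v_1,\dots,v_{i-1},v_{i+1},\dots,v_N),\qquad (\mathcal P^+\mathbf h)_0=0,$$ $$(\mathcal P^-\mathbf h)_N(\underline v_N)=\frac1{N+1}\sum_{i=1}^{N+1}\int_{\mathbb R} e^{-\pi w^2}h_{N+1}(v_1,\dots,v_{i-1},w,v_i,\dots,v_N)\,dw,$$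 $(\mathcal N\mathbf h)_N=N h_N$, and $(\mathcal K\mathbf h)_N=\sum_{1\le i<j\le N}(R_{i,j}-\mathrm{Id})h_N$ with $$(R_{i,j}h_N)(\underline v_N)=\frac1{2\pi}\int_0^{2\pi}h_N(\dots,v_i\cos\theta-v_j\sin\theta,\dots,v_i\sin\theta+v_j\cos\theta,\dots)\,d\theta ,$$ where the two rotated entries stand in places $i$ and $j$. Let $$\widetilde{\mathcal L}=\rho(\mathcal P^+-\mathcal N)+\mu(\mathcal P^--\mathrm{Id})+\tilde\lambda\mathcal K$$ with domain $D^2=\{\mathbf h\in L^2_s(\mathcal R,\boldsymbol\Gamma) : \widetilde{\mathcal L}\mathbf h\in L^2_s(\mathcal R,\boldsymbol\Gamma)\}$, where $\widetilde{\mathcal L}\mathbf h$ is computed level by level. Then $\widetilde{\mathcal L}$ is a densely defined self-adjoint operator on $L^2_s(\mathcal R,\boldsymbol\Gamma)$ and it is non-positive: $(\mathbf h,\widetilde{\mathcal L}\mathbf h)\le 0$ for all $\mathbf h\in D^2$. Let $\mathbf e^0$ be the vector with $(\mathbf e^0)_N\equiv 1$ for every $N$, let $\mathbf E_0=\mathrm{span}\{\mathbf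 e^0\}$, and let $$\Delta=\sup\{(\mathbf h,\widetilde{\mathcal L}\mathbf h) : \mathbf h\in D^2,\ \|\mathbf h\|=1,\ \mathbf h\perp\mathbf E_0\}.$$ Then $\Delta=-\rho$. Moreover $\Delta$ is an eigenvalue of $\widetilde{\mathcal L}$, and its eigenspace is $\mathrm{span}\{\mathbf e_1,\mathbf e_{(0,0,1)}\}$, where $$\mathbf e_1=\sqrt{\tfrac{\rho}{\mu}}\,\mathcal P^+\mathbf e^0-\sqrt{\tfrac{\mu}{\rho}}\,\mathbf e^0,\qquad (\mathbf e_{(0,0,1)})_N(\underline v_N)=\sqrt{\tfrac{\rho}{2\mu}}\sum_{i=1}^N(2\pi v_i^2-1).$$ -/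

import Mathlib

open MeasureTheory

noncomputable section

namespace KacReservoir

/-! ### States at the level of functions

A state is a sequence `h = (h 0, h 1, …)`, where `h N` is a function of `N` velocities. -/

abbrev State : Type := (N : ℕ) → (Fin N → ℝ) → ℝ

/-- `(P⁺ h)_N (v) = ∑ᵢ h_{N-1} (v with vᵢ removed)`; in particular `(P⁺ h)_0 = 0`. -/
def Pplus (h : State) : State
  | 0, _ => 0
  | N + 1, v => ∑ i : Fin (N + 1), h N (i.removeNth v)

/-- `(P⁻ h)_N (v) = (N+1)⁻¹ ∑ᵢ ∫ e^{-π w²} h_{N+1} (v with w inserted at place i) dw`. -/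
def Pminus (h : State) : State := fun N v =>
  1 / ((N : ℝ) + 1) *
    ∑ i : Fin (N + 1), ∫ w : ℝ, Real.exp (-Real.pi * w ^ 2) * h (N + 1) (i.insertNth w v)

/-- The number operator. -/
def Num (h : State) : State := fun N v => (N : ℝ) * h N v

/-- Rotation by the angle `θ` in the plane of the velocities `vᵢ` and `vⱼ`. -/
def rot {N : ℕ} (i j : Fin N) (θ : ℝ) (v : Fin N → ℝ) : Fin N → ℝ := fun k =>
  if k = i then v i * Real.cos θ - v j * Real.sin θ
  else if k = j then v i * Real.sin θ + v j * Real.cos θ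
  else v k

/-- The collision operator `R_{i,j}`: average over all rotations in the plane `(vᵢ, vⱼ)`. -/
def Rcol {N : ℕ} (i j : Fin N) (f : (Fin N → ℝ) → ℝ) : (Fin N → ℝ) → ℝ := fun v =>
  1 / (2 * Real.pi) * ∫ θ in (0 : ℝ)..(2 * Real.pi), f (rot i j θ v)

/-- The Kac collision operator `(K h)_N = ∑_{i<j} (R_{i,j} - Id) h_N`. -/
def Kac (h : State) : State := fun N v =>
  ∑ p : Fin N × Fin N with p.1 < p.2, (Rcol p.1 p.2 (h N) v - h N v)

/-- The expression `ρ (P⁺ h - N h) + μ (P⁻ h - h) + lam K h`. -/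
def genExpr (ρ μ lam : ℝ) (h : State) : State := fun N v =>
  ρ * (Pplus h N v - Num h N v) + μ * (Pminus h N v - h N v) + lam * Kac h N v

/-- `e⁰`, constantly one on every level. -/
def stateE0 : State := fun _ _ => 1

/-- `√(ρ/μ) P⁺ e⁰ - √(μ/ρ) e⁰`. -/
def stateE1 (ρ μ : ℝ) : State := fun N v =>
  Real.sqrt (ρ / μ) * Pplus stateE0 N v - Real.sqrt (μ / ρ) * stateE0 N v

/-- `√(ρ/(2μ)) ∑ᵢ (2π vᵢ² - 1)`. -/
def stateE001 (ρ μ : ℝ) : State := fun N v =>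
  Real.sqrt (ρ / (2 * μ)) * ∑ i : Fin N, (2 * Real.pi * v i ^ 2 - 1)

/-! ### The Hilbert space -/

/-- The Poisson weights `a_N = (μ/ρ)^N e^{-μ/ρ} / N!`. -/
def weight (ρ μ : ℝ) (N : ℕ) : ℝ :=
  (μ / ρ) ^ N * Real.exp (-(μ / ρ)) / (N.factorial : ℝ)

/-- The Maxwellian `γ_N (v) = e^{-π |v|²}`. -/
def maxwell {N : ℕ} (v : Fin N → ℝ) : ℝ := Real.exp (-Real.pi * ∑ i, v i ^ 2)

/-- The measure `a_N γ_N(v) dv` on `ℝ^N`. -/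
def levelMeasure (ρ μ : ℝ) (N : ℕ) : Measure (Fin N → ℝ) :=
  (volume : Measure (Fin N → ℝ)).withDensity
    (fun v => ENNReal.ofReal (weight ρ μ N * maxwell v))

lemma measurePreserving_perm {N : ℕ} (σ : Equiv.Perm (Fin N)) :
    MeasurePreserving (fun v : Fin N → ℝ => v ∘ σ) volume volume := by
  have h := volume_measurePreserving_piCongrLeft (fun _ : Fin N => ℝ) σ.symm
  convert h using 1
  ext v k
  simp [MeasurableEquiv.coe_piCongrLeft, Equiv.piCongrLeft_apply]

lemma maxwell_pos {N : ℕ} (v : Fin N → ℝ) : 0 < maxwell v := Real.exp_pos _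

lemma continuous_maxwell {N : ℕ} : Continuous (maxwell : (Fin N → ℝ) → ℝ) := by
  unfold maxwell; fun_prop

lemma measurePreserving_level {ρ μ : ℝ} {N : ℕ} {T : (Fin N → ℝ) → (Fin N → ℝ)}
    (hT : MeasurePreserving T volume volume) (hm : ∀ v, maxwell (T v) = maxwell v) :
    MeasurePreserving T (levelMeasure ρ μ N) (levelMeasure ρ μ N) := by
  refine ⟨hT.measurable, ?_⟩
  ext s hs
  have hme : Measurable (fun v : Fin N → ℝ => ENNReal.ofReal (weight ρ μ N * maxwell v)) :=
    (continuous_const.mul continuous_maxwell).measurable.ennreal_ofReal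
  rw [Measure.map_apply hT.measurable hs, levelMeasure,
    withDensity_apply _ (hT.measurable hs), withDensity_apply _ hs]
  rw [← hT.setLIntegral_comp_preimage hs hme]
  simp only [hm]

lemma measurePreserving_perm_level (ρ μ : ℝ) {N : ℕ} (σ : Equiv.Perm (Fin N)) :
    MeasurePreserving (fun v : Fin N → ℝ => v ∘ σ)
      (levelMeasure ρ μ N) (levelMeasure ρ μ N) :=
  measurePreserving_level (measurePreserving_perm σ) fun v => by
    simp only [maxwell, Function.comp]
    rw [Equiv.sum_comp σ (fun i => v i ^ 2)]

/-- `L²_s(ℝ^N, a_N γ_N)`: square integrable functions invariant under all permutations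
of the velocities. -/
def symL2 (ρ μ : ℝ) (N : ℕ) : Submodule ℝ (Lp ℝ 2 (levelMeasure ρ μ N)) where
  carrier := {f | ∀ σ : Equiv.Perm (Fin N),
    (fun v : Fin N → ℝ => f (v ∘ σ)) =ᵐ[levelMeasure ρ μ N] f}
  zero_mem' := fun σ => by
    have h0 := Lp.coeFn_zero ℝ 2 (levelMeasure ρ μ N)
    have h1 := (measurePreserving_perm_level ρ μ σ).quasiMeasurePreserving.ae_eq_comp h0
    filter_upwards [h0, h1] with v hv hv1
    exact hv1.trans hv.symm
  add_mem' := fun {f g} hf hg σ => by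
    have h0 := Lp.coeFn_add f g
    have h1 := (measurePreserving_perm_level ρ μ σ).quasiMeasurePreserving.ae_eq_comp h0
    filter_upwards [h0, h1, hf σ, hg σ] with v hv hv1 hv2 hv3
    refine hv1.trans ?_
    rw [hv]
    simp only [Function.comp_apply, Pi.add_apply] at *
    rw [hv2, hv3]
  smul_mem' := fun c f hf σ => by
    have h0 := Lp.coeFn_smul c f
    have h1 := (measurePreserving_perm_level ρ μ σ).quasiMeasurePreserving.ae_eq_comp h0
    filter_upwards [h0, h1, hf σ] with v hv hv1 hv2
    refine hv1.trans ?_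
    rw [hv]
    simp only [Function.comp_apply, Pi.smul_apply] at *
    rw [hv2]

lemma mem_symL2_iff {ρ μ : ℝ} {N : ℕ} (f : Lp ℝ 2 (levelMeasure ρ μ N)) :
    f ∈ symL2 ρ μ N ↔ ∀ σ : Equiv.Perm (Fin N),
      Lp.compMeasurePreservingₗᵢ ℝ _ (measurePreserving_perm_level ρ μ σ) f = f := by
  refine forall_congr' fun σ => ?_
  have h := Lp.coeFn_compMeasurePreserving f (measurePreserving_perm_level ρ μ σ)
  constructor
  · intro hf
    exact Lp.ext (h.trans hf)
  · intro hf
    have h2 : (Lp.compMeasurePreserving _ (measurePreserving_perm_level ρ μ σ) f) = f := hf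
    rw [h2] at h
    exact h.symm

lemma isClosed_symL2 (ρ μ : ℝ) (N : ℕ) :
    IsClosed (symL2 ρ μ N : Set (Lp ℝ 2 (levelMeasure ρ μ N))) := by
  have : (symL2 ρ μ N : Set (Lp ℝ 2 (levelMeasure ρ μ N))) =
      ⋂ σ : Equiv.Perm (Fin N), {f | Lp.compMeasurePreservingₗᵢ ℝ _
        (measurePreserving_perm_level ρ μ σ) f = f} := by
    ext f
    simp only [SetLike.mem_coe, mem_symL2_iff, Set.mem_iInter, Set.mem_ofPred_eq]
  rw [this]
  exact isClosed_iInter fun σ => isClosed_eq (LinearIsometry.continuous _) continuous_id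

instance (ρ μ : ℝ) (N : ℕ) : CompleteSpace (symL2 ρ μ N) :=
  (isClosed_symL2 ρ μ N).completeSpace_coe

/-- The Hilbert space `L²_s(R, Γ) = ⨁_N L²_s(ℝ^N, a_N γ_N)` (Hilbert sum). -/
abbrev Space (ρ μ : ℝ) : Type := lp (fun N : ℕ => symL2 ρ μ N) 2

/-- The state (sequence of functions) underlying a vector of the Hilbert space. -/
def toState {ρ μ : ℝ} (h : Space ρ μ) : State := fun N =>
  ((h N : Lp ℝ 2 (levelMeasure ρ μ N)) : (Fin N → ℝ) → ℝ)

/-- Equality of states up to null sets on every level. -/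
def AEEqState (ρ μ : ℝ) (F G : State) : Prop :=
  ∀ N, F N =ᵐ[levelMeasure ρ μ N] G N

/-- The vector `h` of the Hilbert space is (the class of) the state `F`. -/
def Represents {ρ μ : ℝ} (h : Space ρ μ) (F : State) : Prop :=
  AEEqState ρ μ (toState h) F

/-! ### Well-definedness of the generator on classes of functions -/

lemma weight_pos {ρ μ : ℝ} (hρ : 0 < ρ) (hμ : 0 < μ) (N : ℕ) : 0 < weight ρ μ N := by
  unfold weight; positivity

lemma ae_level_iff {ρ μ : ℝ} (hρ : 0 < ρ) (hμ : 0 < μ) {N : ℕ} {p : (Fin N → ℝ) → Prop} :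
    (∀ᵐ v ∂levelMeasure ρ μ N, p v) ↔ ∀ᵐ v, p v := by
  have hm : Measurable (fun v : Fin N → ℝ => ENNReal.ofReal (weight ρ μ N * maxwell v)) :=
    (continuous_const.mul continuous_maxwell).measurable.ennreal_ofReal
  rw [levelMeasure, ae_withDensity_iff hm]
  refine Filter.eventually_congr (Filter.Eventually.of_forall fun v => ?_)
  have : ENNReal.ofReal (weight ρ μ N * maxwell v) ≠ 0 := by
    simpa using mul_pos (weight_pos hρ hμ N) (maxwell_pos v)
  simp [this]

lemma integrable_maxwell (N : ℕ) : Integrable (maxwell : (Fin N → ℝ) → ℝ) := by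
  have h : Integrable (fun v : Fin N → ℝ => ∏ i, Real.exp (-Real.pi * v i ^ 2)) :=
    Integrable.fintype_prod (f := fun _ : Fin N => fun x : ℝ => Real.exp (-Real.pi * x ^ 2))
      fun _ => integrable_exp_neg_mul_sq Real.pi_pos
  refine h.congr (Filter.Eventually.of_forall fun v => ?_)
  simp only [maxwell, Finset.mul_sum, Real.exp_sum]

instance (ρ μ : ℝ) (N : ℕ) : IsFiniteMeasure (levelMeasure ρ μ N) :=
  isFiniteMeasure_withDensity_ofReal ((integrable_maxwell N).const_mul _).2

lemma integrable_toState {ρ μ : ℝ} (hρ : 0 < ρ) (hμ : 0 < μ) (h : Space ρ μ) (N : ℕ) :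
    Integrable (fun v => maxwell v * toState h N v) := by
  have h1 : Integrable (toState h N) (levelMeasure ρ μ N) :=
    (Lp.memLp (h N : Lp ℝ 2 (levelMeasure ρ μ N))).integrable (by norm_num)
  have hm : Measurable (fun v : Fin N → ℝ => ENNReal.ofReal (weight ρ μ N * maxwell v)) :=
    (continuous_const.mul continuous_maxwell).measurable.ennreal_ofReal
  rw [levelMeasure, integrable_withDensity_iff_integrable_smul' hm (by simp)] at h1
  refine (h1.const_mul (weight ρ μ N)⁻¹).congr (Filter.Eventually.of_forall fun v => ?_)
  have hw := weight_pos hρ hμ N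
  simp only [smul_eq_mul]
  rw [ENNReal.toReal_ofReal (mul_pos hw (maxwell_pos v)).le]
  field_simp

lemma ae_removeNth {N : ℕ} (i : Fin (N + 1)) {p : (Fin N → ℝ) → Prop} (hp : ∀ᵐ v, p v) :
    ∀ᵐ v : Fin (N + 1) → ℝ, p (i.removeNth v) := by
  have h := volume_preserving_piFinSuccAbove (fun _ : Fin (N + 1) => ℝ) i
  have h2 : ∀ᵐ z : ℝ × (Fin N → ℝ), p z.2 := Measure.quasiMeasurePreserving_snd.ae hp
  exact h.quasiMeasurePreserving.ae h2

lemma ae_insertNth {N : ℕ} (i : Fin (N + 1)) {p : (Fin (N + 1) → ℝ) → Prop}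
    (hp : ∀ᵐ v, p v) : ∀ᵐ v : Fin N → ℝ, ∀ᵐ w : ℝ, p (i.insertNth w v) := by
  have h := (volume_preserving_piFinSuccAbove (fun _ : Fin (N + 1) => ℝ) i).symm
  have h2 : ∀ᵐ z : ℝ × (Fin N → ℝ), p (i.insertNth z.1 z.2) := h.quasiMeasurePreserving.ae hp
  have h3 : ∀ᵐ z : (Fin N → ℝ) × ℝ, p (i.insertNth z.2 z.1) :=
    Measure.measurePreserving_swap.quasiMeasurePreserving.ae h2
  exact Measure.ae_ae_of_ae_prod h3

lemma maxwell_insertNth {N : ℕ} (i : Fin (N + 1)) (w : ℝ) (v : Fin N → ℝ) :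
    maxwell (i.insertNth w v : Fin (N + 1) → ℝ) =
      Real.exp (-Real.pi * w ^ 2) * maxwell v := by
  simp only [maxwell]
  rw [← Real.exp_add, Fin.sum_univ_succAbove _ i]
  simp [mul_add]

lemma integrable_insertNth {N : ℕ} (i : Fin (N + 1)) {f : (Fin (N + 1) → ℝ) → ℝ}
    (hf : Integrable (fun v => maxwell v * f v)) :
    ∀ᵐ v : Fin N → ℝ,
      Integrable (fun w : ℝ => Real.exp (-Real.pi * w ^ 2) * f (i.insertNth w v)) := by
  have h := (volume_preserving_piFinSuccAbove (fun _ : Fin (N + 1) => ℝ) i).symm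
  have h2 := h.integrable_comp_of_integrable hf
  have h3 := h2.prod_left_ae
  filter_upwards [h3] with v hv
  refine (hv.const_mul (maxwell v)⁻¹).congr (Filter.Eventually.of_forall fun w => ?_)
  have hpos := maxwell_pos v
  change (maxwell v)⁻¹ * (maxwell (i.insertNth w v : Fin (N + 1) → ℝ) * f (i.insertNth w v)) = _
  rw [maxwell_insertNth]
  field_simp

lemma rot_sum_sq {N : ℕ} {i j : Fin N} (hij : i ≠ j) (θ : ℝ) (v : Fin N → ℝ) :
    ∑ k, rot i j θ v k ^ 2 = ∑ k, v k ^ 2 := by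
  have key : ∀ g : Fin N → ℝ, ∑ k, g k =
      g i + (g j + ∑ k ∈ (Finset.univ.erase i).erase j, g k) := by
    intro g
    rw [Finset.add_sum_erase _ _ (by simp [hij.symm]), Finset.add_sum_erase _ _ (by simp)]
  rw [key (fun k => rot i j θ v k ^ 2), key (fun k => v k ^ 2)]
  have h1 : ∑ k ∈ (Finset.univ.erase i).erase j, rot i j θ v k ^ 2 =
      ∑ k ∈ (Finset.univ.erase i).erase j, v k ^ 2 := by
    refine Finset.sum_congr rfl fun k hk => ?_
    simp only [Finset.mem_erase] at hk
    simp [rot, hk.1, hk.2.1]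
  rw [h1]
  simp only [rot, if_true, hij.symm, if_false]
  linear_combination (v i ^ 2 + v j ^ 2) * Real.cos_sq_add_sin_sq θ

lemma continuous_rot {N : ℕ} (i j : Fin N) :
    Continuous (fun z : ℝ × (Fin N → ℝ) => rot i j z.1 z.2) := by
  refine continuous_pi fun k => ?_
  unfold rot
  split_ifs <;> fun_prop

lemma measurePreserving_rot {N : ℕ} {i j : Fin N} (hij : i ≠ j) (θ : ℝ) :
    MeasurePreserving (rot i j θ) volume volume := by
  let L : EuclideanSpace ℝ (Fin N) →ₗᵢ[ℝ] EuclideanSpace ℝ (Fin N) :=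
    { toFun := fun x => WithLp.toLp 2 (rot i j θ (WithLp.ofLp x))
      map_add' := fun x y => by
        ext k
        simp only [rot, WithLp.ofLp_add, Pi.add_apply]
        split_ifs <;> ring
      map_smul' := fun c x => by
        ext k
        simp only [rot, WithLp.ofLp_smul, Pi.smul_apply, smul_eq_mul, RingHom.id_apply]
        split_ifs <;> ring
      norm_map' := fun x => by
        simp only [LinearMap.coe_mk, AddHom.coe_mk]
        rw [EuclideanSpace.norm_eq, EuclideanSpace.norm_eq]
        simp only [Real.norm_eq_abs, sq_abs]
        rw [rot_sum_sq hij] }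
  have h1 := (L.toLinearIsometryEquiv rfl).measurePreserving
  have h2 := (PiLp.volume_preserving_ofLp (Fin N)).comp
    (h1.comp (PiLp.volume_preserving_toLp (Fin N)))
  exact h2

lemma measurePreserving_rot_prod {N : ℕ} {i j : Fin N} (hij : i ≠ j) :
    MeasurePreserving (fun z : ℝ × (Fin N → ℝ) => (z.1, rot i j z.1 z.2))
      ((volume.restrict (Set.Ioc 0 (2 * Real.pi))).prod volume)
      ((volume.restrict (Set.Ioc 0 (2 * Real.pi))).prod volume) :=
  (MeasurePreserving.id _).skew_product (g := fun θ v => rot i j θ v)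
    (continuous_rot i j).measurable
    (Filter.Eventually.of_forall fun θ => (measurePreserving_rot hij θ).map_eq)

lemma ae_rot {N : ℕ} {i j : Fin N} (hij : i ≠ j) {p : (Fin N → ℝ) → Prop}
    (hp : ∀ᵐ v, p v) :
    ∀ᵐ v : Fin N → ℝ, ∀ᵐ θ ∂(volume.restrict (Set.Ioc 0 (2 * Real.pi))), p (rot i j θ v) := by
  have h2 : ∀ᵐ z ∂((volume.restrict (Set.Ioc 0 (2 * Real.pi))).prod
      (volume : Measure (Fin N → ℝ))), p z.2 := Measure.quasiMeasurePreserving_snd.ae hp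
  have h3 := (measurePreserving_rot_prod hij).quasiMeasurePreserving.ae h2
  have h4 := (Measure.measurePreserving_swap
    (μ := (volume : Measure (Fin N → ℝ)))
    (ν := volume.restrict (Set.Ioc 0 (2 * Real.pi)))).quasiMeasurePreserving.ae h3
  exact Measure.ae_ae_of_ae_prod h4

lemma integrable_rot {N : ℕ} {i j : Fin N} (hij : i ≠ j) {f : (Fin N → ℝ) → ℝ}
    (hf : Integrable (fun v => maxwell v * f v)) :
    ∀ᵐ v : Fin N → ℝ,
      IntervalIntegrable (fun θ => f (rot i j θ v)) volume 0 (2 * Real.pi) := by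
  have h2 := hf.comp_snd (volume.restrict (Set.Ioc 0 (2 * Real.pi)))
  have h3 := ((measurePreserving_rot_prod hij).integrable_comp_of_integrable h2).prod_left_ae
  filter_upwards [h3] with v hv
  rw [intervalIntegrable_iff_integrableOn_Ioc_of_le (by positivity)]
  refine (hv.const_mul (maxwell v)⁻¹).congr (Filter.Eventually.of_forall fun θ => ?_)
  have hpos := maxwell_pos v
  change (maxwell v)⁻¹ * (maxwell (rot i j θ v) * f (rot i j θ v)) = _
  have : maxwell (rot i j θ v) = maxwell v := by simp only [maxwell, rot_sum_sq hij]
  rw [this]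
  field_simp

lemma genExpr_lin {ρ μ lam : ℝ} {F G H : State} (a b : ℝ)
    (hF : ∀ N, Integrable (fun v => maxwell v * F N v))
    (hG : ∀ N, Integrable (fun v => maxwell v * G N v))
    (hH : ∀ N, ∀ᵐ v, H N v = a * F N v + b * G N v) (N : ℕ) :
    ∀ᵐ v, genExpr ρ μ lam H N v =
      a * genExpr ρ μ lam F N v + b * genExpr ρ μ lam G N v := by
  have hplus : ∀ᵐ v, Pplus H N v = a * Pplus F N v + b * Pplus G N v := by
    cases N with
    | zero => simp [Pplus]
    | succ N =>
      have h := ae_all_iff.2 fun i : Fin (N + 1) => ae_removeNth i (hH N)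
      filter_upwards [h] with v hv
      simp only [Pplus, hv, Finset.sum_add_distrib, Finset.mul_sum]
  have hminus : ∀ᵐ v, Pminus H N v = a * Pminus F N v + b * Pminus G N v := by
    have h := ae_all_iff.2 fun i : Fin (N + 1) => ae_insertNth i (hH (N + 1))
    have h1 := ae_all_iff.2 fun i : Fin (N + 1) => integrable_insertNth i (hF (N + 1))
    have h2 := ae_all_iff.2 fun i : Fin (N + 1) => integrable_insertNth i (hG (N + 1))
    filter_upwards [h, h1, h2] with v hv hv1 hv2
    have : ∀ i : Fin (N + 1),
        ∫ w : ℝ, Real.exp (-Real.pi * w ^ 2) * H (N + 1) (i.insertNth w v) =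
        a * (∫ w : ℝ, Real.exp (-Real.pi * w ^ 2) * F (N + 1) (i.insertNth w v)) +
        b * (∫ w : ℝ, Real.exp (-Real.pi * w ^ 2) * G (N + 1) (i.insertNth w v)) := by
      intro i
      rw [← integral_const_mul, ← integral_const_mul,
        ← integral_add ((hv1 i).const_mul a) ((hv2 i).const_mul b)]
      refine integral_congr_ae ?_
      filter_upwards [hv i] with w hw
      rw [hw]; ring
    simp only [Pminus, this, Finset.sum_add_distrib, ← Finset.mul_sum]
    ring
  have hkac : ∀ᵐ v, Kac H N v = a * Kac F N v + b * Kac G N v := by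
    have h := ae_all_iff.2 fun p : {p : Fin N × Fin N // p.1 < p.2} =>
      ae_rot (ne_of_lt p.2) (hH N)
    have h1 := ae_all_iff.2 fun p : {p : Fin N × Fin N // p.1 < p.2} =>
      integrable_rot (ne_of_lt p.2) (hF N)
    have h2 := ae_all_iff.2 fun p : {p : Fin N × Fin N // p.1 < p.2} =>
      integrable_rot (ne_of_lt p.2) (hG N)
    filter_upwards [h, h1, h2, hH N] with v hv hv1 hv2 hv3
    simp only [Kac, Finset.mul_sum]
    rw [← Finset.sum_add_distrib]
    refine Finset.sum_congr rfl fun p hp => ?_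
    have hp' : p.1 < p.2 := (Finset.mem_filter.1 hp).2
    have : ∫ θ in (0 : ℝ)..(2 * Real.pi), H N (rot p.1 p.2 θ v) =
        a * (∫ θ in (0 : ℝ)..(2 * Real.pi), F N (rot p.1 p.2 θ v)) +
        b * (∫ θ in (0 : ℝ)..(2 * Real.pi), G N (rot p.1 p.2 θ v)) := by
      rw [← intervalIntegral.integral_const_mul, ← intervalIntegral.integral_const_mul,
        ← intervalIntegral.integral_add ((hv1 ⟨p, hp'⟩).const_mul a)
          ((hv2 ⟨p, hp'⟩).const_mul b),
        intervalIntegral.integral_of_le (by positivity),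
        intervalIntegral.integral_of_le (by positivity)]
      exact integral_congr_ae (hv ⟨p, hp'⟩)
    simp only [Rcol, this, hv3]
    ring
  filter_upwards [hplus, hminus, hkac, hH N] with v h1 h2 h3 h4
  simp only [genExpr, Num, h1, h2, h3, h4]
  ring

lemma toState_lin {ρ μ : ℝ} (a b : ℝ) (h k : Space ρ μ) (N : ℕ) :
    ∀ᵐ v ∂levelMeasure ρ μ N,
      toState (a • h + b • k) N v = a * toState h N v + b * toState k N v := by
  have h0 := Lp.coeFn_add (a • (h N : Lp ℝ 2 (levelMeasure ρ μ N))) (b • (k N : Lp ℝ 2 _))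
  have h1 := Lp.coeFn_smul a (h N : Lp ℝ 2 (levelMeasure ρ μ N))
  have h2 := Lp.coeFn_smul b (k N : Lp ℝ 2 (levelMeasure ρ μ N))
  filter_upwards [h0, h1, h2] with v hv hv1 hv2
  refine hv.trans ?_
  simp only [Pi.add_apply, hv1, hv2]
  rfl

lemma Represents.unique {ρ μ : ℝ} {g g' : Space ρ μ} {F : State}
    (h : Represents g F) (h' : Represents g' F) : g = g' :=
  lp.ext (funext fun N => Subtype.ext (Lp.ext ((h N).trans (h' N).symm)))

lemma represents_lin {ρ μ lam : ℝ} (hρ : 0 < ρ) (hμ : 0 < μ) (a b : ℝ) {h k g l : Space ρ μ}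
    (hg : Represents g (genExpr ρ μ lam (toState h)))
    (hl : Represents l (genExpr ρ μ lam (toState k))) :
    Represents (a • g + b • l) (genExpr ρ μ lam (toState (a • h + b • k))) := by
  intro N
  have h0 := genExpr_lin (ρ := ρ) (μ := μ) (lam := lam) a b
    (integrable_toState hρ hμ h) (integrable_toState hρ hμ k)
    (fun N => (ae_level_iff hρ hμ).1 (toState_lin a b h k N)) N
  filter_upwards [(ae_level_iff hρ hμ).2 h0, toState_lin a b g l N, hg N, hl N]
    with v h1 h2 h3 h4
  rw [h1, h2, h3, h4]

/-! ### The generator as an unbounded operator -/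

/-- The generator `ρ (P⁺ - N) + μ (P⁻ - Id) + lam K` on its maximal domain, which consists of
all `h` in the Hilbert space for which the state `ρ (P⁺ h - N h) + μ (P⁻ h - h) + lam K h`
is again (the class of) a vector of the Hilbert space. -/
def generator (ρ μ lam : ℝ) (hρ : 0 < ρ) (hμ : 0 < μ) : Space ρ μ →ₗ.[ℝ] Space ρ μ where
  domain :=
    { carrier := {h | ∃ g : Space ρ μ, Represents g (genExpr ρ μ lam (toState h))}
      zero_mem' := by
        have h0 := genExpr_lin (ρ := ρ) (μ := μ) (lam := lam) 0 0
          (integrable_toState hρ hμ (0 : Space ρ μ)) (integrable_toState hρ hμ (0 : Space ρ μ))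
          (fun N => (ae_level_iff hρ hμ).1 (toState_lin 0 0 (0 : Space ρ μ) 0 N))
        refine ⟨0, fun N => ?_⟩
        have h1 := toState_lin 0 0 (0 : Space ρ μ) 0 N
        simp only [zero_smul, add_zero, zero_mul] at h0 h1
        filter_upwards [(ae_level_iff hρ hμ).2 (h0 N), h1] with v hv hv1
        rw [hv, hv1]
      add_mem' := by
        rintro h k ⟨g, hg⟩ ⟨l, hl⟩
        exact ⟨_, by simpa using represents_lin hρ hμ 1 1 hg hl⟩
      smul_mem' := by
        rintro c h ⟨g, hg⟩
        exact ⟨_, by simpa using represents_lin hρ hμ c 0 hg hg⟩ }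
  toFun :=
    { toFun := fun h => h.2.choose
      map_add' := fun h k => (h + k).2.choose_spec.unique (by
        simpa using represents_lin hρ hμ 1 1 h.2.choose_spec k.2.choose_spec)
      map_smul' := fun c h => (c • h).2.choose_spec.unique (by
        simpa using represents_lin hρ hμ c 0 h.2.choose_spec h.2.choose_spec) }

/-- The eigenspace of an unbounded operator `A` for `c`: all `h` in the domain of `A` with
`A h = c h`. -/
def eigenspace {H : Type*} [AddCommGroup H] [Module ℝ H] (A : H →ₗ.[ℝ] H) (c : ℝ) :
    Submodule ℝ H where
  carrier := {h | ∃ hh : h ∈ A.domain, A ⟨h, hh⟩ = c • h}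
  zero_mem' := ⟨A.domain.zero_mem, by
    rw [smul_zero]; exact A.map_zero⟩
  add_mem' := by
    rintro h k ⟨h1, h2⟩ ⟨k1, k2⟩
    refine ⟨A.domain.add_mem h1 k1, ?_⟩
    rw [smul_add, ← h2, ← k2, ← A.map_add]; rfl
  smul_mem' := by
    rintro a h ⟨h1, h2⟩
    refine ⟨A.domain.smul_mem a h1, ?_⟩
    rw [smul_comm, ← h2, ← A.map_smul]; rfl

/-- The values `(h, A h)` for `h` in the domain of `A` with `‖h‖ = 1` and `h ⊥ E`. -/
def rayleighValues {H : Type*} [NormedAddCommGroup H] [InnerProductSpace ℝ H]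
    (A : H →ₗ.[ℝ] H) (E : Submodule ℝ H) : Set ℝ :=
  {x | ∃ h : A.domain, ‖(h : H)‖ = 1 ∧ (h : H) ∈ Eᗮ ∧ x = inner ℝ (h : H) (A h)}

/-- `Δ = sup {(h, A h) | h ∈ D(A), ‖h‖ = 1, h ⊥ E}`. -/
def gap {H : Type*} [NormedAddCommGroup H] [InnerProductSpace ℝ H]
    (A : H →ₗ.[ℝ] H) (E : Submodule ℝ H) : ℝ := sSup (rayleighValues A E)

end KacReservoir

end

/-! Write `B`, `C` for creation `P⁺` and annihilation `P⁻` between consecutive levels and `ν = μ/ρ`.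
For the weighted inner products `B` is `ν` times the adjoint of `C`, and `CB = BC + 1`; the
collision operator `K` is symmetric and nonpositive on each level. The `Ladder` structure records
these facts together with the constants `one n`, and most of the operator theory uses nothing else.

Self-adjointness. Summing by parts over levels `≤ N`, the difference of the two sides of the
symmetry relation is a boundary term of size `√N` times the squared norms on levels `N` and `N + 1`.
These norms are summable, so by divergence of the harmonic series the boundary term is small for
infinitely many `N`, and symmetry follows (`isFormalAdjoint`). Testing the adjoint against one-level
vectors shows that it acts by the same level-wise expression, hence lives on the maximal domain
(`isSelfAdjoint`).

Gap. The same summation turns the form into minus the sum of `μ‖C h_{n+1} - h_n‖²` and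
`ρ((n+1)‖h_{n+1}‖² - ν‖C h_{n+1}‖²)`, plus the nonpositive collision part. Split each level into its
mean and a part orthogonal to constants. On the orthogonal part the commutation relation gives `BC ≤
n` on level `n + 1` (`norm_C_sq_le_of_inner_one`), so the second term is at least `ρ` times the
squared norm. On the means the second term cancels and the first is a discrete Dirichlet form,
controlled by the Poincaré inequality for Poisson weights (`poisson_poincare`). Together they give
`inner_apply_le`, with constant `ρ`.

Eigenspace. After subtracting a multiple of `e₁`, an eigenvector for `-ρ` has mean zero on level
zero, and a recursion makes all its means vanish. Equality in the gap estimate then forces `C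
g_{n+1} = g_n`, `K g_n = 0` and `B g_n = n g_{n+1}` (`eigenvector_structure`), so level one
determines `g`. There `g` is a one-particle function `φ` with mean zero such that `φ(v₁) + φ(v₂)` is
rotation invariant. Invariance under `π/4` makes `φ` a Gaussian smoothing of itself, hence
continuous; then `φ` is affine in `v²` by Cauchy's functional equation, and mean zero leaves
multiples of `2πv² - 1` (`ae_eq_mul_chi`). -/

namespace KacReservoir

/-! ### The Poincaré inequality for Poisson weights -/

section Poisson

variable {ν : ℝ} {a : ℕ → ℝ}

/-- Cauchy–Schwarz on the path from `n` to `N`, whose length is the factor `N - n`, followed by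
exchanging the two summations. -/
lemma sum_mul_sq_sub_le (ha : ∀ n, 0 ≤ a n) (c : ℕ → ℝ) (N : ℕ) :
    ∑ n ∈ Finset.range N, a n * (c N - c n) ^ 2 ≤
      ∑ k ∈ Finset.range N, (c (k + 1) - c k) ^ 2 *
        ∑ n ∈ Finset.range (k + 1), a n * ((N : ℝ) - n) := by
  have h1 : ∀ n ∈ Finset.range N, a n * (c N - c n) ^ 2 ≤
      ∑ k ∈ Finset.Ico n N, (c (k + 1) - c k) ^ 2 * (a n * ((N : ℝ) - n)) := by
    intro n hn
    have hn' : n ≤ N := (Finset.mem_range.1 hn).le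
    have h2 : c N - c n = ∑ k ∈ Finset.Ico n N, (c (k + 1) - c k) := by
      rw [Finset.sum_Ico_sub c hn']
    have h3 := sq_sum_le_card_mul_sum_sq (s := Finset.Ico n N) (f := fun k => c (k + 1) - c k)
    rw [Nat.card_Ico, Nat.cast_sub hn'] at h3
    rw [← Finset.sum_mul, h2]
    calc _ ≤ a n * (((N : ℝ) - n) * ∑ k ∈ Finset.Ico n N, (c (k + 1) - c k) ^ 2) :=
          mul_le_mul_of_nonneg_left h3 (ha n)
      _ = _ := by ring
  refine (Finset.sum_le_sum h1).trans (le_of_eq ?_)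
  rw [Finset.sum_comm' (t' := Finset.range N) (s' := fun k => Finset.range (k + 1))]
  · simp only [Finset.mul_sum]
  · intro n k
    simp only [Finset.mem_range, Finset.mem_Ico]
    omega

lemma sum_mul_cast (ha1 : ∀ n : ℕ, ((n : ℝ) + 1) * a (n + 1) = ν * a n) (k : ℕ) :
    ∑ n ∈ Finset.range (k + 1), a n * (n : ℝ) = ν * ∑ n ∈ Finset.range k, a n := by
  rw [Finset.sum_range_succ', Finset.mul_sum]
  simp only [Nat.cast_zero, mul_zero, add_zero]
  refine Finset.sum_congr rfl fun n _ => ?_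
  rw [← ha1 n]; push_cast; ring

/-- The Poincaré inequality for truncated Poisson weights. -/
lemma poisson_poincare (hν : 0 ≤ ν) (ha : ∀ n, 0 ≤ a n)
    (ha1 : ∀ n : ℕ, ((n : ℝ) + 1) * a (n + 1) = ν * a n)
    (hA : ∀ N, ∑ n ∈ Finset.range N, a n ≤ 1) (c : ℕ → ℝ) (N : ℕ) :
    (∑ n ∈ Finset.range (N + 1), a n) * (∑ n ∈ Finset.range (N + 1), a n * c n ^ 2) -
      (∑ n ∈ Finset.range (N + 1), a n * c n) ^ 2 ≤
    ∑ k ∈ Finset.range N, ν * (a k * (c (k + 1) - c k) ^ 2) := by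
  set A : ℕ → ℝ := fun k => ∑ n ∈ Finset.range k, a n with hAdef
  have hAs : ∀ k, A (k + 1) = A k + a k := fun k => Finset.sum_range_succ _ _
  -- These sharper weights are chosen for the induction: adding level `N + 1` raises the left side
  -- by `a (N + 1) * ∑ a n * (c (N + 1) - c n) ^ 2`, and the path bound for this sum is exactly the
  -- growth of the weights, by the recursion `ha1`. Note that `A k` stops at `a (k - 1)`.
  have key : ∀ N : ℕ, A (N + 1) * (∑ n ∈ Finset.range (N + 1), a n * c n ^ 2) -
      (∑ n ∈ Finset.range (N + 1), a n * c n) ^ 2 ≤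
      ∑ k ∈ Finset.range N, (c (k + 1) - c k) ^ 2 *
        (ν * (A (k + 1) * A N - A (N + 1) * A k)) := by
    intro N
    induction N with
    | zero => simp [hAdef]; nlinarith
    | succ N ih =>
      have hinc := mul_le_mul_of_nonneg_left (sum_mul_sq_sub_le ha c (N + 1)) (ha (N + 1))
      have hexp : ∑ n ∈ Finset.range (N + 1), a n * (c (N + 1) - c n) ^ 2 =
          c (N + 1) ^ 2 * A (N + 1) - 2 * c (N + 1) * (∑ n ∈ Finset.range (N + 1), a n * c n) +
            ∑ n ∈ Finset.range (N + 1), a n * c n ^ 2 := by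
        simp only [hAdef, Finset.mul_sum]
        rw [← Finset.sum_sub_distrib, ← Finset.sum_add_distrib]
        exact Finset.sum_congr rfl fun n _ => by ring
      have hlhs : A (N + 1 + 1) * (∑ n ∈ Finset.range (N + 1 + 1), a n * c n ^ 2) -
          (∑ n ∈ Finset.range (N + 1 + 1), a n * c n) ^ 2 =
          (A (N + 1) * (∑ n ∈ Finset.range (N + 1), a n * c n ^ 2) -
            (∑ n ∈ Finset.range (N + 1), a n * c n) ^ 2) +
          a (N + 1) * ∑ n ∈ Finset.range (N + 1), a n * (c (N + 1) - c n) ^ 2 := by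
        rw [hexp, Finset.sum_range_succ _ (N + 1), Finset.sum_range_succ _ (N + 1), hAs (N + 1)]
        ring
      have hrhs : ∑ k ∈ Finset.range (N + 1), (c (k + 1) - c k) ^ 2 *
            (ν * (A (k + 1) * A (N + 1) - A (N + 1 + 1) * A k)) =
          ∑ k ∈ Finset.range N, (c (k + 1) - c k) ^ 2 *
            (ν * (A (k + 1) * A N - A (N + 1) * A k)) +
          a (N + 1) * ∑ k ∈ Finset.range (N + 1), (c (k + 1) - c k) ^ 2 *
            ∑ n ∈ Finset.range (k + 1), a n * (((N + 1 : ℕ) : ℝ) - n) := by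
        -- The extra term `k = N` is free, its weight being `A (N + 1) * A N - A (N + 1) * A N = 0`.
        have h0 : ∑ k ∈ Finset.range N, (c (k + 1) - c k) ^ 2 *
            (ν * (A (k + 1) * A N - A (N + 1) * A k)) =
            ∑ k ∈ Finset.range (N + 1), (c (k + 1) - c k) ^ 2 *
            (ν * (A (k + 1) * A N - A (N + 1) * A k)) := by
          rw [Finset.sum_range_succ]; ring
        rw [h0, Finset.mul_sum, ← Finset.sum_add_distrib]
        refine Finset.sum_congr rfl fun k _ => ?_
        have h1 : ∑ n ∈ Finset.range (k + 1), a n * (((N + 1 : ℕ) : ℝ) - n) =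
            ((N : ℝ) + 1) * A (k + 1) - ν * A k := by
          rw [← sum_mul_cast ha1, hAdef, Finset.mul_sum, ← Finset.sum_sub_distrib]
          exact Finset.sum_congr rfl fun n _ => by push_cast; ring
        rw [h1, hAs (N + 1), hAs N]
        linear_combination (- (c (k + 1) - c k) ^ 2 * A (k + 1)) * ha1 N
      rw [hlhs, hrhs]
      exact add_le_add ih hinc
  refine (key N).trans (Finset.sum_le_sum fun k _ => ?_)
  have hA0 : ∀ k, 0 ≤ A k := fun k => Finset.sum_nonneg fun n _ => ha n
  have h1 : A (k + 1) * A N - A (N + 1) * A k ≤ a k := by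
    have h2 : A (k + 1) * A N ≤ A (k + 1) * A (N + 1) :=
      mul_le_mul_of_nonneg_left (by rw [hAs]; linarith [ha N]) (hA0 _)
    have h3 : A (N + 1) * a k ≤ 1 * a k := mul_le_mul_of_nonneg_right (hA _) (ha k)
    have h4 : A (k + 1) * A (N + 1) = A (N + 1) * A k + A (N + 1) * a k := by rw [hAs k]; ring
    linarith
  have h2 := mul_le_mul_of_nonneg_left (mul_le_mul_of_nonneg_left h1 hν)
    (sq_nonneg (c (k + 1) - c k))
  linarith

end Poisson

/-! ### A Carleman type criterion -/

/-- If `|q n| ≥ ε` from some point on, then `1 / (n + 1) ≤ (C / ε) * t n` there, and the harmonic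
series would converge. This disposes of boundary terms that are not known to tend to zero. -/
lemma frequently_abs_lt_of_le_sqrt_mul {q t : ℕ → ℝ} {C : ℝ} (ht : Summable t)
    (ht0 : ∀ n, 0 ≤ t n) (hq : ∀ n : ℕ, |q n| ≤ C * (√((n : ℝ) + 1) * t n)) {ε : ℝ}
    (hε : 0 < ε) : ∃ᶠ n in Filter.atTop, |q n| < ε := by
  intro hcon
  simp only [not_lt] at hcon
  have hs : Summable fun n : ℕ => 1 / ((n : ℝ) + 1) := by
    refine summable_of_isBigO_nat ht ?_
    refine Asymptotics.IsBigO.of_bound (C / ε) ?_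
    filter_upwards [hcon] with n hn
    have h1 : ε ≤ C * (√((n : ℝ) + 1) * t n) := hn.trans (hq n)
    have hn1 : (1 : ℝ) ≤ (n : ℝ) + 1 := by linarith [n.cast_nonneg (α := ℝ)]
    have h2 : √((n : ℝ) + 1) ≤ (n : ℝ) + 1 := Real.sqrt_le_iff.2 ⟨by linarith, by nlinarith⟩
    rw [Real.norm_of_nonneg (by positivity), Real.norm_of_nonneg (ht0 n), div_mul_eq_mul_div,
      div_le_div_iff₀ (by positivity) hε]
    have hC : 0 ≤ C := by
      by_contra h
      have : C * (√((n : ℝ) + 1) * t n) ≤ 0 :=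
        mul_nonpos_of_nonpos_of_nonneg (not_le.1 h).le (mul_nonneg (Real.sqrt_nonneg _) (ht0 n))
      linarith
    have h3 : C * (√((n : ℝ) + 1) * t n) ≤ C * (((n : ℝ) + 1) * t n) :=
      mul_le_mul_of_nonneg_left (mul_le_mul_of_nonneg_right h2 (ht0 n)) hC
    nlinarith
  have h := (summable_nat_add_iff (f := fun n : ℕ => 1 / (n : ℝ)) 1).1 (by simpa using hs)
  exact Real.not_summable_one_div_natCast h

/-- Since `S + q` converges along the whole sequence, its limit may be computed at those indices
where the error `q` is small. -/
lemma le_of_tendsto_of_frequently_lt {S q U : ℕ → ℝ} {l u : ℝ}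
    (hl : Filter.Tendsto (fun n => S n + q n) Filter.atTop (nhds l))
    (hq : ∀ ε > 0, ∃ᶠ n in Filter.atTop, |q n| < ε)
    (hS : ∀ᶠ n in Filter.atTop, S n ≤ U n)
    (hU : Filter.Tendsto U Filter.atTop (nhds u)) : l ≤ u := by
  refine le_of_forall_pos_le_add fun ε hε => ?_
  refine le_of_tendsto_of_tendsto_of_frequently hl (hU.add_const ε) ?_
  refine ((hq ε hε).and_eventually hS).mono fun n hn => ?_
  have := (abs_lt.1 hn.1).2
  linarith [hn.2]

end KacReservoir

/-! ### Abstract operator theory from the commutation relation. -/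

namespace KacReservoir

/-! ### Ladders of Hilbert spaces -/

/-- Raising and lowering maps `B`, `C` between consecutive levels `E n`, adjoint to each other up
to the factor `ν` and satisfying the canonical commutation relation, together with a symmetric
nonpositive map `K` on every level and distinguished vectors `one n`. -/
structure Ladder (E : ℕ → Type*) [∀ n, NormedAddCommGroup (E n)]
    [∀ n, InnerProductSpace ℝ (E n)] (ν : ℝ) (a : ℕ → ℝ) where
  B : ∀ n, E n → E (n + 1)
  C : ∀ n, E (n + 1) → E n
  K : ∀ n, E n → E n
  one : ∀ n, E n
  adj : ∀ n x y, inner ℝ (B n x) y = ν * inner ℝ x (C n y)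
  K_symm : ∀ n x y, inner ℝ (K n x) y = inner ℝ x (K n y)
  K_nonpos : ∀ n x, inner ℝ x (K n x) ≤ 0
  comm_zero : ∀ x, C 0 (B 0 x) = x
  comm : ∀ n x, C (n + 1) (B (n + 1) x) = B n (C n x) + x
  B_one : ∀ n, B n (one n) = ((n : ℝ) + 1) • one (n + 1)
  C_one : ∀ n, C n (one (n + 1)) = one n
  K_one : ∀ n, K n (one n) = 0
  inner_one : ∀ n, inner ℝ (one n) (one n) = a n
  eq_zero : ∀ x : E 0, inner ℝ x (one 0) = 0 → x = 0

namespace Ladder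

variable {E : ℕ → Type*} [∀ n, NormedAddCommGroup (E n)] [∀ n, InnerProductSpace ℝ (E n)]
  {ν : ℝ} {a : ℕ → ℝ} (Λ : Ladder E ν a)

lemma norm_one_sq (n : ℕ) : ‖Λ.one n‖ ^ 2 = a n := by
  rw [← real_inner_self_eq_norm_sq, Λ.inner_one]

lemma inner_B_C (n : ℕ) (f : E (n + 1)) :
    inner ℝ (Λ.B n (Λ.C n f)) f = ν * ‖Λ.C n f‖ ^ 2 := by
  rw [Λ.adj, real_inner_self_eq_norm_sq]

lemma norm_B_C_sq_zero (f : E 1) : ‖Λ.B 0 (Λ.C 0 f)‖ ^ 2 = ν * ‖Λ.C 0 f‖ ^ 2 := by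
  rw [← real_inner_self_eq_norm_sq, Λ.adj, Λ.comm_zero, real_inner_self_eq_norm_sq]

lemma norm_B_C_sq (n : ℕ) (f : E (n + 2)) :
    ‖Λ.B (n + 1) (Λ.C (n + 1) f)‖ ^ 2 =
      ν * (ν * ‖Λ.C n (Λ.C (n + 1) f)‖ ^ 2) + ν * ‖Λ.C (n + 1) f‖ ^ 2 := by
  rw [← real_inner_self_eq_norm_sq, Λ.adj, Λ.comm, inner_add_right, real_inner_self_eq_norm_sq,
    real_inner_comm, inner_B_C]
  ring

/-- With `t = ν‖C f‖² = ⟪BC f, f⟫`, Cauchy–Schwarz gives `t² ≤ ‖BC f‖²‖f‖² ≤ k t ‖f‖²`, and `t` can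
be cancelled. Combined with `norm_B_C_sq` this carries a bound for `C` up one level, raising its
constant by one. -/
lemma le_of_norm_B_C_sq_le (hν : 0 < ν) (n : ℕ) {f : E (n + 1)} {k : ℝ} (hk : 0 ≤ k)
    (h : ‖Λ.B n (Λ.C n f)‖ ^ 2 ≤ k * (ν * ‖Λ.C n f‖ ^ 2)) :
    ν * ‖Λ.C n f‖ ^ 2 ≤ k * ‖f‖ ^ 2 := by
  set t := ν * ‖Λ.C n f‖ ^ 2 with ht
  have ht0 : 0 ≤ t := by positivity
  have h1 : t ^ 2 ≤ ‖Λ.B n (Λ.C n f)‖ ^ 2 * ‖f‖ ^ 2 := by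
    rw [ht, ← inner_B_C, ← mul_pow, sq_le_sq, abs_of_nonneg (a := _ * _) (by positivity)]
    exact abs_real_inner_le_norm _ _
  have h2 : t ^ 2 ≤ k * t * ‖f‖ ^ 2 :=
    h1.trans (mul_le_mul_of_nonneg_right h (by positivity))
  rcases ht0.eq_or_lt with h0 | h0
  · rw [← h0]; positivity
  · nlinarith

/-- The bound `C* C ≤ n + 1` on level `n + 1`. -/
lemma norm_C_sq_le (hν : 0 < ν) (n : ℕ) (f : E (n + 1)) :
    ν * ‖Λ.C n f‖ ^ 2 ≤ ((n : ℝ) + 1) * ‖f‖ ^ 2 := by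
  induction n with
  | zero =>
    refine Λ.le_of_norm_B_C_sq_le hν 0 (by positivity) ?_
    rw [norm_B_C_sq_zero]; simp
  | succ n ih =>
    refine Λ.le_of_norm_B_C_sq_le hν (n + 1) (by positivity) ?_
    rw [norm_B_C_sq]
    have := mul_le_mul_of_nonneg_left (ih (Λ.C (n + 1) f)) hν.le
    push_cast
    linarith

lemma inner_C_one (n : ℕ) (f : E (n + 1)) :
    ν * inner ℝ (Λ.C n f) (Λ.one n) = ((n : ℝ) + 1) * inner ℝ f (Λ.one (n + 1)) := by
  rw [real_inner_comm, ← Λ.adj, Λ.B_one, real_inner_smul_left, real_inner_comm]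

/-- The bound `C* C ≤ n` on level `n + 1`, orthogonally to `one`. -/
lemma norm_C_sq_le_of_inner_one (hν : 0 < ν) (n : ℕ) (f : E (n + 1))
    (hf : inner ℝ f (Λ.one (n + 1)) = 0) : ν * ‖Λ.C n f‖ ^ 2 ≤ n * ‖f‖ ^ 2 := by
  have hC : ∀ n (f : E (n + 1)), inner ℝ f (Λ.one (n + 1)) = 0 →
      inner ℝ (Λ.C n f) (Λ.one n) = 0 := fun n f hf => by
    have := Λ.inner_C_one n f
    rw [hf, mul_zero] at this
    exact (mul_eq_zero.1 this).resolve_left hν.ne'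
  induction n with
  -- Here one unit is gained over `norm_C_sq_le`: level zero consists of constants, so `C 0 f`,
  -- being orthogonal to them, vanishes.
  | zero => rw [Λ.eq_zero _ (hC 0 f hf)]; simp
  | succ n ih =>
    refine Λ.le_of_norm_B_C_sq_le hν (n + 1) (by positivity) ?_
    rw [norm_B_C_sq]
    have := mul_le_mul_of_nonneg_left (ih (Λ.C (n + 1) f) (hC _ f hf)) hν.le
    push_cast
    linarith

/-- Linearity is not part of the `Ladder` data; here and in the next lemmas it is forced by the
adjunction, or for `K` by symmetry. -/
lemma C_add (n : ℕ) (hν : 0 < ν) (x y : E (n + 1)) : Λ.C n (x + y) = Λ.C n x + Λ.C n y := by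
  refine ext_inner_left ℝ fun z => mul_left_cancel₀ hν.ne' ?_
  rw [inner_add_right, mul_add]
  simp only [← Λ.adj, inner_add_right]

lemma C_smul (n : ℕ) (hν : 0 < ν) (t : ℝ) (x : E (n + 1)) :
    Λ.C n (t • x) = t • Λ.C n x := by
  refine ext_inner_left ℝ fun z => mul_left_cancel₀ hν.ne' ?_
  rw [real_inner_smul_right, mul_left_comm]
  simp only [← Λ.adj, real_inner_smul_right]

lemma B_smul (n : ℕ) (t : ℝ) (x : E n) : Λ.B n (t • x) = t • Λ.B n x := by
  refine ext_inner_right ℝ fun z => ?_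
  rw [real_inner_smul_left, Λ.adj, Λ.adj, real_inner_smul_left]
  ring

lemma B_zero (n : ℕ) : Λ.B n 0 = 0 := by
  simpa using Λ.B_smul n 0 0

lemma C_zero (n : ℕ) (hν : 0 < ν) : Λ.C n 0 = 0 := by
  simpa using Λ.C_smul n hν 0 0

lemma K_smul (n : ℕ) (t : ℝ) (x : E n) : Λ.K n (t • x) = t • Λ.K n x := by
  refine ext_inner_right ℝ fun z => ?_
  rw [real_inner_smul_left, Λ.K_symm, Λ.K_symm, real_inner_smul_left]

lemma K_zero (n : ℕ) : Λ.K n 0 = 0 := by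
  simpa using Λ.K_smul n 0 0

lemma K_add (n : ℕ) (x y : E n) : Λ.K n (x + y) = Λ.K n x + Λ.K n y := by
  refine ext_inner_right ℝ fun z => ?_
  rw [inner_add_left, Λ.K_symm, Λ.K_symm, Λ.K_symm, inner_add_left]

/-- A vector at which the form of `K` vanishes is in the kernel of `K`. -/
lemma K_eq_zero (n : ℕ) {x : E n} (hx : inner ℝ x (Λ.K n x) = 0) : Λ.K n x = 0 := by
  have h : ∀ t : ℝ, 2 * t * ‖Λ.K n x‖ ^ 2 + t ^ 2 * inner ℝ (Λ.K n x) (Λ.K n (Λ.K n x)) ≤ 0 := by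
    intro t
    have h1 := Λ.K_nonpos n (x + t • Λ.K n x)
    rw [K_add, K_smul] at h1
    simp only [inner_add_left, inner_add_right, real_inner_smul_left, real_inner_smul_right] at h1
    rw [hx, ← Λ.K_symm n x, real_inner_self_eq_norm_sq] at h1
    linarith
  set b := inner ℝ (Λ.K n x) (Λ.K n (Λ.K n x))
  have hb : b ≤ 0 := Λ.K_nonpos _ _
  by_contra hne
  have hpos : 0 < ‖Λ.K n x‖ ^ 2 := by positivity
  set p := ‖Λ.K n x‖ ^ 2
  -- Any small positive `t` makes the linear term dominate; this choice stays legitimate when `b =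
  -- 0`.
  have h2 := h (p / (1 - b))
  have h1b : 0 < 1 - b := by linarith
  have h3 : 2 * (p / (1 - b)) * p + (p / (1 - b)) ^ 2 * b =
      p ^ 2 * (2 - b) / (1 - b) ^ 2 := by field_simp; ring
  rw [h3] at h2
  have : 0 < p ^ 2 * (2 - b) / (1 - b) ^ 2 := by
    have : 0 < 2 - b := by linarith
    positivity
  linarith

/-- The level-wise expression `ρ (B - n) + μ (C - 1) + lam K`. -/
def lev (ρ μ lam : ℝ) (h : ∀ n, E n) : ∀ n, E n
  | 0 => μ • (Λ.C 0 (h 1) - h 0) + lam • Λ.K 0 (h 0)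
  | n + 1 => ρ • (Λ.B n (h n) - ((n : ℝ) + 1) • h (n + 1)) +
      μ • (Λ.C (n + 1) (h (n + 2)) - h (n + 1)) + lam • Λ.K (n + 1) (h (n + 1))

/-- Green's formula for the first levels. -/
lemma sum_inner_lev_sub {ρ μ : ℝ} (hνρ : ρ * ν = μ) (lam : ℝ) (h g : ∀ n, E n) (N : ℕ) :
    ∑ n ∈ Finset.range (N + 1),
      (inner ℝ (Λ.lev ρ μ lam h n) (g n) - inner ℝ (h n) (Λ.lev ρ μ lam g n)) =
    μ * inner ℝ (Λ.C N (h (N + 1))) (g N) - μ * inner ℝ (h N) (Λ.C N (g (N + 1))) := by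
  induction N with
  | zero =>
    simp only [zero_add, Finset.sum_range_one, lev, inner_add_left, inner_add_right,
      inner_sub_left, inner_sub_right, real_inner_smul_left, real_inner_smul_right, Λ.K_symm]
    ring
  | succ N ih =>
    rw [Finset.sum_range_succ, ih]
    simp only [lev, inner_add_left, inner_add_right,
      inner_sub_left, inner_sub_right, real_inner_smul_left, real_inner_smul_right, Λ.K_symm]
    rw [Λ.adj, real_inner_comm (Λ.B N (g N)), Λ.adj, real_inner_comm _ (g N), ← hνρ]
    ring

/-- The Dirichlet form on the first levels. -/
lemma sum_inner_lev {ρ μ : ℝ} (hνρ : ρ * ν = μ) (lam : ℝ) (h : ∀ n, E n) (N : ℕ) :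
    ∑ n ∈ Finset.range (N + 1), inner ℝ (h n) (Λ.lev ρ μ lam h n) =
    (-∑ n ∈ Finset.range N, (μ * ‖Λ.C n (h (n + 1)) - h n‖ ^ 2 +
        ρ * (((n : ℝ) + 1) * ‖h (n + 1)‖ ^ 2 - ν * ‖Λ.C n (h (n + 1))‖ ^ 2)) +
      lam * ∑ n ∈ Finset.range (N + 1), inner ℝ (h n) (Λ.K n (h n))) +
    (μ * inner ℝ (h N) (Λ.C N (h (N + 1))) - μ * ‖h N‖ ^ 2) := by
  induction N with
  | zero =>
    simp only [zero_add, Finset.sum_range_one, lev, inner_add_right, inner_sub_right,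
      real_inner_smul_right, real_inner_self_eq_norm_sq, Finset.sum_range_zero]
    ring
  | succ N ih =>
    rw [Finset.sum_range_succ, ih, Finset.sum_range_succ _ (N + 1),
      Finset.sum_range_succ (fun n => μ * ‖Λ.C n (h (n + 1)) - h n‖ ^ 2 +
        ρ * (((n : ℝ) + 1) * ‖h (n + 1)‖ ^ 2 - ν * ‖Λ.C n (h (n + 1))‖ ^ 2)) N]
    generalize ∑ n ∈ Finset.range N, (_ : ℝ) = s
    generalize ∑ n ∈ Finset.range (N + 1), (_ : ℝ) = s'
    simp only [lev, inner_add_right, inner_sub_right, real_inner_smul_right,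
      real_inner_self_eq_norm_sq]
    rw [real_inner_comm (Λ.B N (h N)), Λ.adj, norm_sub_sq_real, real_inner_comm _ (h N), ← hνρ]
    ring

end Ladder

end KacReservoir

namespace KacReservoir

namespace Ladder

open Filter

variable {E : ℕ → Type*} [∀ n, NormedAddCommGroup (E n)] [∀ n, InnerProductSpace ℝ (E n)]
  {ν : ℝ} {a : ℕ → ℝ}

/-! ### The maximal level-wise operator -/

/-- `A` is the operator acting by `Λ.lev` on every level, on its maximal domain. -/
structure IsMaximal (Λ : Ladder E ν a) (ρ μ lam : ℝ) (A : lp E 2 →ₗ.[ℝ] lp E 2) : Prop where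
  mem_domain : ∀ h g : lp E 2, (∀ n, g n = Λ.lev ρ μ lam h n) → h ∈ A.domain
  apply : ∀ (h : A.domain) (n : ℕ), A h n = Λ.lev ρ μ lam (h : lp E 2) n

lemma hasSum_norm_sq (h : lp E 2) : HasSum (fun n => ‖h n‖ ^ 2) (‖h‖ ^ 2) := by
  simpa only [real_inner_self_eq_norm_sq] using lp.hasSum_inner (𝕜 := ℝ) h h

variable {Λ : Ladder E ν a} {ρ μ lam : ℝ} {A : lp E 2 →ₗ.[ℝ] lp E 2}

lemma lev_single_eq_zero (hν : 0 < ν) (m : ℕ) (x : E m) {n : ℕ} (hn : m + 1 < n) :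
    Λ.lev ρ μ lam (lp.single 2 m x) n = 0 := by
  obtain ⟨n, rfl⟩ : ∃ k, n = k + 1 := ⟨n - 1, by omega⟩
  have h0 : ∀ k, k ≠ m → (lp.single 2 m x : lp E 2) k = 0 := fun k hk =>
    lp.single_apply_ne _ _ _ hk
  simp only [lev, h0 n (by omega), h0 (n + 1) (by omega), h0 (n + 2) (by omega), Λ.B_zero,
    Λ.C_zero _ hν, Λ.K_zero, smul_zero, sub_zero, add_zero]

/-- The bound `C*C ≤ n + 1` makes `C` grow only like `√n`, which is what the Carleman type criterion
tolerates. -/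
lemma boundary_le (hν : 0 < ν) (n : ℕ) (x : E n) (y : E (n + 1)) :
    |inner ℝ x (Λ.C n y)| ≤ (√ν)⁻¹ * (√((n : ℝ) + 1) * (‖x‖ ^ 2 + ‖y‖ ^ 2)) := by
  have h1 : ‖Λ.C n y‖ ≤ (√ν)⁻¹ * (√((n : ℝ) + 1) * ‖y‖) := by
    refine le_of_sq_le_sq ?_ (by positivity)
    rw [mul_pow, mul_pow, inv_pow, Real.sq_sqrt hν.le, Real.sq_sqrt (by positivity),
      le_inv_mul_iff₀ hν]
    exact Λ.norm_C_sq_le hν n y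
  have h2 : ‖x‖ * ‖y‖ ≤ ‖x‖ ^ 2 + ‖y‖ ^ 2 := by
    nlinarith [sq_nonneg (‖x‖ - ‖y‖), sq_nonneg ‖x‖, sq_nonneg ‖y‖]
  calc |inner ℝ x (Λ.C n y)| ≤ ‖x‖ * ‖Λ.C n y‖ := abs_real_inner_le_norm _ _
    _ ≤ ‖x‖ * ((√ν)⁻¹ * (√((n : ℝ) + 1) * ‖y‖)) := by gcongr
    _ = (√ν)⁻¹ * (√((n : ℝ) + 1) * (‖x‖ * ‖y‖)) := by ring
    _ ≤ _ := by gcongr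

lemma sum_K_nonpos (hlam : 0 < lam) (h : ∀ n, E n) (s : Finset ℕ) :
    lam * ∑ n ∈ s, inner ℝ (h n) (Λ.K n (h n)) ≤ 0 :=
  mul_nonpos_of_nonneg_of_nonpos hlam.le (Finset.sum_nonpos fun n _ => Λ.K_nonpos n _)

namespace IsMaximal

/-- `lev` couples only neighbouring levels, so the image has finitely many nonzero levels. These
vectors yield density and serve as test vectors for the adjoint. -/
lemma single_mem (hA : Λ.IsMaximal ρ μ lam A) (hν : 0 < ν) (m : ℕ) (x : E m) :
    lp.single 2 m x ∈ A.domain := by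
  have hfin : Memℓp (Λ.lev ρ μ lam (lp.single 2 m x)) 2 := by
    refine (memℓp_zero ?_).of_exponent_ge zero_le
    refine (Set.finite_Iic (m + 1)).subset fun n hn => ?_
    by_contra h
    exact hn (lev_single_eq_zero hν m x (not_le.1 h))
  exact hA.mem_domain _ ⟨_, hfin⟩ fun n => rfl

lemma dense (hA : Λ.IsMaximal ρ μ lam A) (hν : 0 < ν) : Dense (A.domain : Set (lp E 2)) := by
  intro f
  have h := lp.hasSum_single (p := 2) (by norm_num) f
  refine mem_closure_of_tendsto h (Eventually.of_forall fun s => ?_)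
  exact A.domain.sum_mem fun i _ => hA.single_mem hν i (f i)

/-- The maximal operator is symmetric. -/
lemma isFormalAdjoint (hA : Λ.IsMaximal ρ μ lam A) (hν : 0 < ν) (hνρ : ρ * ν = μ) :
    A.IsFormalAdjoint A := by
  -- An inequality suffices, because exchanging `x` and `y` reverses it. The partial sums of the
  -- difference are pure boundary terms `q`.
  have key : ∀ x y : A.domain, inner ℝ (A x) (y : lp E 2) - inner ℝ (x : lp E 2) (A y) ≤ 0 := by
    intro x y
    set h : lp E 2 := x.1 with hh
    set g : lp E 2 := y.1 with hg
    have hs := ((lp.hasSum_inner (𝕜 := ℝ) (A x) g).sub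
      (lp.hasSum_inner (𝕜 := ℝ) h (A y))).tendsto_sum_nat
    have hs1 := (tendsto_add_atTop_iff_nat 1).2 hs
    simp only [hA.apply, ← hh, ← hg, Λ.sum_inner_lev_sub hνρ] at hs1
    set q : ℕ → ℝ := fun N => μ * inner ℝ (Λ.C N (h (N + 1))) (g N) -
      μ * inner ℝ (h N) (Λ.C N (g (N + 1))) with hq
    set t : ℕ → ℝ := fun N => ‖h N‖ ^ 2 + ‖h (N + 1)‖ ^ 2 + (‖g N‖ ^ 2 + ‖g (N + 1)‖ ^ 2) with ht
    have hts : Summable t :=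
      ((hasSum_norm_sq h).summable.add ((summable_nat_add_iff 1).2 (hasSum_norm_sq h).summable)).add
      ((hasSum_norm_sq g).summable.add ((summable_nat_add_iff 1).2 (hasSum_norm_sq g).summable))
    have hqt : ∀ N : ℕ, |q N| ≤ (|μ| * (√ν)⁻¹) * (√((N : ℝ) + 1) * t N) := by
      intro N
      have h1 := boundary_le (Λ := Λ) hν N (g N) (h (N + 1))
      have h2 := boundary_le (Λ := Λ) hν N (h N) (g (N + 1))
      have h3 : |q N| ≤ |μ| * (|inner ℝ (g N) (Λ.C N (h (N + 1)))| +
          |inner ℝ (h N) (Λ.C N (g (N + 1)))|) := by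
        rw [hq]
        simp only
        rw [← mul_sub, abs_mul, real_inner_comm]
        gcongr
        exact abs_sub _ _
      refine h3.trans ((mul_le_mul_of_nonneg_left (add_le_add h1 h2) (abs_nonneg μ)).trans
        (le_of_eq ?_))
      rw [ht]; ring
    refine le_of_tendsto_of_frequently_lt (S := fun _ => 0) (q := q) (U := fun _ => 0) ?_
      (fun ε hε => frequently_abs_lt_of_le_sqrt_mul hts (fun n => by positivity) hqt hε)
      (Eventually.of_forall fun _ => le_rfl) tendsto_const_nhds
    simpa using hs1
  intro x y
  refine le_antisymm (sub_nonpos.1 (key x y)) ?_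
  have := key y x
  rw [real_inner_comm, real_inner_comm (A x)] at this
  linarith

/-- Green's formula cut at level `m + 1` has no boundary term, since the test vector vanishes on
levels `m + 1` and `m + 2`. Hence `g` may be any vector, not only one in the domain. -/
lemma inner_single_apply (hA : Λ.IsMaximal ρ μ lam A) (hν : 0 < ν) (hνρ : ρ * ν = μ)
    (g : lp E 2) (m : ℕ) (x : E m) :
    inner ℝ (A ⟨_, hA.single_mem hν m x⟩) g = inner ℝ x (Λ.lev ρ μ lam g m) := by
  set h : lp E 2 := lp.single 2 m x with hh
  have h0 : ∀ k, k ≠ m → h k = 0 := fun k hk => lp.single_apply_ne _ _ _ hk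
  have hs : HasSum (fun n => inner ℝ (Λ.lev ρ μ lam h n) (g n))
      (inner ℝ (A ⟨_, hA.single_mem hν m x⟩) g) := by
    have := lp.hasSum_inner (𝕜 := ℝ) (A ⟨_, hA.single_mem hν m x⟩) g
    simpa only [hA.apply] using this
  have hs2 := hasSum_sum_of_ne_finset_zero (L := .unconditional ℕ) (s := Finset.range (m + 1 + 1))
    (f := fun n => inner ℝ (Λ.lev ρ μ lam h n) (g n)) (fun n hn => by
      rw [hh, lev_single_eq_zero hν m x (by simpa using hn), inner_zero_left])
  rw [hs.unique hs2]
  have h1 := Λ.sum_inner_lev_sub hνρ lam h g (m + 1)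
  rw [h0 (m + 1) (by omega), h0 (m + 1 + 1) (by omega), Λ.C_zero _ hν, inner_zero_left,
    inner_zero_left, Finset.sum_sub_distrib] at h1
  have h2 : ∑ n ∈ Finset.range (m + 1 + 1), inner ℝ (h n) (Λ.lev ρ μ lam g n) =
      inner ℝ x (Λ.lev ρ μ lam g m) := by
    rw [Finset.sum_eq_single m (fun n _ hn => by rw [h0 n hn, inner_zero_left])
      (fun hm => absurd (Finset.mem_range.2 (by omega)) hm), hh, lp.single_apply_self]
  linarith

/-- The maximal operator is self-adjoint. -/
theorem isSelfAdjoint (hA : Λ.IsMaximal ρ μ lam A) [∀ n, CompleteSpace (E n)] (hν : 0 < ν)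
    (hνρ : ρ * ν = μ) :
    IsSelfAdjoint A := by
  have hd := hA.dense hν
  rw [LinearPMap.isSelfAdjoint_def]
  refine le_antisymm ?_ ((hA.isFormalAdjoint hν hνρ).le_adjoint hd)
  -- The adjoint is read off level by level from one-level test vectors; maximality of the domain of
  -- `A` then gives the inclusion.
  have key : ∀ y : A.adjoint.domain, ∀ m, A.adjoint y m = Λ.lev ρ μ lam (y : lp E 2) m := by
    intro y m
    refine ext_inner_left ℝ fun x => ?_
    rw [← hA.inner_single_apply hν hνρ, real_inner_comm, ← lp.inner_single_right,
      LinearPMap.adjoint_isFormalAdjoint hd y ⟨_, hA.single_mem hν m x⟩, real_inner_comm]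
  refine ⟨fun y hy => hA.mem_domain y (A.adjoint ⟨y, hy⟩) (key ⟨y, hy⟩), ?_⟩
  intro y z hyz
  refine lp.ext (funext fun m => ?_)
  rw [key, hA.apply, hyz]

/-! ### The quadratic form -/

/-- Passes from truncated Dirichlet forms to the full form: the boundary term in `sum_inner_lev` is
small along a subsequence, and the full sum converges. -/
lemma inner_le (hA : Λ.IsMaximal ρ μ lam A) (hν : 0 < ν) (hνρ : ρ * ν = μ) (h : A.domain)
    {U : ℕ → ℝ} {u : ℝ} (hU : Tendsto U atTop (nhds u))
    (hle : ∀ᶠ N in atTop, -∑ n ∈ Finset.range N,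
      (μ * ‖Λ.C n ((h : lp E 2) (n + 1)) - (h : lp E 2) n‖ ^ 2 +
        ρ * (((n : ℝ) + 1) * ‖(h : lp E 2) (n + 1)‖ ^ 2 -
          ν * ‖Λ.C n ((h : lp E 2) (n + 1))‖ ^ 2)) +
      lam * ∑ n ∈ Finset.range (N + 1),
        inner ℝ ((h : lp E 2) n) (Λ.K n ((h : lp E 2) n)) ≤ U N) :
    inner ℝ (h : lp E 2) (A h) ≤ u := by
  set g : lp E 2 := h.1 with hg
  have hs := (tendsto_add_atTop_iff_nat 1).2
    (lp.hasSum_inner (𝕜 := ℝ) g (A h)).tendsto_sum_nat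
  simp only [hA.apply, ← hg, Λ.sum_inner_lev hνρ] at hs
  have hts : Summable fun N => ‖g N‖ ^ 2 + ‖g (N + 1)‖ ^ 2 :=
    (hasSum_norm_sq g).summable.add ((summable_nat_add_iff 1).2 (hasSum_norm_sq g).summable)
  refine le_of_tendsto_of_frequently_lt hs (fun ε hε =>
    frequently_abs_lt_of_le_sqrt_mul (C := |μ| * ((√ν)⁻¹ + 1)) hts
      (fun n => by positivity) (fun N => ?_) hε) hle hU
  have h1 := boundary_le (Λ := Λ) hν N (g N) (g (N + 1))
  have h2 : ‖g N‖ ^ 2 ≤ √((N : ℝ) + 1) * (‖g N‖ ^ 2 + ‖g (N + 1)‖ ^ 2) := by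
    have h3 : 1 ≤ √((N : ℝ) + 1) := Real.one_le_sqrt.2 (by linarith [N.cast_nonneg (α := ℝ)])
    nlinarith [sq_nonneg ‖g N‖, sq_nonneg ‖g (N + 1)‖]
  rw [← mul_sub, abs_mul, mul_assoc]
  refine mul_le_mul_of_nonneg_left ?_ (abs_nonneg μ)
  refine (abs_sub _ _).trans ?_
  rw [abs_of_nonneg (sq_nonneg ‖g N‖)]
  linarith

/-- The spectral gap inequality. -/
theorem inner_apply_le (hA : Λ.IsMaximal ρ μ lam A) (hρ : 0 < ρ) (hν : 0 < ν)
    (hνρ : ρ * ν = μ) (hlam : 0 < lam) (ha : ∀ n, 0 < a n)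
    (ha1 : ∀ n : ℕ, ((n : ℝ) + 1) * a (n + 1) = ν * a n)
    (hsum : HasSum a 1) {e : lp E 2} (he : ∀ n, e n = Λ.one n) (h : A.domain) :
    inner ℝ (h : lp E 2) (A h) ≤ -ρ * (‖(h : lp E 2)‖ ^ 2 - inner ℝ (h : lp E 2) e ^ 2) := by
  set g : lp E 2 := h.1 with hg
  -- `c n` is the mean of `g n`, so `c n • one n` is its projection to the constants, of squared
  -- norm `a n * c n ^ 2`.
  set c : ℕ → ℝ := fun n => inner ℝ (g n) (Λ.one n) / a n with hc
  have hcm : ∀ n, a n * c n = inner ℝ (g n) (Λ.one n) := fun n => mul_div_cancel₀ _ (ha n).ne'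
  have hca : ∀ n, a n * c n ^ 2 ≤ ‖g n‖ ^ 2 := by
    intro n
    have h1 : (a n * c n) ^ 2 ≤ ‖g n‖ ^ 2 * a n := by
      rw [hcm, ← Λ.norm_one_sq, ← mul_pow, sq_le_sq,
        abs_of_nonneg (a := _ * _) (by positivity)]
      exact abs_real_inner_le_norm _ _
    have h2 := ha n
    nlinarith
  have hs1 : Summable fun n => a n * c n ^ 2 :=
    Summable.of_nonneg_of_le (fun n => mul_nonneg (ha n).le (sq_nonneg _)) hca
      (hasSum_norm_sq g).summable
  have hs2 : HasSum (fun n => a n * c n) (inner ℝ g e) := by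
    simpa only [hcm, he] using lp.hasSum_inner (𝕜 := ℝ) g e
  -- The truncated upper bound: squared norm of the fluctuations plus the Poisson variance of the
  -- means. As the weights sum to one, `∑ a c²` cancels in the limit.
  have hlim : Tendsto (fun N => -ρ * (∑ n ∈ Finset.range (N + 1), ‖g n‖ ^ 2 -
      ∑ n ∈ Finset.range (N + 1), a n * c n ^ 2 +
      ((∑ n ∈ Finset.range (N + 1), a n) * ∑ n ∈ Finset.range (N + 1), a n * c n ^ 2 -
        (∑ n ∈ Finset.range (N + 1), a n * c n) ^ 2))) atTop
      (nhds (-ρ * (‖g‖ ^ 2 - (∑' n, a n * c n ^ 2) +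
        (1 * (∑' n, a n * c n ^ 2) - inner ℝ g e ^ 2)))) := by
    have t1 := (tendsto_add_atTop_iff_nat 1).2 (hasSum_norm_sq g).tendsto_sum_nat
    have t2 := (tendsto_add_atTop_iff_nat 1).2 hs1.hasSum.tendsto_sum_nat
    have t3 := (tendsto_add_atTop_iff_nat 1).2 hsum.tendsto_sum_nat
    have t4 := (tendsto_add_atTop_iff_nat 1).2 hs2.tendsto_sum_nat
    exact ((t1.sub t2).add ((t3.mul t2).sub (t4.pow 2))).const_mul _
  refine (hA.inner_le hν hνρ h hlim (Eventually.of_forall fun N => ?_)).trans (le_of_eq (by ring))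
  have hP := poisson_poincare hν.le (fun n => (ha n).le) ha1
    (fun N => sum_le_hasSum _ (fun n _ => (ha n).le) hsum) c N
  have h0 : ‖g 0‖ ^ 2 - a 0 * c 0 ^ 2 = 0 := by
    have hz : g 0 - c 0 • Λ.one 0 = 0 := by
      refine Λ.eq_zero _ ?_
      rw [inner_sub_left, real_inner_smul_left, Λ.inner_one, ← hcm]; ring
    rw [sub_eq_zero.1 hz, norm_smul, mul_pow, Λ.norm_one_sq, Real.norm_eq_abs, sq_abs]
    ring
  -- The first summand comes from projecting `C g_{n+1} - g_n` onto constants. The second comes from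
  -- the number term, in which the means cancel by `(n + 1) a_{n+1} = ν a_n`.
  have hterm : ∀ n, ρ * (ν * (a n * (c (n + 1) - c n) ^ 2)) +
      ρ * (‖g (n + 1)‖ ^ 2 - a (n + 1) * c (n + 1) ^ 2) ≤
      μ * ‖Λ.C n (g (n + 1)) - g n‖ ^ 2 +
        ρ * (((n : ℝ) + 1) * ‖g (n + 1)‖ ^ 2 - ν * ‖Λ.C n (g (n + 1))‖ ^ 2) := by
    intro n
    have hC1 : inner ℝ (Λ.C n (g (n + 1))) (Λ.one n) = a n * c (n + 1) := by
      have h1 := Λ.inner_C_one n (g (n + 1))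
      rw [← hcm] at h1
      refine mul_left_cancel₀ hν.ne' ?_
      rw [h1]
      linear_combination c (n + 1) * ha1 n
    have hD : a n * (c (n + 1) - c n) ^ 2 ≤ ‖Λ.C n (g (n + 1)) - g n‖ ^ 2 := by
      have h1 : (a n * (c (n + 1) - c n)) ^ 2 ≤ ‖Λ.C n (g (n + 1)) - g n‖ ^ 2 * a n := by
        rw [mul_sub, hcm, ← hC1, ← inner_sub_left, ← Λ.norm_one_sq, ← mul_pow, sq_le_sq,
          abs_of_nonneg (a := _ * _) (by positivity)]
        exact abs_real_inner_le_norm _ _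
      have h2 := ha n
      nlinarith
    set f := g (n + 1) - c (n + 1) • Λ.one (n + 1) with hf
    have hf1 : inner ℝ f (Λ.one (n + 1)) = 0 := by
      rw [hf, inner_sub_left, real_inner_smul_left, Λ.inner_one, ← hcm]; ring
    have hgf : g (n + 1) = f + c (n + 1) • Λ.one (n + 1) := by rw [hf]; abel
    have hES := Λ.norm_C_sq_le_of_inner_one hν n f hf1
    have hfn : ‖g (n + 1)‖ ^ 2 = ‖f‖ ^ 2 + a (n + 1) * c (n + 1) ^ 2 := by
      rw [hgf, norm_add_sq_real, real_inner_smul_right, hf1, norm_smul, mul_pow,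
        Λ.norm_one_sq, Real.norm_eq_abs, sq_abs]
      ring
    have hf2 : inner ℝ (Λ.C n f) (Λ.one n) = 0 := by
      have := Λ.inner_C_one n f
      rw [hf1, mul_zero] at this
      exact (mul_eq_zero.1 this).resolve_left hν.ne'
    have hCn : ‖Λ.C n (g (n + 1))‖ ^ 2 = ‖Λ.C n f‖ ^ 2 + a n * c (n + 1) ^ 2 := by
      rw [hgf, Λ.C_add n hν, Λ.C_smul n hν, Λ.C_one, norm_add_sq_real, real_inner_smul_right, hf2,
        norm_smul, mul_pow, Λ.norm_one_sq, Real.norm_eq_abs, sq_abs]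
      ring
    have e1 : ((n : ℝ) + 1) * (a (n + 1) * c (n + 1) ^ 2) = ν * (a n * c (n + 1) ^ 2) := by
      linear_combination c (n + 1) ^ 2 * ha1 n
    have e2 : ‖g (n + 1)‖ ^ 2 - a (n + 1) * c (n + 1) ^ 2 ≤
        ((n : ℝ) + 1) * ‖g (n + 1)‖ ^ 2 - ν * ‖Λ.C n (g (n + 1))‖ ^ 2 := by
      rw [hfn, hCn]; linarith
    have e3 : ρ * (ν * (a n * (c (n + 1) - c n) ^ 2)) ≤ μ * ‖Λ.C n (g (n + 1)) - g n‖ ^ 2 := by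
      rw [← hνρ, mul_assoc]
      exact mul_le_mul_of_nonneg_left (mul_le_mul_of_nonneg_left hD hν.le) hρ.le
    exact add_le_add e3 (mul_le_mul_of_nonneg_left e2 hρ.le)
  have hT := Finset.sum_le_sum fun n (_ : n ∈ Finset.range N) => hterm n
  rw [Finset.sum_add_distrib, ← Finset.mul_sum, ← Finset.mul_sum (a := ρ)
    (f := fun n => ‖g (n + 1)‖ ^ 2 - a (n + 1) * c (n + 1) ^ 2), Finset.sum_sub_distrib] at hT
  have hK := sum_K_nonpos (Λ := Λ) hlam g (Finset.range (N + 1))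
  have h3 := Finset.sum_range_succ' (fun n => ‖g n‖ ^ 2) N
  have h4 := Finset.sum_range_succ' (fun n => a n * c n ^ 2) N
  have hP' := mul_le_mul_of_nonneg_left hP hρ.le
  have h5 : ρ * (‖g 0‖ ^ 2 - a 0 * c 0 ^ 2) = 0 := by rw [h0, mul_zero]
  rw [h3]
  -- Only the sum inside the fluctuation part is split; the one inside the variance must keep the
  -- shape it has in `hP`.
  nth_rewrite 1 [h4]
  linarith

end IsMaximal

end Ladder

end KacReservoir

namespace KacReservoir

namespace Ladder

open Filter

variable {E : ℕ → Type*} [∀ n, NormedAddCommGroup (E n)] [∀ n, InnerProductSpace ℝ (E n)]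
  {ν : ℝ} {a : ℕ → ℝ} {Λ : Ladder E ν a} {ρ μ lam : ℝ}

/-! ### Eigenvectors -/

/-- The exchange `C x - x` and the collisions vanish, while creation minus number contributes `n -
(n + 1) = -1` on level `n + 1`. -/
lemma lev_eq_neg_smul {x : ∀ n, E n} (hx0 : x 0 = 0) (hB : ∀ n, Λ.B n (x n) = (n : ℝ) • x (n + 1))
    (hC : ∀ n, Λ.C n (x (n + 1)) = x n) (hK : ∀ n, Λ.K n (x n) = 0) (n : ℕ) :
    Λ.lev ρ μ lam x n = (-ρ) • x n := by
  cases n with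
  | zero => simp [lev, hC, hx0, Λ.K_zero]
  | succ n =>
    rw [lev, hB, hC, hK, ← sub_smul, smul_smul, sub_self, smul_zero, smul_zero, add_zero, add_zero]
    congr 1; ring

/-- On constants the operator is the birth–death generator of the Poisson weights. The truncated `n
- 1` at `n = 0` is harmless because of the factor `n`. -/
lemma lev_smul_one (hν : 0 < ν) (c : ℕ → ℝ) (n : ℕ) :
    Λ.lev ρ μ lam (fun n => c n • Λ.one n) n =
      (ρ * (n * (c (n - 1) - c n)) + μ * (c (n + 1) - c n)) • Λ.one n := by
  cases n with
  | zero =>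
    simp only [lev, Λ.C_smul _ hν, Λ.C_one, Λ.K_smul, Λ.K_one, smul_zero, add_zero, ← sub_smul,
      smul_smul]
    simp
  | succ n =>
    simp only [lev, Λ.C_smul _ hν, Λ.C_one, Λ.K_smul, Λ.K_one, Λ.B_smul, Λ.B_one, smul_zero,
      add_zero, ← sub_smul, smul_smul, ← add_smul]
    congr 1
    simp only [Nat.add_sub_cancel]
    push_cast
    ring

/-- If the mean of an eigenvector for `-ρ` vanishes on level zero, it vanishes on all levels. -/
lemma inner_one_eq_zero (hρ : 0 < ρ) (hνρ : ρ * ν = μ) {g : ∀ n, E n}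
    (hg : ∀ n, Λ.lev ρ μ lam g n = (-ρ) • g n) (h0 : inner ℝ (g 0) (Λ.one 0) = 0) (n : ℕ) :
    inner ℝ (g n) (Λ.one n) = 0 := by
  set m : ℕ → ℝ := fun n => inner ℝ (g n) (Λ.one n) with hm
  have hC : ∀ n, ν * inner ℝ (Λ.C n (g (n + 1))) (Λ.one n) = ((n : ℝ) + 1) * m (n + 1) :=
    fun n => Λ.inner_C_one n _
  have hK : ∀ n, inner ℝ (Λ.K n (g n)) (Λ.one n) = 0 := fun n => by
    rw [Λ.K_symm, Λ.K_one, inner_zero_right]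
  have r0 : m 1 = 0 := by
    have h1 := congrArg (fun x => inner ℝ x (Λ.one 0)) (hg 0)
    simp only [lev, inner_add_left, inner_sub_left, real_inner_smul_left, hK, h0] at h1
    have h2 := hC 0
    simp only [Nat.cast_zero, zero_add, one_mul] at h2
    have h3 : ρ * m 1 = 0 := by rw [← h2, ← mul_assoc, hνρ]; linarith
    exact (mul_eq_zero.1 h3).resolve_left hρ.ne'
  -- Pairing the eigenvalue equation with `one` removes `K` and leaves a three-term recursion for
  -- the means, whose leading coefficient `ρ(n + 2)` is nonzero.
  have r1 : ∀ n, m n = 0 → m (n + 1) = 0 → m (n + 2) = 0 := by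
    intro n h1 h2
    have h3 := congrArg (fun x => inner ℝ x (Λ.one (n + 1))) (hg (n + 1))
    simp only [lev, inner_add_left, inner_sub_left, real_inner_smul_left, hK, Λ.adj, Λ.C_one] at h3
    have h4 := hC (n + 1)
    change inner ℝ (g n) (Λ.one n) = 0 at h1
    change inner ℝ (g (n + 1)) (Λ.one (n + 1)) = 0 at h2
    rw [h1, h2] at h3
    have h5 : (ρ * (((n + 1 : ℕ) : ℝ) + 1)) * m (n + 2) = 0 := by
      rw [mul_assoc, ← h4, ← mul_assoc, hνρ]; linarith
    exact (mul_eq_zero.1 h5).resolve_left (by positivity)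
  have : ∀ n, m n = 0 ∧ m (n + 1) = 0 := by
    intro n
    induction n with
    | zero => exact ⟨h0, r0⟩
    | succ n ih => exact ⟨ih.2, r1 n ih.1 ih.2⟩
  exact (this n).1

namespace IsMaximal

variable {A : lp E 2 →ₗ.[ℝ] lp E 2}

lemma mem_eigenspace_iff (hA : Λ.IsMaximal ρ μ lam A) {c : ℝ} {h : lp E 2} :
    (∃ hh : h ∈ A.domain, A ⟨h, hh⟩ = c • h) ↔ ∀ n, Λ.lev ρ μ lam h n = c • h n := by
  constructor
  · rintro ⟨hh, h1⟩ n
    rw [← hA.apply ⟨h, hh⟩, h1]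
    rfl
  · intro h1
    have hh : h ∈ A.domain := hA.mem_domain h (c • h) fun n => (h1 n).symm
    refine ⟨hh, lp.ext (funext fun n => ?_)⟩
    rw [hA.apply]
    exact h1 n

/-- The structure of the eigenvectors for `-ρ` whose mean vanishes on level zero. -/
theorem eigenvector_structure (hA : Λ.IsMaximal ρ μ lam A) (hρ : 0 < ρ) (hν : 0 < ν)
    (hνρ : ρ * ν = μ) (hlam : 0 < lam) {g : lp E 2}
    (hg : ∀ n, Λ.lev ρ μ lam g n = (-ρ) • g n) (h0 : inner ℝ (g 0) (Λ.one 0) = 0) :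
    (∀ n, inner ℝ (g n) (Λ.one n) = 0) ∧ g 0 = 0 ∧
      (∀ n, Λ.B n (g n) = (n : ℝ) • g (n + 1)) ∧ (∀ n, Λ.K n (g n) = 0) := by
  have hm := inner_one_eq_zero hρ hνρ hg h0
  have hg0 : g 0 = 0 := Λ.eq_zero _ h0
  obtain ⟨hmem, hAg⟩ := hA.mem_eigenspace_iff.2 hg
  have hμ : 0 < μ := hνρ ▸ mul_pos hρ hν
  have hES : ∀ n, ρ * ‖g (n + 1)‖ ^ 2 ≤
      ρ * (((n : ℝ) + 1) * ‖g (n + 1)‖ ^ 2 - ν * ‖Λ.C n (g (n + 1))‖ ^ 2) := fun n => by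
    have := Λ.norm_C_sq_le_of_inner_one hν n (g (n + 1)) (hm (n + 1))
    exact mul_le_mul_of_nonneg_left (by linarith) hρ.le
  -- With all means zero, the number term alone already accounts for `-ρ‖g‖²`, which is the value of
  -- the form at `g`. Keeping the exchange and collision terms of a single level `m` therefore shows
  -- that nothing is left for them.
  have key : ∀ m, μ * ‖Λ.C m (g (m + 1)) - g m‖ ^ 2 -
      lam * inner ℝ (g m) (Λ.K m (g m)) ≤ 0 := by
    intro m
    set T := μ * ‖Λ.C m (g (m + 1)) - g m‖ ^ 2 - lam * inner ℝ (g m) (Λ.K m (g m)) with hT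
    have hlim : Tendsto (fun N => -ρ * (∑ n ∈ Finset.range (N + 1), ‖g n‖ ^ 2) - T) atTop
        (nhds (-ρ * ‖g‖ ^ 2 - T)) :=
      (((tendsto_add_atTop_iff_nat 1).2 (hasSum_norm_sq g).tendsto_sum_nat).const_mul _).sub_const _
    have hle := hA.inner_le hν hνρ ⟨g, hmem⟩ hlim (by
      filter_upwards [eventually_gt_atTop m] with N hN
      have h1 : ρ * ∑ n ∈ Finset.range N, ‖g (n + 1)‖ ^ 2 +
          μ * ‖Λ.C m (g (m + 1)) - g m‖ ^ 2 ≤ ∑ n ∈ Finset.range N,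
          (μ * ‖Λ.C n (g (n + 1)) - g n‖ ^ 2 +
            ρ * (((n : ℝ) + 1) * ‖g (n + 1)‖ ^ 2 - ν * ‖Λ.C n (g (n + 1))‖ ^ 2)) := by
        rw [Finset.sum_add_distrib, add_comm, Finset.mul_sum]
        refine add_le_add ?_ (Finset.sum_le_sum fun n _ => hES n)
        exact Finset.single_le_sum (f := fun n => μ * ‖Λ.C n (g (n + 1)) - g n‖ ^ 2)
          (fun n _ => by positivity) (Finset.mem_range.2 hN)
      have h2 : ∑ n ∈ Finset.range (N + 1), inner ℝ (g n) (Λ.K n (g n)) ≤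
          inner ℝ (g m) (Λ.K m (g m)) := by
        have h3 := Finset.single_le_sum (s := Finset.range (N + 1))
          (f := fun n => -inner ℝ (g n) (Λ.K n (g n)))
          (fun n _ => neg_nonneg.2 (Λ.K_nonpos n _)) (Finset.mem_range.2 (hN.trans N.lt_succ_self))
        rw [Finset.sum_neg_distrib] at h3
        exact neg_le_neg_iff.1 h3
      have h4 := mul_le_mul_of_nonneg_left h2 hlam.le
      rw [Finset.sum_range_succ' (fun n => ‖g n‖ ^ 2), hg0, norm_zero]
      linarith)
    rw [hAg] at hle
    change inner ℝ g ((-ρ) • g) ≤ _ at hle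
    rw [real_inner_smul_right, real_inner_self_eq_norm_sq] at hle
    linarith
  have hK : ∀ n, Λ.K n (g n) = 0 := by
    intro n
    refine Λ.K_eq_zero n (le_antisymm (Λ.K_nonpos n _) ?_)
    have h1 := key n
    have h2 : 0 ≤ μ * ‖Λ.C n (g (n + 1)) - g n‖ ^ 2 := by positivity
    exact (mul_nonneg_iff_of_pos_left hlam).1 (by linarith)
  have hC : ∀ n, Λ.C n (g (n + 1)) - g n = 0 := by
    intro n
    have h1 := key n
    rw [hK, inner_zero_right, mul_zero, sub_zero] at h1
    have h2 : ‖Λ.C n (g (n + 1)) - g n‖ ^ 2 ≤ 0 := by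
      by_contra h
      exact absurd h1 (not_le.2 (mul_pos hμ (not_le.1 h)))
    simpa using le_antisymm h2 (sq_nonneg _)
  refine ⟨hm, hg0, fun n => ?_, hK⟩
  -- With exchange and collisions gone, the equation on level `n + 1` reads `B g_n - (n + 1) g_{n+1}
  -- = -g_{n+1}`.
  have h1 := hg (n + 1)
  rw [lev, hC (n + 1), hK, smul_zero, smul_zero, add_zero, add_zero, neg_smul, ← smul_neg] at h1
  have h2 := smul_right_injective _ hρ.ne' h1
  rw [sub_eq_iff_eq_add] at h2
  rw [h2, add_smul, one_smul]
  abel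

/-- The eigenspace of `-ρ` is spanned by `e₁` and `x`, if `x` spans, on level one, the possible
values of eigenvectors of mean zero. -/
theorem eigenspace_eq_span (hA : Λ.IsMaximal ρ μ lam A) (hρ : 0 < ρ) (hν : 0 < ν)
    (hνρ : ρ * ν = μ) (hlam : 0 < lam) {e₁ x : lp E 2}
    (he₁ : ∀ n, Λ.lev ρ μ lam e₁ n = (-ρ) • e₁ n) (he₁0 : inner ℝ (e₁ 0) (Λ.one 0) ≠ 0)
    (hx0 : x 0 = 0) (hB : ∀ n, Λ.B n (x n) = (n : ℝ) • x (n + 1))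
    (hC : ∀ n, Λ.C n (x (n + 1)) = x n) (hK : ∀ n, Λ.K n (x n) = 0)
    (hspan : ∀ f : E 1, inner ℝ f (Λ.one 1) = 0 → Λ.K 2 (Λ.B 1 f) = 0 → ∃ t : ℝ, f = t • x 1) :
    eigenspace A (-ρ) = Submodule.span ℝ {e₁, x} := by
  have hx := lev_eq_neg_smul (ρ := ρ) (μ := μ) (lam := lam) hx0 hB hC hK
  have he₁m : e₁ ∈ eigenspace A (-ρ) := hA.mem_eigenspace_iff.2 he₁
  have hxm : x ∈ eigenspace A (-ρ) := hA.mem_eigenspace_iff.2 hx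
  apply le_antisymm
  · intro h hh
    -- Chosen so that `h - t • e₁` has mean zero on level zero, as `eigenvector_structure` requires.
    set t := inner ℝ (h 0) (Λ.one 0) / inner ℝ (e₁ 0) (Λ.one 0) with ht
    set g := h - t • e₁ with hgdef
    have hgm : g ∈ eigenspace A (-ρ) := Submodule.sub_mem _ hh (Submodule.smul_mem _ t he₁m)
    have hg := hA.mem_eigenspace_iff.1 hgm
    have hg0 : inner ℝ (g 0) (Λ.one 0) = 0 := by
      change inner ℝ (h 0 - t • e₁ 0) (Λ.one 0) = 0
      rw [inner_sub_left, real_inner_smul_left, ht, div_mul_cancel₀ _ he₁0, sub_self]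
    obtain ⟨g1, g2, g3, g4⟩ := hA.eigenvector_structure hρ hν hνρ hlam hg hg0
    obtain ⟨s, hs⟩ := hspan (g 1) (g1 1) (by
      rw [g3 1, Λ.K_smul, g4, smul_zero])
    -- The relation `B g_n = n g_{n+1}` determines level `n + 1` from level `n` only for `n ≥ 1`;
    -- hence level one is free and starts the induction.
    have hgx : ∀ n, g (n + 1) = s • x (n + 1) := by
      intro n
      induction n with
      | zero => exact hs
      | succ n ih =>
        have h1 := g3 (n + 1)
        rw [ih, Λ.B_smul, hB, smul_comm] at h1
        exact (smul_right_injective _ (by positivity : (((n + 1 : ℕ) : ℝ)) ≠ 0) h1).symm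
    have hgx' : g = s • x := by
      refine lp.ext (funext fun n => ?_)
      cases n with
      | zero =>
        change g 0 = s • x 0
        rw [g2, hx0, smul_zero]
      | succ n => exact hgx n
    refine Submodule.mem_span_pair.2 ⟨t, s, ?_⟩
    rw [← hgx', hgdef]; abel
  · rw [Submodule.span_le]
    rintro y (rfl | hy)
    · exact he₁m
    · rw [Set.mem_singleton_iff.1 hy]; exact hxm

end IsMaximal

end Ladder

end KacReservoir

/-! ### Realisation of the ladder by Gaussian averages. -/

noncomputable section

namespace KacReservoir

/-! ### Averages of measure preserving maps -/

section Average

variable {Ω X Y : Type*} [MeasurableSpace Ω] [MeasurableSpace X] [MeasurableSpace Y]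
  {P : Measure Ω} [IsProbabilityMeasure P] {νX : Measure X} [IsFiniteMeasure νX] {νY : Measure Y}
  {T : Ω × X → Y} {f : Y → ℝ}

/-- Jensen's inequality in the form "variance is nonnegative". Annihilation (averaging an inserted
velocity) and collision (averaging an angle) are both such averages. -/
lemma memLp_average (hT : MeasurePreserving T (P.prod νX) νY) (hf : MemLp f 2 νY) :
    MemLp (fun x => ∫ ω, f (T (ω, x)) ∂P) 2 νX := by
  have hF : MemLp (fun z => f (T z)) 2 (P.prod νX) := hf.comp_measurePreserving hT
  have hF1 : Integrable (fun z => f (T z)) (P.prod νX) := hF.integrable (by norm_num)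
  have hF2 : Integrable (fun z => f (T z) ^ 2) (P.prod νX) := hF.integrable_sq
  have hm : AEStronglyMeasurable (fun x => ∫ ω, f (T (ω, x)) ∂P) νX :=
    hF1.integral_prod_right.aestronglyMeasurable
  rw [memLp_two_iff_integrable_sq hm]
  refine hF2.integral_prod_right.mono' (hm.pow 2) ?_
  filter_upwards [hF1.prod_left_ae, hF2.prod_left_ae] with x h1 h2
  rw [Real.norm_of_nonneg (sq_nonneg _)]
  set c := ∫ ω, f (T (ω, x)) ∂P with hc
  have h3 : 0 ≤ ∫ ω, (f (T (ω, x)) - c) ^ 2 ∂P := integral_nonneg fun ω => sq_nonneg _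
  have h4 : ∫ ω, (f (T (ω, x)) - c) ^ 2 ∂P = (∫ ω, f (T (ω, x)) ^ 2 ∂P) - c ^ 2 := by
    have : ∀ ω, (f (T (ω, x)) - c) ^ 2 = f (T (ω, x)) ^ 2 - 2 * c * f (T (ω, x)) + c ^ 2 :=
      fun ω => by ring
    simp only [this]
    have h5 : Integrable (fun ω => f (T (ω, x)) ^ 2 - 2 * c * f (T (ω, x))) P :=
      h2.sub (h1.const_mul _)
    rw [integral_add h5 (integrable_const _),
      integral_sub h2 (h1.const_mul _), integral_const_mul, ← hc]
    simp
    ring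
  linarith

lemma integral_average_mul (hT : MeasurePreserving T (P.prod νX) νY) (hf : MemLp f 2 νY)
    {g : X → ℝ} (hg : MemLp g 2 νX) :
    ∫ x, (∫ ω, f (T (ω, x)) ∂P) * g x ∂νX = ∫ z, f (T z) * g z.2 ∂(P.prod νX) := by
  have hF : MemLp (fun z => f (T z)) 2 (P.prod νX) := hf.comp_measurePreserving hT
  have hG : MemLp (fun z : Ω × X => g z.2) 2 (P.prod νX) :=
    hg.comp_measurePreserving measurePreserving_snd
  rw [integral_prod_symm (fun z => f (T z) * g z.2) (hF.integrable_mul hG)]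
  simp only [integral_mul_const]

end Average

/-! ### Gaussian measures -/

lemma measurePreserving_withDensity {X Y : Type*} [MeasurableSpace X] [MeasurableSpace Y]
    {μX : Measure X} {μY : Measure Y} {T : X → Y} (hT : MeasurePreserving T μX μY)
    {p : X → ENNReal} {q : Y → ENNReal} (hq : Measurable q) (hpq : ∀ x, p x = q (T x)) :
    MeasurePreserving T (μX.withDensity p) (μY.withDensity q) := by
  refine ⟨hT.measurable, ?_⟩
  ext s hs
  rw [Measure.map_apply hT.measurable hs, withDensity_apply _ (hT.measurable hs),
    withDensity_apply _ hs, ← hT.setLIntegral_comp_preimage hs hq]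
  simp only [hpq]

/-- The Gaussian measure `e^{-π w²} dw`. -/
def gauss : Measure ℝ :=
  volume.withDensity fun w => ENNReal.ofReal (Real.exp (-Real.pi * w ^ 2))

/-- The Gaussian measure `γ_N(v) dv`. -/
def gaussN (N : ℕ) : Measure (Fin N → ℝ) :=
  volume.withDensity fun v => ENNReal.ofReal (maxwell v)

lemma integral_gauss (f : ℝ → ℝ) : ∫ w, f w ∂gauss = ∫ w, Real.exp (-Real.pi * w ^ 2) * f w := by
  rw [gauss, integral_withDensity_eq_integral_toReal_smul (by fun_prop) (by simp)]
  refine integral_congr_ae (Filter.Eventually.of_forall fun w => ?_)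
  simp [ENNReal.toReal_ofReal (Real.exp_pos _).le]

lemma integrable_gauss_iff {f : ℝ → ℝ} :
    Integrable f gauss ↔ Integrable fun w => Real.exp (-Real.pi * w ^ 2) * f w := by
  rw [gauss, integrable_withDensity_iff_integrable_smul' (by fun_prop) (by simp)]
  simp [ENNReal.toReal_ofReal (Real.exp_pos _).le]

lemma ae_gauss_iff {p : ℝ → Prop} : (∀ᵐ w ∂gauss, p w) ↔ ∀ᵐ w, p w := by
  rw [gauss, ae_withDensity_iff (by fun_prop)]
  simp [Real.exp_pos]

lemma measurable_maxwell {N : ℕ} :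
    Measurable (fun v : Fin N → ℝ => ENNReal.ofReal (maxwell v)) :=
  continuous_maxwell.measurable.ennreal_ofReal

lemma ae_gaussN_iff {N : ℕ} {p : (Fin N → ℝ) → Prop} :
    (∀ᵐ v ∂gaussN N, p v) ↔ ∀ᵐ v, p v := by
  rw [gaussN, ae_withDensity_iff measurable_maxwell]
  simp [maxwell_pos]

lemma integrable_gaussN_iff {N : ℕ} {f : (Fin N → ℝ) → ℝ} :
    Integrable f (gaussN N) ↔ Integrable fun v => maxwell v * f v := by
  rw [gaussN, integrable_withDensity_iff_integrable_smul' measurable_maxwell (by simp)]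
  simp [ENNReal.toReal_ofReal (maxwell_pos _).le]

instance : IsProbabilityMeasure gauss := by
  constructor
  rw [gauss, withDensity_apply _ MeasurableSet.univ, Measure.restrict_univ,
    ← ofReal_integral_eq_lintegral_ofReal (integrable_exp_neg_mul_sq Real.pi_pos)
      (Filter.Eventually.of_forall fun w => (Real.exp_pos _).le), integral_gaussian]
  simp

instance (N : ℕ) : IsFiniteMeasure (gaussN N) :=
  isFiniteMeasure_withDensity_ofReal (integrable_maxwell N).2

lemma measurePreserving_insertNth {N : ℕ} (i : Fin (N + 1)) :
    MeasurePreserving (fun z : ℝ × (Fin N → ℝ) => (i.insertNth z.1 z.2 : Fin (N + 1) → ℝ))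
      (gauss.prod (gaussN N)) (gaussN (N + 1)) := by
  have h := (volume_preserving_piFinSuccAbove (fun _ : Fin (N + 1) => ℝ) i).symm
  rw [gauss, gaussN, prod_withDensity (by fun_prop) measurable_maxwell]
  refine measurePreserving_withDensity h measurable_maxwell fun z => ?_
  change _ = ENNReal.ofReal (maxwell (i.insertNth z.1 z.2 : Fin (N + 1) → ℝ))
  rw [maxwell_insertNth, ENNReal.ofReal_mul (Real.exp_pos _).le]

lemma gaussN_univ (N : ℕ) : gaussN N Set.univ = 1 := by
  induction N with
  | zero =>
    rw [gaussN, withDensity_apply _ MeasurableSet.univ, Measure.restrict_univ]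
    simp [maxwell, volume_pi]
  | succ N ih =>
    rw [← (measurePreserving_insertNth (0 : Fin (N + 1))).measure_preimage
      MeasurableSet.univ.nullMeasurableSet, Set.preimage_univ, ← Set.univ_prod_univ,
      Measure.prod_prod, ih, measure_univ, one_mul]

instance (N : ℕ) : IsProbabilityMeasure (gaussN N) := ⟨gaussN_univ N⟩

lemma measurePreserving_removeNth {N : ℕ} (i : Fin (N + 1)) :
    MeasurePreserving (fun v : Fin (N + 1) → ℝ => i.removeNth v) (gaussN (N + 1)) (gaussN N) := by
  have hm : Measurable (fun v : Fin (N + 1) → ℝ => (i.removeNth v : Fin N → ℝ)) :=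
    measurable_pi_lambda _ fun k => measurable_pi_apply _
  refine ⟨hm, ?_⟩
  rw [← (measurePreserving_insertNth i).map_eq, Measure.map_map hm
    (measurePreserving_insertNth i).measurable]
  have : (fun v : Fin (N + 1) → ℝ => (i.removeNth v : Fin N → ℝ)) ∘
      (fun z : ℝ × (Fin N → ℝ) => (i.insertNth z.1 z.2 : Fin (N + 1) → ℝ)) = Prod.snd := by
    funext z
    simp
  rw [this]
  exact measurePreserving_snd.map_eq

lemma measurePreserving_gaussN {N : ℕ} {T : (Fin N → ℝ) → (Fin N → ℝ)}
    (hT : MeasurePreserving T volume volume) (hm : ∀ v, maxwell (T v) = maxwell v) :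
    MeasurePreserving T (gaussN N) (gaussN N) :=
  measurePreserving_withDensity hT measurable_maxwell fun v => by rw [hm]

lemma measurePreserving_rot_gaussN {N : ℕ} {i j : Fin N} (hij : i ≠ j) (θ : ℝ) :
    MeasurePreserving (rot i j θ) (gaussN N) (gaussN N) :=
  measurePreserving_gaussN (measurePreserving_rot hij θ) fun v => by
    simp only [maxwell, rot_sum_sq hij]

lemma levelMeasure_eq {ρ μ : ℝ} (hρ : 0 < ρ) (hμ : 0 < μ) (N : ℕ) :
    levelMeasure ρ μ N = ENNReal.ofReal (weight ρ μ N) • gaussN N := by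
  rw [levelMeasure, gaussN, ← withDensity_smul _ measurable_maxwell]
  congr 1
  funext v
  simp [ENNReal.ofReal_mul (weight_pos hρ hμ N).le]

/-! ### The uniform measure on angles -/

/-- The uniform probability measure on `(0, 2π]`. -/
def unif : Measure ℝ :=
  ENNReal.ofReal (1 / (2 * Real.pi)) • volume.restrict (Set.Ioc 0 (2 * Real.pi))

instance : IsProbabilityMeasure unif := by
  constructor
  rw [unif, Measure.smul_apply, Measure.restrict_apply_univ, Real.volume_Ioc, smul_eq_mul,
    ← ENNReal.ofReal_mul (by positivity)]
  have : 1 / (2 * Real.pi) * (2 * Real.pi - 0) = 1 := by field_simp; simp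
  rw [this, ENNReal.ofReal_one]

lemma Rcol_eq_integral_unif {N : ℕ} (i j : Fin N) (f : (Fin N → ℝ) → ℝ) (v : Fin N → ℝ) :
    Rcol i j f v = ∫ θ, f (rot i j θ v) ∂unif := by
  rw [Rcol, unif, integral_smul_measure, intervalIntegral.integral_of_le (by positivity),
    ENNReal.toReal_ofReal (by positivity), smul_eq_mul]

/-- Reflection replaces a rotation by its inverse; it maps `Ioc` to `Ico`, which differs by a null
set. -/
lemma measurePreserving_sub_left_unif :
    MeasurePreserving (fun θ : ℝ => 2 * Real.pi - θ) unif unif := by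
  have h := (Measure.measurePreserving_sub_left (volume : Measure ℝ)
    (2 * Real.pi)).restrict_preimage (measurableSet_Ioc (a := (0 : ℝ)) (b := 2 * Real.pi))
  have h2 : (fun θ : ℝ => 2 * Real.pi - θ) ⁻¹' Set.Ioc 0 (2 * Real.pi) =
      Set.Ico 0 (2 * Real.pi) := by
    ext θ
    simp only [Set.mem_preimage, Set.mem_Ioc, Set.mem_Ico]
    constructor <;> rintro ⟨h1, h2⟩ <;> constructor <;> linarith
  rw [h2, Measure.restrict_congr_set Ico_ae_eq_Ioc] at h
  exact h.smul_measure _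

lemma measurePreserving_rot_unif {N : ℕ} {i j : Fin N} (hij : i ≠ j) :
    MeasurePreserving (fun z : ℝ × (Fin N → ℝ) => rot i j z.1 z.2)
      (unif.prod (gaussN N)) (gaussN N) :=
  measurePreserving_snd.comp ((MeasurePreserving.id unif).skew_product
    (g := fun θ v => rot i j θ v) (continuous_rot i j).measurable
    (Filter.Eventually.of_forall fun θ => (measurePreserving_rot_gaussN hij θ).map_eq))

end KacReservoir

end

noncomputable section

namespace KacReservoir

/-! ### Symmetric square integrable functions -/

/-- Square integrable functions on `ℝ^N`, almost everywhere invariant under permutations. -/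
structure SymMemLp {N : ℕ} (f : (Fin N → ℝ) → ℝ) : Prop where
  memLp : MemLp f 2 (gaussN N)
  symm : ∀ σ : Equiv.Perm (Fin N), ∀ᵐ v, f (v ∘ σ) = f v

section toSym

variable {ρ μ : ℝ} {N : ℕ}

lemma memLp_level_iff (hρ : 0 < ρ) (hμ : 0 < μ) {f : (Fin N → ℝ) → ℝ} :
    MemLp f 2 (levelMeasure ρ μ N) ↔ MemLp f 2 (gaussN N) := by
  have hw : ENNReal.ofReal (weight ρ μ N) ≠ 0 := by simpa using weight_pos hρ hμ N
  constructor
  · intro h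
    have h2 := h.smul_measure (c := (ENNReal.ofReal (weight ρ μ N))⁻¹) (by simpa using hw)
    rwa [levelMeasure_eq hρ hμ, smul_smul, ENNReal.inv_mul_cancel hw (by simp), one_smul] at h2
  · intro h
    rw [levelMeasure_eq hρ hμ]
    exact h.smul_measure (by simp)

lemma symMemLp_coe (hρ : 0 < ρ) (hμ : 0 < μ) (x : symL2 ρ μ N) :
    SymMemLp ((x : Lp ℝ 2 (levelMeasure ρ μ N)) : (Fin N → ℝ) → ℝ) where
  memLp := (memLp_level_iff hρ hμ).1 (Lp.memLp _)
  symm := fun σ => (ae_level_iff hρ hμ).1 (x.2 σ)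

/-- The class of a symmetric square integrable function. -/
def toSym (hρ : 0 < ρ) (hμ : 0 < μ) (f : (Fin N → ℝ) → ℝ) (hf : SymMemLp f) : symL2 ρ μ N :=
  ⟨((memLp_level_iff hρ hμ).2 hf.memLp).toLp f, fun σ => by
    have h0 := ((memLp_level_iff hρ hμ).2 hf.memLp).coeFn_toLp
    have h1 := (measurePreserving_perm_level ρ μ σ).quasiMeasurePreserving.ae_eq_comp h0
    filter_upwards [h0, h1, (ae_level_iff hρ hμ).2 (hf.symm σ)] with v h2 h3 h4
    exact (h3.trans h4).trans h2.symm⟩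

lemma coe_toSym (hρ : 0 < ρ) (hμ : 0 < μ) (f : (Fin N → ℝ) → ℝ) (hf : SymMemLp f) :
    ∀ᵐ v, ((toSym hρ hμ f hf : Lp ℝ 2 (levelMeasure ρ μ N)) : (Fin N → ℝ) → ℝ) v = f v :=
  (ae_level_iff hρ hμ).1 ((memLp_level_iff hρ hμ).2 hf.memLp).coeFn_toLp

lemma symL2_ext (hρ : 0 < ρ) (hμ : 0 < μ) {x y : symL2 ρ μ N}
    (h : ∀ᵐ v, ((x : Lp ℝ 2 (levelMeasure ρ μ N)) : (Fin N → ℝ) → ℝ) v =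
      ((y : Lp ℝ 2 (levelMeasure ρ μ N)) : (Fin N → ℝ) → ℝ) v) : x = y :=
  Subtype.ext (Lp.ext ((ae_level_iff hρ hμ).2 h))

lemma inner_symL2 (hρ : 0 < ρ) (hμ : 0 < μ) (x y : symL2 ρ μ N) :
    inner ℝ x y = weight ρ μ N * ∫ v, ((x : Lp ℝ 2 (levelMeasure ρ μ N)) : (Fin N → ℝ) → ℝ) v *
      ((y : Lp ℝ 2 (levelMeasure ρ μ N)) : (Fin N → ℝ) → ℝ) v ∂gaussN N := by
  rw [Submodule.coe_inner, L2.inner_def]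
  have : ∀ m : Measure (Fin N → ℝ), m = ENNReal.ofReal (weight ρ μ N) • gaussN N →
      ∀ F : (Fin N → ℝ) → ℝ, ∫ v, F v ∂m = weight ρ μ N * ∫ v, F v ∂gaussN N := by
    rintro m rfl F
    rw [integral_smul_measure, ENNReal.toReal_ofReal (weight_pos hρ hμ N).le, smul_eq_mul]
  rw [this _ (levelMeasure_eq hρ hμ N)]
  congr 1
  refine integral_congr_ae (Filter.Eventually.of_forall fun v => ?_)
  simp [mul_comm]

lemma inner_toSym_left (hρ : 0 < ρ) (hμ : 0 < μ) (f : (Fin N → ℝ) → ℝ) (hf : SymMemLp f)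
    (y : symL2 ρ μ N) :
    inner ℝ (toSym hρ hμ f hf) y = weight ρ μ N *
      ∫ v, f v * ((y : Lp ℝ 2 (levelMeasure ρ μ N)) : (Fin N → ℝ) → ℝ) v ∂gaussN N := by
  rw [inner_symL2 hρ hμ]
  congr 1
  refine integral_congr_ae ?_
  filter_upwards [ae_gaussN_iff.2 (coe_toSym hρ hμ f hf)] with v hv
  rw [hv]

lemma inner_toSym_right (hρ : 0 < ρ) (hμ : 0 < μ) (f : (Fin N → ℝ) → ℝ) (hf : SymMemLp f)
    (y : symL2 ρ μ N) :
    inner ℝ y (toSym hρ hμ f hf) = weight ρ μ N *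
      ∫ v, ((y : Lp ℝ 2 (levelMeasure ρ μ N)) : (Fin N → ℝ) → ℝ) v * f v ∂gaussN N := by
  rw [real_inner_comm, inner_toSym_left]
  simp only [mul_comm]

lemma coe_add (hρ : 0 < ρ) (hμ : 0 < μ) (x y : symL2 ρ μ N) :
    ∀ᵐ v, ((x + y : symL2 ρ μ N) : Lp ℝ 2 (levelMeasure ρ μ N)) v =
      (x : Lp ℝ 2 (levelMeasure ρ μ N)) v + (y : Lp ℝ 2 (levelMeasure ρ μ N)) v :=
  (ae_level_iff hρ hμ).1 (Lp.coeFn_add _ _)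

lemma coe_sub (hρ : 0 < ρ) (hμ : 0 < μ) (x y : symL2 ρ μ N) :
    ∀ᵐ v, ((x - y : symL2 ρ μ N) : Lp ℝ 2 (levelMeasure ρ μ N)) v =
      (x : Lp ℝ 2 (levelMeasure ρ μ N)) v - (y : Lp ℝ 2 (levelMeasure ρ μ N)) v :=
  (ae_level_iff hρ hμ).1 (Lp.coeFn_sub _ _)

lemma coe_smul (hρ : 0 < ρ) (hμ : 0 < μ) (c : ℝ) (x : symL2 ρ μ N) :
    ∀ᵐ v, ((c • x : symL2 ρ μ N) : Lp ℝ 2 (levelMeasure ρ μ N)) v =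
      c * (x : Lp ℝ 2 (levelMeasure ρ μ N)) v :=
  (ae_level_iff hρ hμ).1 (Lp.coeFn_smul _ _)

lemma coe_zero (hρ : 0 < ρ) (hμ : 0 < μ) :
    ∀ᵐ v, ((0 : symL2 ρ μ N) : Lp ℝ 2 (levelMeasure ρ μ N)) v = 0 :=
  (ae_level_iff hρ hμ).1 (Lp.coeFn_zero _ _ _)

end toSym

/-! ### The operators on a single level -/

/-- The creation operator between consecutive levels. -/
def plusF {N : ℕ} (f : (Fin N → ℝ) → ℝ) : (Fin (N + 1) → ℝ) → ℝ := fun v =>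
  ∑ i : Fin (N + 1), f (i.removeNth v)

/-- The annihilation operator between consecutive levels. -/
def minusF {N : ℕ} (f : (Fin (N + 1) → ℝ) → ℝ) : (Fin N → ℝ) → ℝ := fun v =>
  1 / ((N : ℝ) + 1) *
    ∑ i : Fin (N + 1), ∫ w : ℝ, Real.exp (-Real.pi * w ^ 2) * f (i.insertNth w v)

/-- The Kac collision operator on a single level. -/
def kacF {N : ℕ} (f : (Fin N → ℝ) → ℝ) : (Fin N → ℝ) → ℝ := fun v =>
  ∑ p : Fin N × Fin N with p.1 < p.2, (Rcol p.1 p.2 f v - f v)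

variable {N : ℕ}

lemma plusF_congr {f g : (Fin N → ℝ) → ℝ} (h : ∀ᵐ v, f v = g v) :
    ∀ᵐ v, plusF f v = plusF g v := by
  filter_upwards [ae_all_iff.2 fun i : Fin (N + 1) => ae_removeNth i h] with v hv
  simp only [plusF, hv]

lemma minusF_congr {f g : (Fin (N + 1) → ℝ) → ℝ} (h : ∀ᵐ v, f v = g v) :
    ∀ᵐ v, minusF f v = minusF g v := by
  filter_upwards [ae_all_iff.2 fun i : Fin (N + 1) => ae_insertNth i h] with v hv
  simp only [minusF]
  congr 1
  refine Finset.sum_congr rfl fun i _ => integral_congr_ae ?_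
  filter_upwards [hv i] with w hw
  rw [hw]

lemma Rcol_congr {i j : Fin N} (hij : i ≠ j) {f g : (Fin N → ℝ) → ℝ} (h : ∀ᵐ v, f v = g v) :
    ∀ᵐ v, Rcol i j f v = Rcol i j g v := by
  filter_upwards [ae_rot hij h] with v hv
  rw [Rcol, Rcol, intervalIntegral.integral_of_le (by positivity),
    intervalIntegral.integral_of_le (by positivity), integral_congr_ae hv]

lemma kacF_congr {f g : (Fin N → ℝ) → ℝ} (h : ∀ᵐ v, f v = g v) :
    ∀ᵐ v, kacF f v = kacF g v := by
  have h1 := ae_all_iff.2 fun p : {p : Fin N × Fin N // p.1 < p.2} =>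
    Rcol_congr (ne_of_lt p.2) h
  filter_upwards [h, h1] with v hv hv1
  refine Finset.sum_congr rfl fun p hp => ?_
  rw [hv, hv1 ⟨p, (Finset.mem_filter.1 hp).2⟩]

lemma ae_perm {p : (Fin N → ℝ) → Prop} (σ : Equiv.Perm (Fin N)) (h : ∀ᵐ v, p v) :
    ∀ᵐ v : Fin N → ℝ, p (v ∘ σ) :=
  (measurePreserving_perm σ).quasiMeasurePreserving.ae h

/-! #### Creation -/

lemma exists_removeNth_comp (σ : Equiv.Perm (Fin (N + 1))) (i : Fin (N + 1)) :
    ∃ τ : Equiv.Perm (Fin N), ∀ v : Fin (N + 1) → ℝ,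
      (i.removeNth (v ∘ σ) : Fin N → ℝ) = (σ i).removeNth v ∘ τ := by
  let e : {x // x ≠ i} ≃ {x // x ≠ σ i} := σ.subtypeEquiv fun x => by simp
  refine ⟨(finSuccAboveEquiv i).trans (e.trans (finSuccAboveEquiv (σ i)).symm),
    fun v => funext fun k => ?_⟩
  simp only [Fin.removeNth_apply, Function.comp_apply, Equiv.trans_apply]
  have h := congrArg Subtype.val ((finSuccAboveEquiv (σ i)).apply_symm_apply
    (e ((finSuccAboveEquiv i) k)))
  exact congrArg v h.symm

lemma SymMemLp.plusF {f : (Fin N → ℝ) → ℝ} (hf : SymMemLp f) : SymMemLp (plusF f) where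
  memLp := memLp_finsetSum _ fun i _ =>
    hf.memLp.comp_measurePreserving (measurePreserving_removeNth i)
  symm := fun σ => by
    choose τ hτ using fun i => exists_removeNth_comp σ i
    have h := ae_all_iff.2 fun i : Fin (N + 1) => ae_removeNth (σ i) (hf.symm (τ i))
    filter_upwards [h] with v hv
    simp only [KacReservoir.plusF, hτ, hv]
    exact Equiv.sum_comp σ (fun i => f (i.removeNth v))

/-! #### Annihilation -/

lemma SymMemLp.integrable {f : (Fin N → ℝ) → ℝ} (hf : SymMemLp f) :
    Integrable (fun v => maxwell v * f v) :=
  integrable_gaussN_iff.1 (hf.memLp.integrable (by norm_num))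

/-- By symmetry all `N + 1` insertion places give the same integral, so the normalised sum collapses
to insertion in front. -/
lemma minusF_eq {f : (Fin (N + 1) → ℝ) → ℝ} (hf : SymMemLp f) :
    ∀ᵐ v, minusF f v = ∫ w, f (Fin.cons w v) ∂gauss := by
  have h := ae_all_iff.2 fun i : Fin (N + 1) =>
    ae_insertNth (0 : Fin (N + 1)) (hf.symm i.cycleRange)
  filter_upwards [h] with v hv
  have h1 : ∀ i : Fin (N + 1), ∫ w : ℝ, Real.exp (-Real.pi * w ^ 2) * f (i.insertNth w v) =
      ∫ w, f (Fin.cons w v) ∂gauss := by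
    intro i
    rw [integral_gauss]
    refine integral_congr_ae ?_
    filter_upwards [hv i] with w hw
    rw [Fin.insertNth_zero', Fin.cons_comp_cycleRange] at hw
    rw [hw]
  simp only [minusF, h1, Finset.sum_const, Finset.card_univ, Fintype.card_fin, nsmul_eq_mul]
  push_cast
  have : (N : ℝ) + 1 ≠ 0 := by positivity
  field_simp

lemma measurePreserving_cons :
    MeasurePreserving (fun z : ℝ × (Fin N → ℝ) => (Fin.cons z.1 z.2 : Fin (N + 1) → ℝ))
      (gauss.prod (gaussN N)) (gaussN (N + 1)) := by
  simpa only [Fin.insertNth_zero'] using measurePreserving_insertNth (0 : Fin (N + 1))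

lemma ae_cons {p : (Fin (N + 1) → ℝ) → Prop} (hp : ∀ᵐ v, p v) :
    ∀ᵐ v : Fin N → ℝ, ∀ᵐ w : ℝ, p (Fin.cons w v) := by
  simpa only [Fin.insertNth_zero'] using ae_insertNth (0 : Fin (N + 1)) hp

lemma cons_comp (σ : Equiv.Perm (Fin N)) (w : ℝ) (v : Fin N → ℝ) :
    (Fin.cons w (v ∘ σ) : Fin (N + 1) → ℝ) =
      (Fin.cons w v : Fin (N + 1) → ℝ) ∘ Equiv.Perm.decomposeFin.symm (0, σ) := by
  funext k
  refine Fin.cases ?_ (fun k => ?_) k <;> simp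

lemma SymMemLp.minusF {f : (Fin (N + 1) → ℝ) → ℝ} (hf : SymMemLp f) : SymMemLp (minusF f) where
  memLp := (memLp_average measurePreserving_cons hf.memLp).ae_eq
    (ae_gaussN_iff.2 ((minusF_eq hf).mono fun v hv => hv.symm))
  symm := fun σ => by
    filter_upwards [minusF_eq hf, ae_perm σ (minusF_eq hf),
      ae_cons (hf.symm (Equiv.Perm.decomposeFin.symm (0, σ)))] with v h1 h2 h3
    rw [h1, h2]
    refine integral_congr_ae (ae_gauss_iff.2 ?_)
    filter_upwards [h3] with w hw
    rw [cons_comp, hw]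

/-- Removing coordinate `i` is dual to averaging over an insertion at `i`, by Fubini for the
factorised Gaussian. The factor `N + 1` undoes the normalisation in `minusF`. -/
lemma integral_plusF_mul {f : (Fin N → ℝ) → ℝ} {g : (Fin (N + 1) → ℝ) → ℝ}
    (hf : MemLp f 2 (gaussN N)) (hg : MemLp g 2 (gaussN (N + 1))) :
    ∫ v, plusF f v * g v ∂gaussN (N + 1) = ((N : ℝ) + 1) * ∫ v, f v * minusF g v ∂gaussN N := by
  have hi : ∀ i : Fin (N + 1), ∫ v, f (i.removeNth v) * g v ∂gaussN (N + 1) =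
      ∫ v, (∫ w, g (i.insertNth w v) ∂gauss) * f v ∂gaussN N := by
    intro i
    rw [integral_average_mul (measurePreserving_insertNth i) hg hf,
      ← (measurePreserving_insertNth i).map_eq, integral_map
        (measurePreserving_insertNth i).measurable.aemeasurable]
    · simp [mul_comm]
    · rw [(measurePreserving_insertNth i).map_eq]
      exact (hf.comp_measurePreserving (measurePreserving_removeNth i)).aestronglyMeasurable.mul
        hg.aestronglyMeasurable
  simp only [plusF, Finset.sum_mul]
  have h1 : ∀ i : Fin (N + 1), Integrable (fun v => f (i.removeNth v) * g v) (gaussN (N + 1)) :=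
    fun i => (hf.comp_measurePreserving (measurePreserving_removeNth i)).integrable_mul hg
  have h2 : ∀ i : Fin (N + 1),
      Integrable (fun v => (∫ w, g (i.insertNth w v) ∂gauss) * f v) (gaussN N) :=
    fun i => (memLp_average (measurePreserving_insertNth i) hg).integrable_mul hf
  rw [integral_finsetSum _ fun i _ => h1 i]
  simp only [hi]
  rw [← integral_finsetSum _ fun i _ => h2 i, ← integral_const_mul]
  refine integral_congr_ae (Filter.Eventually.of_forall fun v => ?_)
  have : (N : ℝ) + 1 ≠ 0 := by positivity
  simp only [minusF, ← integral_gauss, ← Finset.sum_mul]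
  field_simp

lemma removeNth_succ_cons (j : Fin (N + 1)) (w : ℝ) (v : Fin (N + 1) → ℝ) :
    (j.succ.removeNth (Fin.cons w v : Fin (N + 2) → ℝ) : Fin (N + 1) → ℝ) =
      Fin.cons w (j.removeNth v) := by
  funext k
  refine Fin.cases ?_ (fun k => ?_) k <;> simp [Fin.removeNth_apply]

lemma minusF_plusF_zero {f : (Fin 0 → ℝ) → ℝ} (hf : SymMemLp f) :
    ∀ᵐ v, minusF (plusF f) v = f v := by
  filter_upwards [minusF_eq hf.plusF] with v hv
  rw [hv]
  have : ∀ w : ℝ, plusF f (Fin.cons w v) = f v := fun w => by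
    rw [plusF, Fin.sum_univ_one]
    exact congrArg f (Subsingleton.elim _ _)
  simp [this]

/-- The canonical commutation relation. -/
lemma minusF_plusF {f : (Fin (N + 1) → ℝ) → ℝ} (hf : SymMemLp f) :
    ∀ᵐ v, minusF (plusF f) v = plusF (minusF f) v + f v := by
  have h1 := ae_all_iff.2 fun j : Fin (N + 1) => ae_removeNth j
    (integrable_insertNth 0 hf.integrable)
  filter_upwards [minusF_eq hf.plusF, plusF_congr (minusF_eq hf), h1] with v hv hv1 hv2
  rw [hv, hv1]
  -- The term that deletes the new velocity `w` produces the identity in the commutator; the others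
  -- delete an old one and commute with averaging over `w`.
  have h2 : ∀ w : ℝ, plusF f (Fin.cons w v) =
      f v + ∑ j : Fin (N + 1), f (Fin.cons w (j.removeNth v)) := fun w => by
    rw [plusF, Fin.sum_univ_succ]
    simp only [removeNth_succ_cons]
    simp
  have h3 : ∀ j : Fin (N + 1), Integrable (fun w => f (Fin.cons w (j.removeNth v))) gauss := by
    intro j
    have := hv2 j
    simp only [Fin.insertNth_zero'] at this
    exact integrable_gauss_iff.2 this
  simp only [h2]
  rw [integral_add (integrable_const _) (integrable_finsetSum _ fun j _ => h3 j),
    integral_finsetSum _ fun j _ => h3 j]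
  simp [plusF, add_comm]

end KacReservoir

end

noncomputable section

namespace KacReservoir

/-! #### Collisions -/

variable {N : ℕ}

lemma rot_swap {i j : Fin N} (hij : i ≠ j) (θ : ℝ) (v : Fin N → ℝ) :
    rot j i θ v = rot i j (2 * Real.pi - θ) v := by
  funext k
  simp only [rot, Real.cos_two_pi_sub, Real.sin_two_pi_sub]
  by_cases h1 : k = i
  · subst h1; simp only [hij, if_true, if_false]; ring
  · by_cases h2 : k = j
    · subst h2; simp only [hij.symm, if_true, if_false]; ring
    · simp only [h1, h2, if_false]

lemma rot_rot_inv {i j : Fin N} (hij : i ≠ j) (θ : ℝ) (v : Fin N → ℝ) :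
    rot i j (2 * Real.pi - θ) (rot i j θ v) = v := by
  funext k
  simp only [rot, Real.cos_two_pi_sub, Real.sin_two_pi_sub, if_true, hij.symm, if_false]
  have h := Real.cos_sq_add_sin_sq θ
  by_cases h1 : k = i
  · subst h1; simp only [if_true]; linear_combination v k * h
  · by_cases h2 : k = j
    · subst h2; simp only [hij.symm, if_true, if_false]; linear_combination v k * h
    · simp only [h1, h2, if_false]

lemma rot_comp_perm (σ : Equiv.Perm (Fin N)) (i j : Fin N) (θ : ℝ) (v : Fin N → ℝ) :
    rot i j θ (v ∘ σ) = rot (σ i) (σ j) θ v ∘ σ := by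
  funext k
  simp [rot]

lemma integral_unif_sub_left (F : ℝ → ℝ) : ∫ θ, F (2 * Real.pi - θ) ∂unif = ∫ θ, F θ ∂unif :=
  measurePreserving_sub_left_unif.integral_comp
    (Homeomorph.subLeft (2 * Real.pi)).measurableEmbedding F

lemma Rcol_swap {i j : Fin N} (hij : i ≠ j) (f : (Fin N → ℝ) → ℝ) (v : Fin N → ℝ) :
    Rcol j i f v = Rcol i j f v := by
  simp only [Rcol_eq_integral_unif, rot_swap hij]
  exact integral_unif_sub_left fun θ => f (rot i j θ v)

lemma memLp_Rcol {i j : Fin N} (hij : i ≠ j) {f : (Fin N → ℝ) → ℝ} (hf : MemLp f 2 (gaussN N)) :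
    MemLp (Rcol i j f) 2 (gaussN N) := by
  have h := memLp_average (measurePreserving_rot_unif hij) hf
  simpa only [← Rcol_eq_integral_unif] using h

lemma integral_Rcol_mul {i j : Fin N} (hij : i ≠ j) {f g : (Fin N → ℝ) → ℝ}
    (hf : MemLp f 2 (gaussN N)) (hg : MemLp g 2 (gaussN N)) :
    ∫ v, Rcol i j f v * g v ∂gaussN N =
      ∫ z : ℝ × (Fin N → ℝ), f (rot i j z.1 z.2) * g z.2 ∂(unif.prod (gaussN N)) := by
  simp only [Rcol_eq_integral_unif]
  exact integral_average_mul (measurePreserving_rot_unif hij) hf hg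

/-- The change of variables `(θ, v) ↦ (2π - θ, rot θ v)` preserves the joint measure and exchanges
the rotated with the unrotated argument. -/
lemma integral_Rcol_mul_comm {i j : Fin N} (hij : i ≠ j) {f g : (Fin N → ℝ) → ℝ}
    (hf : MemLp f 2 (gaussN N)) (hg : MemLp g 2 (gaussN N)) :
    ∫ v, Rcol i j f v * g v ∂gaussN N = ∫ v, f v * Rcol i j g v ∂gaussN N := by
  have hS : MeasurePreserving (fun z : ℝ × (Fin N → ℝ) => (2 * Real.pi - z.1, rot i j z.1 z.2))
      (unif.prod (gaussN N)) (unif.prod (gaussN N)) :=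
    measurePreserving_sub_left_unif.skew_product (g := fun θ v => rot i j θ v)
      (continuous_rot i j).measurable
      (Filter.Eventually.of_forall fun θ => (measurePreserving_rot_gaussN hij θ).map_eq)
  have hm : AEStronglyMeasurable (fun z : ℝ × (Fin N → ℝ) => g (rot i j z.1 z.2) * f z.2)
      (unif.prod (gaussN N)) :=
    (hg.comp_measurePreserving (measurePreserving_rot_unif hij)).aestronglyMeasurable.mul
      (hf.comp_measurePreserving measurePreserving_snd).aestronglyMeasurable
  simp only [mul_comm (f _) (Rcol i j g _)]
  rw [integral_Rcol_mul hij hf hg, integral_Rcol_mul hij hg hf]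
  nth_rewrite 2 [← hS.map_eq]
  rw [integral_map hS.measurable.aemeasurable (by rwa [hS.map_eq])]
  simp only [rot_rot_inv hij]
  simp only [mul_comm (g _)]

/-- `2ab ≤ a² + b²` for the rotated and unrotated values, whose second moments agree by rotation
invariance. -/
lemma integral_mul_Rcol_le {i j : Fin N} (hij : i ≠ j) {f : (Fin N → ℝ) → ℝ}
    (hf : MemLp f 2 (gaussN N)) :
    ∫ v, f v * Rcol i j f v ∂gaussN N ≤ ∫ v, f v * f v ∂gaussN N := by
  rw [← integral_Rcol_mul_comm hij hf hf, integral_Rcol_mul hij hf hf]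
  have hF := hf.comp_measurePreserving (measurePreserving_rot_unif hij)
  have hG : MemLp (fun z : ℝ × (Fin N → ℝ) => f z.2) 2 (unif.prod (gaussN N)) :=
    hf.comp_measurePreserving measurePreserving_snd
  have e1 : ∫ z : ℝ × (Fin N → ℝ), f (rot i j z.1 z.2) ^ 2 ∂(unif.prod (gaussN N)) =
      ∫ v, f v ^ 2 ∂gaussN N := by
    conv_rhs => rw [← (measurePreserving_rot_unif hij).map_eq]
    rw [integral_map (measurePreserving_rot_unif hij).measurable.aemeasurable]
    rw [(measurePreserving_rot_unif hij).map_eq]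
    exact hf.aestronglyMeasurable.pow 2
  have e2 : ∫ z : ℝ × (Fin N → ℝ), f z.2 ^ 2 ∂(unif.prod (gaussN N)) =
      ∫ v, f v ^ 2 ∂gaussN N := by
    have hs : MeasurePreserving Prod.snd (unif.prod (gaussN N)) (gaussN N) := measurePreserving_snd
    conv_rhs => rw [← hs.map_eq]
    rw [integral_map hs.measurable.aemeasurable]
    rw [hs.map_eq]
    exact hf.aestronglyMeasurable.pow 2
  have i1 : Integrable (fun z : ℝ × (Fin N → ℝ) => f (rot i j z.1 z.2) ^ 2)
      (unif.prod (gaussN N)) := hF.integrable_sq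
  have i2 : Integrable (fun z : ℝ × (Fin N → ℝ) => f z.2 ^ 2) (unif.prod (gaussN N)) :=
    hG.integrable_sq
  calc ∫ z : ℝ × (Fin N → ℝ), f (rot i j z.1 z.2) * f z.2 ∂(unif.prod (gaussN N))
      ≤ ∫ z : ℝ × (Fin N → ℝ), (1 / 2 * f (rot i j z.1 z.2) ^ 2 + 1 / 2 * f z.2 ^ 2)
          ∂(unif.prod (gaussN N)) :=
        integral_mono (hF.integrable_mul hG) ((i1.const_mul _).add (i2.const_mul _)) fun z => by
          have := sq_nonneg (f (rot i j z.1 z.2) - f z.2)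
          linarith
    _ = ∫ v, f v * f v ∂gaussN N := by
        rw [integral_add (i1.const_mul _) (i2.const_mul _), integral_const_mul,
          integral_const_mul, e1, e2]
        simp only [← sq]
        ring

/-- The index set `i < j` is not stable under permutations, but `i ≠ j` is; this is how `kacF` is
seen to preserve symmetry. -/
lemma sum_lt_eq_half_sum_ne {g : Fin N → Fin N → ℝ} (hg : ∀ i j, i ≠ j → g j i = g i j) :
    ∑ p : Fin N × Fin N with p.1 < p.2, g p.1 p.2 =
      1 / 2 * ∑ p : Fin N × Fin N with p.1 ≠ p.2, g p.1 p.2 := by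
  have h1 : ∑ p : Fin N × Fin N with p.1 ≠ p.2, g p.1 p.2 =
      ∑ p : Fin N × Fin N with p.1 < p.2, g p.1 p.2 +
      ∑ p : Fin N × Fin N with p.2 < p.1, g p.1 p.2 := by
    rw [← Finset.sum_union]
    · congr 1
      ext p
      simp [lt_or_lt_iff_ne]
    · rw [Finset.disjoint_filter]
      intro p _ h
      exact h.asymm
  have h2 : ∑ p : Fin N × Fin N with p.2 < p.1, g p.1 p.2 =
      ∑ p : Fin N × Fin N with p.1 < p.2, g p.1 p.2 := by
    refine Finset.sum_equiv (Equiv.prodComm _ _) (fun p => by simp) fun p hp => ?_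
    simp only [Equiv.prodComm_apply, Prod.fst_swap, Prod.snd_swap]
    exact hg _ _ (ne_of_lt (Finset.mem_filter.1 hp).2)
  rw [h1, h2]; ring

lemma sum_lt_comp_perm {g : Fin N → Fin N → ℝ} (hg : ∀ i j, i ≠ j → g j i = g i j)
    (σ : Equiv.Perm (Fin N)) :
    ∑ p : Fin N × Fin N with p.1 < p.2, g (σ p.1) (σ p.2) =
      ∑ p : Fin N × Fin N with p.1 < p.2, g p.1 p.2 := by
  rw [sum_lt_eq_half_sum_ne hg, sum_lt_eq_half_sum_ne (g := fun i j => g (σ i) (σ j))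
    fun i j hij => hg _ _ (σ.injective.ne hij)]
  congr 1
  exact Finset.sum_equiv (σ.prodCongr σ) (fun p => by simp) fun p _ => rfl

lemma SymMemLp.kacF {f : (Fin N → ℝ) → ℝ} (hf : SymMemLp f) : SymMemLp (kacF f) where
  memLp := memLp_finsetSum _ fun p hp =>
    (memLp_Rcol (ne_of_lt (Finset.mem_filter.1 hp).2) hf.memLp).sub hf.memLp
  symm := fun σ => by
    have h := ae_all_iff.2 fun p : {p : Fin N × Fin N // p.1 < p.2} =>
      ae_rot (σ.injective.ne (ne_of_lt p.2)) (hf.symm σ)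
    filter_upwards [h, hf.symm σ] with v hv hv1
    have h1 : ∀ p ∈ Finset.univ.filter (fun p : Fin N × Fin N => p.1 < p.2),
        Rcol p.1 p.2 f (v ∘ σ) - f (v ∘ σ) = Rcol (σ p.1) (σ p.2) f v - f v := by
      intro p hp
      rw [hv1, Rcol, Rcol, intervalIntegral.integral_of_le (by positivity),
        intervalIntegral.integral_of_le (by positivity)]
      simp only [rot_comp_perm]
      rw [integral_congr_ae (hv ⟨p, (Finset.mem_filter.1 hp).2⟩)]
    rw [KacReservoir.kacF, Finset.sum_congr rfl h1]
    exact sum_lt_comp_perm (g := fun i j => Rcol i j f v - f v)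
      (fun i j hij => by rw [Rcol_swap hij]) σ

lemma integral_mul_kacF {f g : (Fin N → ℝ) → ℝ} (hf : MemLp f 2 (gaussN N))
    (hg : MemLp g 2 (gaussN N)) :
    ∫ v, f v * kacF g v ∂gaussN N = ∑ p : Fin N × Fin N with p.1 < p.2,
      (∫ v, f v * Rcol p.1 p.2 g v ∂gaussN N - ∫ v, f v * g v ∂gaussN N) := by
  have h1 : ∀ p ∈ Finset.univ.filter (fun p : Fin N × Fin N => p.1 < p.2),
      Integrable (fun v => f v * Rcol p.1 p.2 g v) (gaussN N) := fun p hp =>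
    hf.integrable_mul (memLp_Rcol (ne_of_lt (Finset.mem_filter.1 hp).2) hg)
  have h2 : Integrable (fun v => f v * g v) (gaussN N) := hf.integrable_mul hg
  simp only [kacF, Finset.mul_sum, mul_sub]
  rw [integral_finsetSum]
  · exact Finset.sum_congr rfl fun p hp => integral_sub (h1 p hp) h2
  · exact fun p hp => (h1 p hp).sub h2

lemma integral_kacF_mul {f g : (Fin N → ℝ) → ℝ} (hf : MemLp f 2 (gaussN N))
    (hg : MemLp g 2 (gaussN N)) :
    ∫ v, kacF f v * g v ∂gaussN N = ∫ v, f v * kacF g v ∂gaussN N := by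
  simp only [mul_comm _ (g _)]
  rw [integral_mul_kacF hg hf, integral_mul_kacF hf hg]
  refine Finset.sum_congr rfl fun p hp => ?_
  simp only [mul_comm (g _)]
  rw [integral_Rcol_mul_comm (ne_of_lt (Finset.mem_filter.1 hp).2) hf hg]

lemma integral_mul_kacF_nonpos {f : (Fin N → ℝ) → ℝ} (hf : MemLp f 2 (gaussN N)) :
    ∫ v, f v * kacF f v ∂gaussN N ≤ 0 := by
  rw [integral_mul_kacF hf hf]
  exact Finset.sum_nonpos fun p hp => sub_nonpos.2
    (integral_mul_Rcol_le (ne_of_lt (Finset.mem_filter.1 hp).2) hf)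

/-- Functions of the kinetic energy are invariant under collisions. -/
lemma kacF_eq_zero {f : (Fin N → ℝ) → ℝ}
    (hf : ∀ i j : Fin N, i ≠ j → ∀ θ v, f (rot i j θ v) = f v) (v : Fin N → ℝ) :
    kacF f v = 0 := by
  refine Finset.sum_eq_zero fun p hp => ?_
  simp [Rcol_eq_integral_unif, hf _ _ (ne_of_lt (Finset.mem_filter.1 hp).2)]

/-! ### The ladder of the reservoir model -/

lemma symMemLp_const (c : ℝ) : SymMemLp (fun _ : Fin N → ℝ => c) where
  memLp := memLp_const c
  symm := fun _ => Filter.Eventually.of_forall fun _ => rfl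

lemma weight_succ {ρ μ : ℝ} (n : ℕ) :
    ((n : ℝ) + 1) * weight ρ μ (n + 1) = μ / ρ * weight ρ μ n := by
  have : (n : ℝ) + 1 ≠ 0 := by positivity
  simp only [weight, Nat.factorial_succ, pow_succ]
  push_cast
  field_simp

lemma hasSum_weight (ρ μ : ℝ) : HasSum (weight ρ μ) 1 := by
  have h := (NormedSpace.expSeries_div_hasSum_exp (μ / ρ)).mul_right (Real.exp (-(μ / ρ)))
  rw [← Real.exp_eq_exp_ℝ, ← Real.exp_add, add_neg_cancel, Real.exp_zero] at h
  have e : weight ρ μ = fun n => (μ / ρ) ^ n / (n.factorial : ℝ) * Real.exp (-(μ / ρ)) := by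
    funext n
    rw [weight]
    ring
  rw [e]
  exact h

section ladder

variable {ρ μ : ℝ} (hρ : 0 < ρ) (hμ : 0 < μ)

/-- The creation, annihilation and collision operators on the levels of the Hilbert space. -/
def ladder : Ladder (fun N => symL2 ρ μ N) (μ / ρ) (weight ρ μ) where
  B := fun _ x => toSym hρ hμ _ (symMemLp_coe hρ hμ x).plusF
  C := fun _ x => toSym hρ hμ _ (symMemLp_coe hρ hμ x).minusF
  K := fun _ x => toSym hρ hμ _ (symMemLp_coe hρ hμ x).kacF
  one := fun _ => toSym hρ hμ _ (symMemLp_const 1)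
  adj := fun n x y => by
    rw [inner_toSym_left, inner_toSym_right,
      integral_plusF_mul (symMemLp_coe hρ hμ x).memLp (symMemLp_coe hρ hμ y).memLp,
      ← mul_assoc, ← mul_assoc, ← weight_succ]
    ring
  K_symm := fun n x y => by
    rw [inner_toSym_left, inner_toSym_right,
      integral_kacF_mul (symMemLp_coe hρ hμ x).memLp (symMemLp_coe hρ hμ y).memLp]
  K_nonpos := fun n x => by
    rw [inner_toSym_right]
    exact mul_nonpos_of_nonneg_of_nonpos (weight_pos hρ hμ n).le
      (integral_mul_kacF_nonpos (symMemLp_coe hρ hμ x).memLp)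
  comm_zero := fun x => symL2_ext hρ hμ (by
    filter_upwards [coe_toSym hρ hμ _ (symMemLp_coe hρ hμ
        (toSym hρ hμ _ (symMemLp_coe hρ hμ x).plusF)).minusF,
      minusF_congr (coe_toSym hρ hμ _ (symMemLp_coe hρ hμ x).plusF),
      minusF_plusF_zero (symMemLp_coe hρ hμ x)] with v h1 h2 h3
    rw [h1, h2, h3])
  comm := fun n x => symL2_ext hρ hμ (by
    filter_upwards [coe_toSym hρ hμ _ (symMemLp_coe hρ hμ
        (toSym hρ hμ _ (symMemLp_coe hρ hμ x).plusF)).minusF,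
      minusF_congr (coe_toSym hρ hμ _ (symMemLp_coe hρ hμ x).plusF),
      minusF_plusF (symMemLp_coe hρ hμ x), coe_toSym hρ hμ _ (symMemLp_coe hρ hμ
        (toSym hρ hμ _ (symMemLp_coe hρ hμ x).minusF)).plusF,
      plusF_congr (coe_toSym hρ hμ _ (symMemLp_coe hρ hμ x).minusF),
      coe_add hρ hμ (toSym hρ hμ _ (symMemLp_coe hρ hμ
        (toSym hρ hμ _ (symMemLp_coe hρ hμ x).minusF)).plusF) x] with v h1 h2 h3 h4 h5 h6
    rw [h1, h2, h3, h6, h4, h5])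
  B_one := fun n => symL2_ext hρ hμ (by
    filter_upwards [coe_toSym hρ hμ _ (symMemLp_coe hρ hμ
        (toSym hρ hμ _ (symMemLp_const (N := n) 1))).plusF,
      plusF_congr (coe_toSym hρ hμ _ (symMemLp_const (N := n) 1)),
      coe_smul hρ hμ ((n : ℝ) + 1) (toSym hρ hμ _ (symMemLp_const (N := n + 1) 1)),
      coe_toSym hρ hμ _ (symMemLp_const (N := n + 1) 1)] with v h1 h2 h3 h4
    rw [h1, h2, h3, h4]
    simp [plusF])
  C_one := fun n => symL2_ext hρ hμ (by
    filter_upwards [coe_toSym hρ hμ _ (symMemLp_coe hρ hμ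
        (toSym hρ hμ _ (symMemLp_const (N := n + 1) 1))).minusF,
      minusF_congr (coe_toSym hρ hμ _ (symMemLp_const (N := n + 1) 1)),
      minusF_eq (symMemLp_const (N := n + 1) 1),
      coe_toSym hρ hμ _ (symMemLp_const (N := n) 1)] with v h1 h2 h3 h4
    rw [h1, h2, h3, h4]
    simp)
  K_one := fun n => symL2_ext hρ hμ (by
    filter_upwards [coe_toSym hρ hμ _ (symMemLp_coe hρ hμ
        (toSym hρ hμ _ (symMemLp_const (N := n) 1))).kacF,
      kacF_congr (coe_toSym hρ hμ _ (symMemLp_const (N := n) 1)),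
      coe_zero (ρ := ρ) (μ := μ) (N := n) hρ hμ] with v h1 h2 h3
    rw [h1, h2, h3]
    exact kacF_eq_zero (fun _ _ _ _ _ => rfl) v)
  inner_one := fun n => by
    rw [inner_toSym_left, integral_congr_ae (g := fun _ => (1 : ℝ))]
    · simp
    · filter_upwards [ae_gaussN_iff.2 (coe_toSym hρ hμ _ (symMemLp_const (N := n) 1))] with v hv
      rw [hv, one_mul]
  -- Level zero is a space of functions on a single point.
  eq_zero := fun x hx => symL2_ext hρ hμ (by
    rw [inner_toSym_right] at hx
    have h1 : ∀ v : Fin 0 → ℝ, ((x : Lp ℝ 2 (levelMeasure ρ μ 0)) : (Fin 0 → ℝ) → ℝ) v =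
        ((x : Lp ℝ 2 (levelMeasure ρ μ 0)) : (Fin 0 → ℝ) → ℝ) 0 := fun v => by
      rw [Subsingleton.elim v 0]
    simp only [h1] at hx
    filter_upwards [coe_zero (ρ := ρ) (μ := μ) (N := 0) hρ hμ] with v hv
    rw [h1, hv]
    simpa [(weight_pos hρ hμ 0).ne'] using hx)

end ladder

end KacReservoir

end

noncomputable section

namespace KacReservoir

/-! ### The generator as maximal operator of the ladder -/

section generator

variable {ρ μ lam : ℝ}

/-- The bridge between the pointwise formula of the generator and the ladder; through it all
abstract results apply to `generator`. -/
lemma coe_lev (hρ : 0 < ρ) (hμ : 0 < μ) (h : Space ρ μ) (N : ℕ) :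
    ∀ᵐ v, (((ladder hρ hμ).lev ρ μ lam h N : symL2 ρ μ N) : Lp ℝ 2 (levelMeasure ρ μ N)) v =
      genExpr ρ μ lam (toState h) N v := by
  set Λ := ladder hρ hμ
  cases N with
  | zero =>
    filter_upwards [coe_add hρ hμ (μ • (Λ.C 0 (h 1) - h 0)) (lam • Λ.K 0 (h 0)),
      coe_smul hρ hμ μ (Λ.C 0 (h 1) - h 0), coe_smul hρ hμ lam (Λ.K 0 (h 0)),
      coe_sub hρ hμ (Λ.C 0 (h 1)) (h 0),
      coe_toSym hρ hμ _ (symMemLp_coe hρ hμ (h 1)).minusF,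
      coe_toSym hρ hμ _ (symMemLp_coe hρ hμ (h 0)).kacF] with v h1 h2 h3 h4 h5 h6
    refine h1.trans ?_
    rw [h2, h3, h4]
    refine (congrArg₂ (fun a b => μ * (a - _) + lam * b) h5 h6).trans ?_
    simp only [genExpr, Pplus, Num, Nat.cast_zero, zero_mul, sub_zero, mul_zero, zero_add]
    rfl
  | succ n =>
    filter_upwards [coe_add hρ hμ (ρ • (Λ.B n (h n) - ((n : ℝ) + 1) • h (n + 1)) +
        μ • (Λ.C (n + 1) (h (n + 2)) - h (n + 1))) (lam • Λ.K (n + 1) (h (n + 1))),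
      coe_add hρ hμ (ρ • (Λ.B n (h n) - ((n : ℝ) + 1) • h (n + 1)))
        (μ • (Λ.C (n + 1) (h (n + 2)) - h (n + 1))),
      coe_smul hρ hμ ρ (Λ.B n (h n) - ((n : ℝ) + 1) • h (n + 1)),
      coe_sub hρ hμ (Λ.B n (h n)) (((n : ℝ) + 1) • h (n + 1)),
      coe_smul hρ hμ ((n : ℝ) + 1) (h (n + 1)),
      coe_smul hρ hμ μ (Λ.C (n + 1) (h (n + 2)) - h (n + 1)),
      coe_sub hρ hμ (Λ.C (n + 1) (h (n + 2))) (h (n + 1)),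
      coe_smul hρ hμ lam (Λ.K (n + 1) (h (n + 1))),
      coe_toSym hρ hμ _ (symMemLp_coe hρ hμ (h n)).plusF,
      coe_toSym hρ hμ _ (symMemLp_coe hρ hμ (h (n + 2))).minusF,
      coe_toSym hρ hμ _ (symMemLp_coe hρ hμ (h (n + 1))).kacF]
      with v h1 h2 h3 h4 h5 h6 h7 h8 h9 h10 h11
    refine h1.trans ?_
    rw [h2, h3, h4, h5, h6, h7, h8]
    refine (congrArg₂ (fun a b => ρ * (a - _) + μ * (b - _) + lam * _) h9 h10).trans ?_
    refine (congrArg (fun a => ρ * (_ - _) + μ * (_ - _) + lam * a) h11).trans ?_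
    simp only [genExpr, Num]
    push_cast
    rfl

lemma represents_iff (hρ : 0 < ρ) (hμ : 0 < μ) {g : Space ρ μ} {F : State} :
    Represents g F ↔
      ∀ N, ∀ᵐ v, (g N : Lp ℝ 2 (levelMeasure ρ μ N)) v = F N v :=
  forall_congr' fun _ => ae_level_iff hρ hμ

lemma isMaximal_generator (hρ : 0 < ρ) (hμ : 0 < μ) :
    (ladder hρ hμ).IsMaximal ρ μ lam (generator ρ μ lam hρ hμ) where
  mem_domain := fun h g hg => ⟨g, (represents_iff hρ hμ).2 fun N => by
    rw [hg N]; exact coe_lev hρ hμ h N⟩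
  apply := fun h N => symL2_ext hρ hμ (by
    have h1 := (represents_iff hρ hμ).1 h.2.choose_spec N
    filter_upwards [h1, coe_lev (lam := lam) hρ hμ h.1 N] with v h2 h3
    exact h2.trans h3.symm)

end generator

/-! ### The explicit vectors -/

section vectors

variable {ρ μ : ℝ}

lemma memℓp_two_of_summable {E : ℕ → Type*} [∀ n, NormedAddCommGroup (E n)] {x : ∀ n, E n}
    (hx : Summable fun n => ‖x n‖ ^ 2) : Memℓp x 2 :=
  memℓp_gen (by simpa using hx)

lemma summable_mul_weight (ρ μ : ℝ) : Summable fun n : ℕ => (n : ℝ) * weight ρ μ n := by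
  rw [← summable_nat_add_iff 1]
  refine ((hasSum_weight ρ μ).summable.mul_left (μ / ρ)).congr fun n => ?_
  rw [← weight_succ]; push_cast; ring

lemma summable_sq_mul_weight (ρ μ : ℝ) : Summable fun n : ℕ => (n : ℝ) ^ 2 * weight ρ μ n := by
  rw [← summable_nat_add_iff 1]
  refine (((summable_mul_weight ρ μ).add (hasSum_weight ρ μ).summable).mul_left (μ / ρ)).congr
    fun n => ?_
  have := weight_succ (ρ := ρ) (μ := μ) n
  push_cast
  linear_combination (-((n : ℝ) + 1)) * this

/-- The one-particle function `2 π w² - 1`. -/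
def chi (w : ℝ) : ℝ := 2 * Real.pi * w ^ 2 - 1

lemma integrable_pow_mul_gauss (k : ℕ) :
    Integrable fun w : ℝ => w ^ k * Real.exp (-Real.pi * w ^ 2) := by
  have h := integrable_rpow_mul_exp_neg_mul_sq Real.pi_pos (s := (k : ℝ))
    (by linarith [k.cast_nonneg (α := ℝ)])
  simpa only [Real.rpow_natCast] using h

lemma memLp_chi : MemLp chi 2 gauss := by
  have hm : AEStronglyMeasurable chi gauss := by
    unfold chi; fun_prop
  rw [memLp_two_iff_integrable_sq hm, integrable_gauss_iff]
  have h := (((integrable_pow_mul_gauss 4).const_mul (4 * Real.pi ^ 2)).sub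
    ((integrable_pow_mul_gauss 2).const_mul (4 * Real.pi))).add (integrable_pow_mul_gauss 0)
  refine h.congr (Filter.Eventually.of_forall fun w => ?_)
  simp only [Pi.add_apply, Pi.sub_apply, chi]
  ring

lemma integral_chi : ∫ w, chi w ∂gauss = 0 := by
  rw [integral_gauss]
  -- The integrand is a total derivative of an integrable function.
  have hd : ∀ w : ℝ, HasDerivAt (fun w : ℝ => -(w ^ 1 * Real.exp (-Real.pi * w ^ 2)))
      (Real.exp (-Real.pi * w ^ 2) * chi w) w := by
    intro w
    have h1 : HasDerivAt (fun w : ℝ => -Real.pi * w ^ 2) (-Real.pi * (2 * w)) w := by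
      simpa using (hasDerivAt_pow 2 w).const_mul (-Real.pi)
    have h2 := (((hasDerivAt_pow 1 w).mul h1.exp)).neg
    refine h2.congr_deriv ?_
    simp only [chi]
    ring
  refine integral_eq_zero_of_hasDerivAt_of_integrable hd ?_ (integrable_pow_mul_gauss 1).neg
  exact integrable_gauss_iff.1 (memLp_chi.integrable (by norm_num))

lemma measurePreserving_eval {N : ℕ} (i : Fin N) :
    MeasurePreserving (fun v : Fin N → ℝ => v i) (gaussN N) gauss := by
  cases N with
  | zero => exact i.elim0
  | succ N =>
    refine ⟨measurable_pi_apply i, ?_⟩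
    rw [← (measurePreserving_insertNth i).map_eq, Measure.map_map (measurable_pi_apply i)
      (measurePreserving_insertNth i).measurable]
    have : (fun v : Fin (N + 1) → ℝ => v i) ∘
        (fun z : ℝ × (Fin N → ℝ) => (i.insertNth z.1 z.2 : Fin (N + 1) → ℝ)) = Prod.fst := by
      funext z
      simp
    rw [this]
    exact measurePreserving_fst.map_eq

lemma memLp_chi_eval {N : ℕ} (i : Fin N) : MemLp (fun v : Fin N → ℝ => chi (v i)) 2 (gaussN N) :=
  memLp_chi.comp_measurePreserving (measurePreserving_eval i)

/-- The sum of the one-particle functions. -/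
def chiSum (N : ℕ) (v : Fin N → ℝ) : ℝ := ∑ i, chi (v i)

lemma symMemLp_chiSum (N : ℕ) : SymMemLp (chiSum N) where
  memLp := memLp_finsetSum _ fun i _ => memLp_chi_eval i
  symm := fun σ => Filter.Eventually.of_forall fun v =>
    Equiv.sum_comp σ (fun i => chi (v i))

/-- Cauchy–Schwarz instead of independence: the crude factor `N²` is enough, since Poisson weights
have finite second moment. -/
lemma integral_chiSum_sq_le (N : ℕ) :
    ∫ v, chiSum N v ^ 2 ∂gaussN N ≤ (N : ℝ) ^ 2 * ∫ w, chi w ^ 2 ∂gauss := by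
  have hi : ∀ i : Fin N, Integrable (fun v : Fin N → ℝ => chi (v i) ^ 2) (gaussN N) :=
    fun i => (memLp_chi_eval i).integrable_sq
  have he : ∀ i : Fin N, ∫ v, chi (v i) ^ 2 ∂gaussN N = ∫ w, chi w ^ 2 ∂gauss := by
    intro i
    rw [← (measurePreserving_eval i).map_eq, integral_map
      (measurePreserving_eval i).measurable.aemeasurable]
    exact (by unfold chi; fun_prop : Continuous fun w => chi w ^ 2).aestronglyMeasurable
  calc ∫ v, chiSum N v ^ 2 ∂gaussN N
      ≤ ∫ v, (N : ℝ) * ∑ i : Fin N, chi (v i) ^ 2 ∂gaussN N :=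
        integral_mono (symMemLp_chiSum N).memLp.integrable_sq
          ((integrable_finsetSum _ fun i _ => hi i).const_mul _) fun v => by
            have := sq_sum_le_card_mul_sum_sq (s := Finset.univ) (f := fun i => chi (v i))
            rw [Finset.card_univ, Fintype.card_fin] at this
            exact this
    _ = _ := by
        rw [integral_const_mul, integral_finsetSum _ fun i _ => hi i]
        simp only [he, Finset.sum_const, Finset.card_univ, Fintype.card_fin, nsmul_eq_mul]
        ring

/-- Each `chi (v i)` survives all removals except that of `v i` itself. -/
lemma plusF_chiSum {N : ℕ} (v : Fin (N + 1) → ℝ) :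
    plusF (chiSum N) v = (N : ℝ) * chiSum (N + 1) v := by
  have h : ∀ i : Fin (N + 1), chiSum N (i.removeNth v) = chiSum (N + 1) v - chi (v i) := by
    intro i
    rw [chiSum, chiSum, Fin.sum_univ_succAbove _ i]
    simp [Fin.removeNth_apply]
  simp only [plusF, h, Finset.sum_sub_distrib, Finset.sum_const, Finset.card_univ,
    Fintype.card_fin, nsmul_eq_mul]
  rw [← chiSum]
  push_cast
  ring

lemma minusF_chiSum {N : ℕ} : ∀ᵐ v : Fin N → ℝ, minusF (chiSum (N + 1)) v = chiSum N v := by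
  filter_upwards [minusF_eq (symMemLp_chiSum (N + 1))] with v hv
  rw [hv]
  have h : ∀ w : ℝ, chiSum (N + 1) (Fin.cons w v) = chi w + chiSum N v := fun w => by
    simp [chiSum, Fin.sum_univ_succ]
  simp only [h]
  rw [integral_add (memLp_chi.integrable (by norm_num)) (integrable_const _), integral_chi]
  simp

lemma kacF_chiSum {N : ℕ} (v : Fin N → ℝ) : kacF (chiSum N) v = 0 := by
  refine kacF_eq_zero (fun i j hij θ v => ?_) v
  simp only [chiSum, chi, Finset.sum_sub_distrib, ← Finset.mul_sum, rot_sum_sq hij]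

variable (hρ : 0 < ρ) (hμ : 0 < μ)

/-- The vector with entries `c N` times the constant function one. -/
def constVec (c : ℕ → ℝ) (hc : Summable fun n => c n ^ 2 * weight ρ μ n) : Space ρ μ :=
  ⟨fun n => c n • (ladder hρ hμ).one n, memℓp_two_of_summable (hc.congr fun n => by
    rw [norm_smul, mul_pow, Ladder.norm_one_sq, Real.norm_eq_abs, sq_abs])⟩

lemma represents_constVec (c : ℕ → ℝ) (hc : Summable fun n => c n ^ 2 * weight ρ μ n) :
    Represents (constVec hρ hμ c hc) (fun N _ => c N) := by
  refine (represents_iff hρ hμ).2 fun N => ?_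
  filter_upwards [coe_smul hρ hμ (c N) ((ladder hρ hμ).one N),
    coe_toSym hρ hμ _ (symMemLp_const (N := N) 1)] with v h1 h2
  refine h1.trans ((congrArg (fun a => c N * a) h2).trans (mul_one _))

/-- The vector with entries `κ ∑ᵢ (2 π vᵢ² - 1)`. -/
def chiVec (κ : ℝ) : Space ρ μ :=
  ⟨fun n => κ • toSym hρ hμ _ (symMemLp_chiSum n), by
    refine memℓp_two_of_summable (Summable.of_nonneg_of_le (fun n => by positivity) (fun n => ?_)
      ((summable_sq_mul_weight ρ μ).mul_left (κ ^ 2 * ∫ w, chi w ^ 2 ∂gauss)))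
    rw [norm_smul, mul_pow, Real.norm_eq_abs, sq_abs, ← real_inner_self_eq_norm_sq,
      inner_toSym_left]
    have h1 : ∫ v, chiSum n v * ((toSym hρ hμ _ (symMemLp_chiSum n) :
        Lp ℝ 2 (levelMeasure ρ μ n)) : (Fin n → ℝ) → ℝ) v ∂gaussN n =
        ∫ v, chiSum n v ^ 2 ∂gaussN n := by
      refine integral_congr_ae ?_
      filter_upwards [ae_gaussN_iff.2 (coe_toSym hρ hμ _ (symMemLp_chiSum n))] with v hv
      rw [hv, sq]
    rw [h1]
    have h2 := mul_le_mul_of_nonneg_left (integral_chiSum_sq_le n)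
      (mul_nonneg (sq_nonneg κ) (weight_pos hρ hμ n).le)
    linarith⟩

lemma coe_chiVec (κ : ℝ) (N : ℕ) :
    ∀ᵐ v, (chiVec hρ hμ κ N : Lp ℝ 2 (levelMeasure ρ μ N)) v = κ * chiSum N v := by
  filter_upwards [coe_smul hρ hμ κ (toSym hρ hμ _ (symMemLp_chiSum N)),
    coe_toSym hρ hμ _ (symMemLp_chiSum N)] with v h1 h2
  exact h1.trans (congrArg (fun a => κ * a) h2)

lemma B_chiVec (κ : ℝ) (n : ℕ) :
    (ladder hρ hμ).B n (chiVec hρ hμ κ n) = (n : ℝ) • chiVec hρ hμ κ (n + 1) := by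
  change (ladder hρ hμ).B n (κ • toSym hρ hμ _ (symMemLp_chiSum n)) =
    (n : ℝ) • (κ • toSym hρ hμ _ (symMemLp_chiSum (n + 1)))
  rw [Ladder.B_smul, smul_comm]
  congr 1
  refine symL2_ext hρ hμ ?_
  filter_upwards [coe_toSym hρ hμ _ (symMemLp_coe hρ hμ (toSym hρ hμ _ (symMemLp_chiSum n))).plusF,
    plusF_congr (coe_toSym hρ hμ _ (symMemLp_chiSum n)),
    coe_smul hρ hμ (n : ℝ) (toSym hρ hμ _ (symMemLp_chiSum (n + 1))),
    coe_toSym hρ hμ _ (symMemLp_chiSum (n + 1))] with v h1 h2 h3 h4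
  refine h1.trans ?_
  rw [h2, h3, h4, plusF_chiSum]

lemma C_chiVec (κ : ℝ) (n : ℕ) :
    (ladder hρ hμ).C n (chiVec hρ hμ κ (n + 1)) = chiVec hρ hμ κ n := by
  change (ladder hρ hμ).C n (κ • toSym hρ hμ _ (symMemLp_chiSum (n + 1))) =
    κ • toSym hρ hμ _ (symMemLp_chiSum n)
  rw [Ladder.C_smul _ _ (div_pos hμ hρ)]
  congr 1
  refine symL2_ext hρ hμ ?_
  filter_upwards [coe_toSym hρ hμ _
      (symMemLp_coe hρ hμ (toSym hρ hμ _ (symMemLp_chiSum (n + 1)))).minusF,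
    minusF_congr (coe_toSym hρ hμ _ (symMemLp_chiSum (n + 1))),
    coe_toSym hρ hμ _ (symMemLp_chiSum n), minusF_chiSum (N := n)] with v h1 h2 h3 h4
  refine h1.trans ?_
  rw [h2, h3, h4]

lemma K_chiVec (κ : ℝ) (n : ℕ) : (ladder hρ hμ).K n (chiVec hρ hμ κ n) = 0 := by
  change (ladder hρ hμ).K n (κ • toSym hρ hμ _ (symMemLp_chiSum n)) = 0
  rw [Ladder.K_smul]
  have : (ladder hρ hμ).K n (toSym hρ hμ _ (symMemLp_chiSum n)) = 0 := by
    refine symL2_ext hρ hμ ?_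
    filter_upwards [coe_toSym hρ hμ _
        (symMemLp_coe hρ hμ (toSym hρ hμ _ (symMemLp_chiSum n))).kacF,
      kacF_congr (coe_toSym hρ hμ _ (symMemLp_chiSum n)),
      coe_zero (ρ := ρ) (μ := μ) (N := n) hρ hμ] with v h1 h2 h3
    refine h1.trans ?_
    rw [h2, h3, kacF_chiSum]
  rw [this, smul_zero]

lemma chiVec_zero (κ : ℝ) : chiVec hρ hμ κ 0 = 0 := by
  refine symL2_ext hρ hμ ?_
  filter_upwards [coe_chiVec hρ hμ κ 0, coe_zero (ρ := ρ) (μ := μ) (N := 0) hρ hμ] with v h1 h2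
  rw [h1, h2]
  simp [chiSum]

end vectors

end KacReservoir

end

noncomputable section

namespace KacReservoir

/-! ### One-particle functions with rotation invariant sums -/

section classification

lemma rot_add {N : ℕ} {i j : Fin N} (hij : i ≠ j) (θ α : ℝ) (v : Fin N → ℝ) :
    rot i j θ (rot i j α v) = rot i j (θ + α) v := by
  funext k
  simp only [rot, Real.cos_add, Real.sin_add, if_true, hij.symm, if_false]
  split_ifs <;> ring

lemma rot_two_pi_add {N : ℕ} (i j : Fin N) (θ : ℝ) (v : Fin N → ℝ) :
    rot i j (θ + 2 * Real.pi) v = rot i j θ v := by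
  funext k
  simp only [rot, Real.cos_add_two_pi, Real.sin_add_two_pi]

/-- Invariance holds at every point, not only almost everywhere, so `Rcol` supplies an exactly
invariant representative of any almost everywhere fixed function. -/
lemma Rcol_rot {N : ℕ} {i j : Fin N} (hij : i ≠ j) (f : (Fin N → ℝ) → ℝ) (α : ℝ)
    (v : Fin N → ℝ) : Rcol i j f (rot i j α v) = Rcol i j f v := by
  have hper : Function.Periodic (fun θ => f (rot i j θ v)) (2 * Real.pi) := fun θ => by
    simp only [rot_two_pi_add]
  simp only [Rcol, rot_add hij]
  rw [intervalIntegral.integral_comp_add_right (fun θ => f (rot i j θ v)), zero_add,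
    add_comm (2 * Real.pi), hper.intervalIntegral_add_eq α 0, zero_add]

lemma ae_finTwo {p : (Fin 2 → ℝ) → Prop} (hp : ∀ᵐ v, p v) :
    ∀ᵐ x : ℝ, ∀ᵐ y : ℝ, p ![x, y] := by
  have h : ∀ᵐ z : ℝ × ℝ, p ![z.1, z.2] :=
    (volume_preserving_finTwoArrow ℝ).symm.quasiMeasurePreserving.ae hp
  exact Measure.ae_ae_of_ae_prod h

/-- The convolution of `φ` with a Gaussian. -/
def smoothing (φ : ℝ → ℝ) (x : ℝ) : ℝ :=
  2 * √2 * ∫ z, φ z * Real.exp (-Real.pi * (x - √2 * z) ^ 2)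

/-- From `(x - √2 z)² = z² - x² + (z - √2 x)²`. Locally uniformly in `x` the kernel is thus
dominated by the Gaussian weight against which `φ` is integrable. -/
lemma exp_neg_sq_le (x z : ℝ) : Real.exp (-Real.pi * (x - √2 * z) ^ 2) ≤
    Real.exp (Real.pi * x ^ 2) * Real.exp (-Real.pi * z ^ 2) := by
  rw [← Real.exp_add, Real.exp_le_exp]
  have h2 : √2 ^ 2 = 2 := Real.sq_sqrt (by norm_num)
  have h : 0 ≤ Real.pi * (z - √2 * x) ^ 2 := by positivity
  have e : -Real.pi * (x - √2 * z) ^ 2 + Real.pi * (z - √2 * x) ^ 2 =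
      Real.pi * x ^ 2 + -Real.pi * z ^ 2 := by
    linear_combination (Real.pi * x ^ 2 - Real.pi * z ^ 2) * h2
  linarith

lemma norm_smoothing_le (φ : ℝ → ℝ) {x M : ℝ} (hx : x ^ 2 ≤ M) (z : ℝ) :
    ‖φ z * Real.exp (-Real.pi * (x - √2 * z) ^ 2)‖ ≤
      Real.exp (Real.pi * M) * ‖Real.exp (-Real.pi * z ^ 2) * φ z‖ := by
  rw [norm_mul, norm_mul, Real.norm_of_nonneg (Real.exp_pos _).le,
    Real.norm_of_nonneg (Real.exp_pos _).le]
  have h1 : Real.exp (Real.pi * x ^ 2) ≤ Real.exp (Real.pi * M) :=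
    Real.exp_le_exp.2 (mul_le_mul_of_nonneg_left hx Real.pi_pos.le)
  calc ‖φ z‖ * Real.exp (-Real.pi * (x - √2 * z) ^ 2)
      ≤ ‖φ z‖ * (Real.exp (Real.pi * x ^ 2) * Real.exp (-Real.pi * z ^ 2)) := by
        gcongr; exact exp_neg_sq_le x z
    _ ≤ ‖φ z‖ * (Real.exp (Real.pi * M) * Real.exp (-Real.pi * z ^ 2)) := by gcongr
    _ = _ := by ring

lemma aestronglyMeasurable_of_gauss {φ : ℝ → ℝ} (hφ : Integrable φ gauss) :
    AEStronglyMeasurable φ volume := by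
  have h := (integrable_gauss_iff.1 hφ).aestronglyMeasurable
  have h2 : AEStronglyMeasurable (fun w : ℝ => Real.exp (Real.pi * w ^ 2)) volume :=
    (by fun_prop : Continuous fun w : ℝ => Real.exp (Real.pi * w ^ 2)).aestronglyMeasurable
  refine (h2.mul h).congr (Filter.Eventually.of_forall fun w => ?_)
  simp only [Pi.mul_apply]
  rw [← mul_assoc, ← Real.exp_add]
  simp

lemma aestronglyMeasurable_smoothing {φ : ℝ → ℝ} (hφ : Integrable φ gauss) (x : ℝ) :
    AEStronglyMeasurable (fun z => φ z * Real.exp (-Real.pi * (x - √2 * z) ^ 2)) volume :=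
  (aestronglyMeasurable_of_gauss hφ).mul (by fun_prop : Continuous fun z : ℝ =>
    Real.exp (-Real.pi * (x - √2 * z) ^ 2)).aestronglyMeasurable

lemma integrable_smoothing {φ : ℝ → ℝ} (hφ : Integrable φ gauss) (x : ℝ) :
    Integrable fun z => φ z * Real.exp (-Real.pi * (x - √2 * z) ^ 2) :=
  ((integrable_gauss_iff.1 hφ).norm.const_mul _).mono' (aestronglyMeasurable_smoothing hφ x)
    (Filter.Eventually.of_forall fun z => norm_smoothing_le φ le_rfl z)

lemma continuous_smoothing {φ : ℝ → ℝ} (hφ : Integrable φ gauss) : Continuous (smoothing φ) := by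
  refine continuous_const.mul (continuous_iff_continuousAt.2 fun x₀ => ?_)
  have hnhds : ∀ᶠ x in nhds x₀, x ^ 2 ≤ x₀ ^ 2 + 1 :=
    ((continuous_pow 2).tendsto x₀).eventually_le_const (by linarith)
  refine continuousAt_of_dominated
    (bound := fun z => Real.exp (Real.pi * (x₀ ^ 2 + 1)) * ‖Real.exp (-Real.pi * z ^ 2) * φ z‖)
    (Filter.Eventually.of_forall fun x => aestronglyMeasurable_smoothing hφ x)
    (hnhds.mono fun x hx => Filter.Eventually.of_forall fun z => norm_smoothing_le φ hx z)
    ((integrable_gauss_iff.1 hφ).norm.const_mul _)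
    (Filter.Eventually.of_forall fun z => ?_)
  exact (by fun_prop : Continuous fun x : ℝ =>
    φ z * Real.exp (-Real.pi * (x - √2 * z) ^ 2)).continuousAt

/-- A function invariant under rotation by `π / 4` agrees with its smoothing. -/
lemma ae_eq_smoothing {φ : ℝ → ℝ} (hφ : Integrable φ gauss) (h0 : ∫ w, φ w ∂gauss = 0)
    (h : ∀ᵐ x : ℝ, ∀ᵐ y : ℝ, φ ((√2)⁻¹ * (x - y)) + φ ((√2)⁻¹ * (x + y)) = φ x + φ y) :
    ∀ᵐ x : ℝ, φ x = smoothing φ x := by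
  filter_upwards [h] with x hx
  set H : ℝ → ℝ := fun z => φ z * Real.exp (-Real.pi * (x - √2 * z) ^ 2) with hH
  have hs2 : √2 ≠ 0 := by positivity
  have hHi : Integrable H := integrable_smoothing hφ x
  have hHi2 : Integrable fun y => H ((√2)⁻¹ * y) := hHi.comp_mul_left' (inv_ne_zero hs2)
  have e1 : ∀ y, H ((√2)⁻¹ * (x - y)) = Real.exp (-Real.pi * y ^ 2) * φ ((√2)⁻¹ * (x - y)) := by
    intro y
    simp only [hH]
    rw [mul_inv_cancel_left₀ hs2]
    ring_nf
  have e2 : ∀ y, H ((√2)⁻¹ * (x + y)) = Real.exp (-Real.pi * y ^ 2) * φ ((√2)⁻¹ * (x + y)) := by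
    intro y
    simp only [hH]
    rw [mul_inv_cancel_left₀ hs2]
    ring_nf
  have i1 : Integrable fun y => H ((√2)⁻¹ * (x - y)) := hHi2.comp_sub_left x
  have i2 : Integrable fun y => H ((√2)⁻¹ * (x + y)) := hHi2.comp_add_left x
  have v0 : ∫ y, H ((√2)⁻¹ * y) = √2 * ∫ z, H z := by
    rw [Measure.integral_comp_mul_left, inv_inv, abs_of_nonneg (Real.sqrt_nonneg 2), smul_eq_mul]
  have v1 : ∫ y, H ((√2)⁻¹ * (x - y)) = √2 * ∫ z, H z := by
    rw [integral_sub_left_eq_self (fun y => H ((√2)⁻¹ * y)), v0]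
  have v2 : ∫ y, H ((√2)⁻¹ * (x + y)) = √2 * ∫ z, H z := by
    rw [integral_add_left_eq_self (fun y => H ((√2)⁻¹ * y)), v0]
  -- Integrating the invariance in `y` isolates `φ x` by mean zero. On the other side `z = (x ±
  -- y)/√2` turns both terms into the same integral with Jacobian `√2`, whence the constant `2√2` in
  -- `smoothing`.
  have hl : ∫ y, (φ x + φ y) ∂gauss = φ x := by
    rw [integral_add (integrable_const _) hφ, h0]
    simp
  rw [← hl, integral_gauss]
  have hr : ∫ y, Real.exp (-Real.pi * y ^ 2) * (φ x + φ y) =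
      ∫ y, (H ((√2)⁻¹ * (x - y)) + H ((√2)⁻¹ * (x + y))) := by
    refine integral_congr_ae ?_
    filter_upwards [hx] with y hy
    rw [e1, e2, ← hy]
    ring
  rw [hr, integral_add i1 i2, v1, v2, smoothing]
  ring

/-- A continuous function with rotation invariant sums is quadratic. -/
lemma exists_quadratic {ψ : ℝ → ℝ} (hc : Continuous ψ)
    (h : ∀ θ x y, ψ (x * Real.cos θ - y * Real.sin θ) + ψ (x * Real.sin θ + y * Real.cos θ) =
      ψ x + ψ y) : ∃ a : ℝ, ∀ x, ψ x = ψ 0 + a * x ^ 2 := by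
  have heven : ∀ x, ψ (-x) = ψ x := fun x => by
    have := h Real.pi x 0
    simpa using this
  -- The point `(x, y)` is the rotation of `(r, 0)` by its polar angle.
  have hsum : ∀ x y, ψ x + ψ y = ψ (√(x ^ 2 + y ^ 2)) + ψ 0 := by
    intro x y
    set z : ℂ := ⟨x, y⟩ with hz
    have h1 := h z.arg ‖z‖ 0
    have h2 : ‖z‖ * Real.cos z.arg = x := Complex.norm_mul_cos_arg z
    have h3 : ‖z‖ * Real.sin z.arg = y := Complex.norm_mul_sin_arg z
    have h4 : ‖z‖ = √(x ^ 2 + y ^ 2) := by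
      rw [Complex.norm_def, Complex.normSq_apply, hz]; simp only [sq]
    rw [h2, h3, zero_mul, zero_mul, sub_zero, add_zero, h4] at h1
    exact h1
  have hadd : ∀ s t, 0 ≤ s → 0 ≤ t → ψ (√(s + t)) + ψ 0 = ψ (√s) + ψ (√t) := by
    intro s t hs ht
    rw [hsum (√s) (√t), Real.sq_sqrt hs, Real.sq_sqrt ht]
  -- Since `√` is zero on negative numbers, this is the odd extension of `u ↦ ψ (√u) - ψ 0` from `u
  -- ≥ 0`, continuous on all of `ℝ`.
  set A : ℝ → ℝ := fun u => ψ (√u) - ψ (√(-u)) with hA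
  have hApos : ∀ u, 0 ≤ u → A u = ψ (√u) - ψ 0 := fun u hu => by
    simp only [hA]
    rw [Real.sqrt_eq_zero_of_nonpos (by linarith : -u ≤ 0)]
  have hAneg : ∀ u, A (-u) = -A u := fun u => by simp only [hA, neg_neg]; ring
  have hAp : ∀ s t, 0 ≤ s → 0 ≤ t → A (s + t) = A s + A t := fun s t hs ht => by
    rw [hApos _ hs, hApos _ ht, hApos _ (add_nonneg hs ht)]
    linarith [hadd s t hs ht]
  have hAs : ∀ s t, 0 ≤ s → 0 ≤ t → A (s - t) = A s - A t := fun s t hs ht => by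
    rcases le_total t s with hts | hts
    · have := hAp (s - t) t (by linarith) ht
      rw [sub_add_cancel] at this
      linarith
    · have := hAp (t - s) s (by linarith) hs
      rw [sub_add_cancel] at this
      rw [← neg_sub t s, hAneg]
      linarith
  have hAadd : ∀ u w, A (u + w) = A u + A w := by
    intro u w
    rcases le_total 0 u with hu | hu <;> rcases le_total 0 w with hw | hw
    · exact hAp u w hu hw
    · have := hAs u (-w) hu (by linarith)
      rw [sub_neg_eq_add, hAneg] at this
      linarith
    · have := hAs w (-u) hw (by linarith)
      rw [sub_neg_eq_add, hAneg, add_comm w] at this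
      linarith
    · have := hAp (-u) (-w) (by linarith) (by linarith)
      rw [← neg_add, hAneg, hAneg, hAneg] at this
      linarith
  have hAc : Continuous A :=
    (hc.comp Real.continuous_sqrt).sub (hc.comp (Real.continuous_sqrt.comp continuous_neg))
  let Ahom : ℝ →+ ℝ := ⟨⟨A, by simp [hA]⟩, hAadd⟩
  have hlin : ∀ u, A u = u * A 1 := fun u => by
    have := (AddMonoidHom.toRealLinearMap Ahom hAc).map_smul u 1
    simpa [Ahom] using this
  refine ⟨A 1, fun x => ?_⟩
  have h1 := hlin (x ^ 2)
  rw [hApos _ (sq_nonneg x), Real.sqrt_sq_eq_abs] at h1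
  have h2 : ψ |x| = ψ x := by
    rcases abs_choice x with h | h <;> rw [h]
    exact heven x
  rw [h2] at h1
  linarith

/-- A mean zero one-particle function whose two-particle sum is rotation invariant is a multiple
of `2 π w² - 1`. -/
lemma ae_eq_mul_chi {φ : ℝ → ℝ} (hφ : Integrable φ gauss) (h0 : ∫ w, φ w ∂gauss = 0)
    {G : (Fin 2 → ℝ) → ℝ} (hG : ∀ θ v, G (rot 0 1 θ v) = G v)
    (hF : ∀ᵐ v : Fin 2 → ℝ, φ (v 0) + φ (v 1) = G v) : ∃ t : ℝ, ∀ᵐ w, φ w = t * chi w := by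
  have h01 : (0 : Fin 2) ≠ 1 := by decide
  have hrot : ∀ θ (x y : ℝ), rot (0 : Fin 2) 1 θ ![x, y] =
      ![x * Real.cos θ - y * Real.sin θ, x * Real.sin θ + y * Real.cos θ] := by
    intro θ x y
    funext k
    fin_cases k <;> simp [rot]
  have hinv : ∀ θ, ∀ᵐ v : Fin 2 → ℝ,
      φ (rot 0 1 θ v 0) + φ (rot 0 1 θ v 1) = φ (v 0) + φ (v 1) := by
    intro θ
    filter_upwards [hF, (measurePreserving_rot h01 θ).quasiMeasurePreserving.ae hF] with v h1 h2
    rw [h1, h2, hG]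
  have hψ : ∀ᵐ x : ℝ, φ x = smoothing φ x := by
    refine ae_eq_smoothing hφ h0 ?_
    filter_upwards [ae_finTwo (hinv (Real.pi / 4))] with x hx
    filter_upwards [hx] with y hy
    rw [hrot] at hy
    have hs : √2 / 2 = (√2)⁻¹ := by
      have h2 : √2 ^ 2 = 2 := Real.sq_sqrt (by norm_num)
      have h3 : √2 ≠ 0 := by positivity
      field_simp
      linarith
    simp only [Real.cos_pi_div_four, Real.sin_pi_div_four, hs, Matrix.cons_val_zero,
      Matrix.cons_val_one] at hy
    rw [← hy]
    congr 2 <;> ring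
  set ψ := smoothing φ with hψdef
  have hc : Continuous ψ := continuous_smoothing hφ
  have hev : ∀ i : Fin 2, ∀ᵐ v : Fin 2 → ℝ, φ (v i) = ψ (v i) := fun i =>
    ae_gaussN_iff.1 ((measurePreserving_eval i).quasiMeasurePreserving.ae (ae_gauss_iff.2 hψ))
  have hψinv : ∀ θ x y, ψ (x * Real.cos θ - y * Real.sin θ) +
      ψ (x * Real.sin θ + y * Real.cos θ) = ψ x + ψ y := by
    intro θ x y
    have hcr : Continuous (rot (0 : Fin 2) 1 θ) :=
      (continuous_rot 0 1).comp (continuous_const.prodMk continuous_id)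
    have hae : (fun v : Fin 2 → ℝ => ψ (rot 0 1 θ v 0) + ψ (rot 0 1 θ v 1)) =ᵐ[volume]
        fun v => ψ (v 0) + ψ (v 1) := by
      have hq := (measurePreserving_rot h01 θ).quasiMeasurePreserving
      filter_upwards [hinv θ, hev 0, hev 1, hq.ae (hev 0), hq.ae (hev 1)] with v h1 h2 h3 h4 h5
      rw [← h2, ← h3, ← h4, ← h5, h1]
    -- Continuity of `ψ` upgrades the invariance, known for each angle almost everywhere, to every
    -- point.
    have heq := (Continuous.ae_eq_iff_eq (volume : Measure (Fin 2 → ℝ))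
      ((hc.comp ((continuous_apply 0).comp hcr)).add (hc.comp ((continuous_apply 1).comp hcr)))
      ((hc.comp (continuous_apply 0)).add (hc.comp (continuous_apply 1)))).1 hae
    have := congrFun heq ![x, y]
    simpa [hrot] using this
  obtain ⟨a, ha⟩ := exists_quadratic hc hψinv
  have hpi : Real.pi ≠ 0 := Real.pi_ne_zero
  have hψchi : ∀ w, ψ w = (ψ 0 + a / (2 * Real.pi)) + a / (2 * Real.pi) * chi w := by
    intro w
    rw [ha w, chi]
    field_simp
    ring
  have hzero : ψ 0 + a / (2 * Real.pi) = 0 := by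
    have h1 : ∫ w, ψ w ∂gauss = 0 := by
      rw [← h0]
      exact integral_congr_ae ((ae_gauss_iff.2 hψ).mono fun w hw => hw.symm)
    rw [integral_congr_ae (Filter.Eventually.of_forall hψchi), integral_add (integrable_const _)
      ((memLp_chi.integrable (by norm_num)).const_mul _),
      integral_const_mul, integral_chi] at h1
    simpa using h1
  refine ⟨a / (2 * Real.pi), ?_⟩
  filter_upwards [hψ] with w hw
  rw [hw, hψchi w, hzero, zero_add]

end classification

end KacReservoir

end

/-! ### Level-one classification, explicit eigenvectors, and assembly of the theorem. -/

noncomputable section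

namespace KacReservoir

section main

variable {ρ μ : ℝ}

/-- On level one, the mean zero functions whose image under creation is invariant under
collisions are the multiples of `2 π v² - 1`. -/
lemma exists_eq_smul_chiVec (hρ : 0 < ρ) (hμ : 0 < μ) {κ : ℝ} (hκ : κ ≠ 0) (f : symL2 ρ μ 1)
    (hf : inner ℝ f ((ladder hρ hμ).one 1) = 0)
    (hK : (ladder hρ hμ).K 2 ((ladder hρ hμ).B 1 f) = 0) :
    ∃ t : ℝ, f = t • chiVec hρ hμ κ 1 := by
  set F : (Fin 1 → ℝ) → ℝ := ((f : Lp ℝ 2 (levelMeasure ρ μ 1)) : (Fin 1 → ℝ) → ℝ) with hFdef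
  set φ : ℝ → ℝ := fun x => F fun _ => x with hφdef
  have hFφ : ∀ v, F v = φ (v 0) := fun v => by
    simp only [hφdef]
    congr 1
    funext k
    rw [Subsingleton.elim k 0]
  have hemb : MeasurableEmbedding fun v : Fin 1 → ℝ => v 0 :=
    (MeasurableEquiv.funUnique (Fin 1) ℝ).measurableEmbedding
  have hev := measurePreserving_eval (0 : Fin 1)
  have hFm := symMemLp_coe hρ hμ f
  have hφi : Integrable φ gauss := by
    rw [← hev.integrable_comp_emb hemb]
    exact (hFm.memLp.integrable (by norm_num)).congr (Filter.Eventually.of_forall hFφ)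
  have hφ0 : ∫ w, φ w ∂gauss = 0 := by
    have h1 : ∫ v, F v ∂gaussN 1 = 0 := by
      have h2 := inner_toSym_right hρ hμ _ (symMemLp_const (N := 1) 1) f
      have h3 : inner ℝ f (toSym hρ hμ _ (symMemLp_const (N := 1) 1)) = 0 := hf
      rw [h3] at h2
      simpa [(weight_pos hρ hμ 1).ne'] using h2.symm
    rw [← hev.integral_comp hemb, ← h1]
    exact integral_congr_ae (Filter.Eventually.of_forall fun v => (hFφ v).symm)
  have hP : ∀ v, plusF F v = φ (v 0) + φ (v 1) := fun v => by
    rw [plusF, Fin.sum_univ_two, hFφ, hFφ, add_comm]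
    rfl
  have hkac : ∀ᵐ v, kacF (plusF F) v = 0 := by
    have h1 := coe_toSym hρ hμ _ (symMemLp_coe hρ hμ ((ladder hρ hμ).B 1 f)).kacF
    have h2 := kacF_congr (coe_toSym hρ hμ _ hFm.plusF)
    filter_upwards [h1, h2, coe_zero (ρ := ρ) (μ := μ) (N := 2) hρ hμ] with v h3 h4 h5
    rw [← h4, ← h5, ← hK]
    exact h3.symm
  obtain ⟨t, ht⟩ := ae_eq_mul_chi hφi hφ0 (G := Rcol 0 1 (plusF F))
    (fun θ v => Rcol_rot (by decide) _ θ v) (by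
      filter_upwards [hkac] with v hv
      -- For two particles the collision operator is `R₀₁ - Id`, so its kernel consists of fixed
      -- points of the rotation average.
      have hset : (Finset.univ.filter fun p : Fin 2 × Fin 2 => p.1 < p.2) = {(0, 1)} := by decide
      rw [kacF, hset, Finset.sum_singleton, sub_eq_zero] at hv
      rw [← hP, hv])
  refine ⟨t / κ, symL2_ext hρ hμ ?_⟩
  have ht1 : ∀ᵐ v : Fin 1 → ℝ, φ (v 0) = t * chi (v 0) :=
    ae_gaussN_iff.1 (hev.quasiMeasurePreserving.ae (ae_gauss_iff.2 ht))
  filter_upwards [ht1, coe_smul hρ hμ (t / κ) (chiVec hρ hμ κ 1), coe_chiVec hρ hμ κ 1]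
    with v h1 h2 h3
  rw [h2, h3, ← hFdef, hFφ, h1, chiSum, Fin.sum_univ_one]
  field_simp

lemma summable_affine_sq_mul_weight (ρ μ b d : ℝ) :
    Summable fun n : ℕ => (b * (n : ℝ) - d) ^ 2 * weight ρ μ n := by
  refine ((((summable_sq_mul_weight ρ μ).mul_left (b ^ 2)).sub
    ((summable_mul_weight ρ μ).mul_left (2 * b * d))).add
    ((hasSum_weight ρ μ).summable.mul_left (d ^ 2))).congr fun n => ?_
  ring

lemma Pplus_stateE0 (N : ℕ) (v : Fin N → ℝ) : Pplus stateE0 N v = N := by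
  cases N with
  | zero => simp [Pplus]
  | succ N => simp [Pplus, stateE0]

end main

end KacReservoir

end

namespace KacReservoir

namespace Ladder

variable {E : ℕ → Type*} [∀ n, NormedAddCommGroup (E n)] [∀ n, InnerProductSpace ℝ (E n)]
  {ν : ℝ} {a : ℕ → ℝ} {Λ : Ladder E ν a} {ρ μ lam : ℝ}

/-! ### The ground state and the gap -/

lemma lev_one_eq_zero (hν : 0 < ν) (n : ℕ) : Λ.lev ρ μ lam Λ.one n = 0 := by
  have h := lev_smul_one (Λ := Λ) (ρ := ρ) (μ := μ) (lam := lam) hν (fun _ => 1) n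
  simpa using h

/-- The birth–death generator sends `b n - d` to `μ b - ρ b n`; the condition `hbd` makes this `-ρ
(b n - d)`. -/
lemma lev_affine_smul_one (hν : 0 < ν) {b d : ℝ} (hbd : μ * b = ρ * d) (n : ℕ) :
    Λ.lev ρ μ lam (fun n => (b * (n : ℝ) - d) • Λ.one n) n =
      (-ρ) • ((b * (n : ℝ) - d) • Λ.one n) := by
  rw [lev_smul_one hν, smul_smul]
  congr 1
  cases n with
  | zero =>
    push_cast
    linear_combination hbd
  | succ n =>
    simp only [Nat.add_sub_cancel]
    push_cast
    linear_combination hbd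

lemma norm_eq_one_of_eq_one (hsum : HasSum a 1) {e : lp E 2} (he : ∀ n, e n = Λ.one n) :
    ‖e‖ = 1 := by
  have h1 := hasSum_norm_sq e
  simp only [he, norm_one_sq] at h1
  exact (pow_eq_one_iff_of_nonneg (norm_nonneg e) two_ne_zero).1 (h1.unique hsum)

namespace IsMaximal

variable {A : lp E 2 →ₗ.[ℝ] lp E 2}

/-- The maximal operator is nonpositive. -/
theorem inner_apply_nonpos (hA : Λ.IsMaximal ρ μ lam A) (hρ : 0 < ρ) (hν : 0 < ν)
    (hνρ : ρ * ν = μ) (hlam : 0 < lam) (ha : ∀ n, 0 < a n)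
    (ha1 : ∀ n : ℕ, ((n : ℝ) + 1) * a (n + 1) = ν * a n) (hsum : HasSum a 1) {e : lp E 2}
    (he : ∀ n, e n = Λ.one n) (h : A.domain) : inner ℝ (h : lp E 2) (A h) ≤ 0 := by
  refine (hA.inner_apply_le hρ hν hνρ hlam ha ha1 hsum he h).trans ?_
  have h1 : inner ℝ (h : lp E 2) e ^ 2 ≤ ‖(h : lp E 2)‖ ^ 2 := by
    have h2 := abs_real_inner_le_norm (h : lp E 2) e
    rw [norm_eq_one_of_eq_one hsum he, mul_one] at h2
    rw [← sq_abs]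
    exact pow_le_pow_left₀ (abs_nonneg _) h2 2
  nlinarith

/-- The Rayleigh quotient on the complement of the ground state attains its maximum `-ρ` at every
eigenvector for `-ρ`. -/
theorem isGreatest_rayleighValues (hA : Λ.IsMaximal ρ μ lam A) (hρ : 0 < ρ) (hν : 0 < ν)
    (hνρ : ρ * ν = μ) (hlam : 0 < lam) (ha : ∀ n, 0 < a n)
    (ha1 : ∀ n : ℕ, ((n : ℝ) + 1) * a (n + 1) = ν * a n) (hsum : HasSum a 1) {e e₁ : lp E 2}
    (he : ∀ n, e n = Λ.one n) (he₁ : e₁ ∈ eigenspace A (-ρ)) (hne : e₁ ≠ 0) :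
    IsGreatest (rayleighValues A (Submodule.span ℝ {e})) (-ρ) := by
  obtain ⟨hm0, hA0⟩ := (hA.mem_eigenspace_iff (c := 0) (h := e)).2 fun n => by
    rw [funext he, lev_one_eq_zero hν, zero_smul]
  obtain ⟨hm1, hA1⟩ := he₁
  -- Eigenvectors of a symmetric operator for the distinct eigenvalues `0` and `-ρ`.
  have horth : inner ℝ e e₁ = 0 := by
    have h1 := hA.isFormalAdjoint hν hνρ ⟨e₁, hm1⟩ ⟨e, hm0⟩
    rw [hA0, hA1, zero_smul, inner_zero_right, real_inner_smul_left] at h1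
    rw [real_inner_comm]
    exact (mul_eq_zero.1 h1).resolve_left (neg_ne_zero.2 hρ.ne')
  constructor
  · have hn : ‖e₁‖ ≠ 0 := norm_ne_zero_iff.2 hne
    have hm : ‖e₁‖⁻¹ • e₁ ∈ A.domain := A.domain.smul_mem _ hm1
    refine ⟨⟨_, hm⟩, ?_, ?_, ?_⟩
    · rw [norm_smul, norm_inv, norm_norm, inv_mul_cancel₀ hn]
    · rw [Submodule.mem_orthogonal_singleton_iff_inner_right, real_inner_smul_right, horth,
        mul_zero]
    · have h1 : A ⟨_, hm⟩ = ‖e₁‖⁻¹ • A ⟨e₁, hm1⟩ := A.map_smul ‖e₁‖⁻¹ ⟨e₁, hm1⟩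
      rw [h1, hA1]
      simp only [real_inner_smul_left, real_inner_smul_right, real_inner_self_eq_norm_sq]
      field_simp
  · rintro x ⟨h, hn, ho, rfl⟩
    have h1 := hA.inner_apply_le hρ hν hνρ hlam ha ha1 hsum he h
    rw [Submodule.mem_orthogonal_singleton_iff_inner_left] at ho
    rw [hn, ho] at h1
    linarith

end IsMaximal

end Ladder

lemma mul_sqrt_div_eq {ρ μ : ℝ} (hρ : 0 < ρ) (hμ : 0 < μ) :
    μ * √(ρ / μ) = ρ * √(μ / ρ) := by
  rw [Real.sqrt_div hρ.le, Real.sqrt_div hμ.le]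
  have h3 : √ρ ≠ 0 := (Real.sqrt_pos.2 hρ).ne'
  have h4 : √μ ≠ 0 := (Real.sqrt_pos.2 hμ).ne'
  field_simp
  rw [Real.sq_sqrt hρ.le, Real.sq_sqrt hμ.le]

lemma inner_constVec_zero {ρ μ : ℝ} (hρ : 0 < ρ) (hμ : 0 < μ) (c : ℕ → ℝ)
    (hc : Summable fun n : ℕ => c n ^ 2 * weight ρ μ n) :
    inner ℝ (constVec hρ hμ c hc 0) ((ladder hρ hμ).one 0) = c 0 * weight ρ μ 0 :=
  (real_inner_smul_left _ _ _).trans (congrArg _ ((ladder hρ hμ).inner_one 0))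

end KacReservoir

open KacReservoir in
theorem theorem1 (ρ μ lam : ℝ) (hρ : 0 < ρ) (hμ : 0 < μ) (hlam : 0 < lam) :
    Dense ((generator ρ μ lam hρ hμ).domain : Set (Space ρ μ)) ∧
    IsSelfAdjoint (generator ρ μ lam hρ hμ) ∧
    (∀ h : (generator ρ μ lam hρ hμ).domain,
      inner ℝ (h : Space ρ μ) (generator ρ μ lam hρ hμ h) ≤ 0) ∧
    ∃ e0 e1 e001 : Space ρ μ,
      Represents e0 stateE0 ∧ Represents e1 (stateE1 ρ μ) ∧ Represents e001 (stateE001 ρ μ) ∧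
      IsLUB (rayleighValues (generator ρ μ lam hρ hμ) (Submodule.span ℝ {e0}))
        (gap (generator ρ μ lam hρ hμ) (Submodule.span ℝ {e0})) ∧
      gap (generator ρ μ lam hρ hμ) (Submodule.span ℝ {e0}) = -ρ ∧
      eigenspace (generator ρ μ lam hρ hμ)
        (gap (generator ρ μ lam hρ hμ) (Submodule.span ℝ {e0})) ≠ ⊥ ∧
      eigenspace (generator ρ μ lam hρ hμ)
        (gap (generator ρ μ lam hρ hμ) (Submodule.span ℝ {e0})) =
          Submodule.span ℝ {e1, e001} := by
  have hν : 0 < μ / ρ := div_pos hμ hρ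
  have hνρ : ρ * (μ / ρ) = μ := mul_div_cancel₀ μ hρ.ne'
  have hA := isMaximal_generator (lam := lam) hρ hμ
  have hs0 : Summable fun n : ℕ => (1 : ℝ) ^ 2 * weight ρ μ n := by
    simpa using (hasSum_weight ρ μ).summable
  have hs1 := summable_affine_sq_mul_weight ρ μ (√(ρ / μ)) (√(μ / ρ))
  have hκ : √(ρ / (2 * μ)) ≠ 0 := (Real.sqrt_pos.2 (by positivity)).ne'
  obtain ⟨e0, hr0, he0⟩ : ∃ e : Space ρ μ, Represents e stateE0 ∧
      ∀ n, e n = (ladder hρ hμ).one n :=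
    ⟨constVec hρ hμ (fun _ => 1) hs0, represents_constVec hρ hμ _ hs0, fun n => one_smul ℝ _⟩
  obtain ⟨e1, hr1, hlev1, h10⟩ : ∃ e : Space ρ μ, Represents e (stateE1 ρ μ) ∧
      (∀ n, (ladder hρ hμ).lev ρ μ lam e n = (-ρ) • e n) ∧
      inner ℝ (e 0) ((ladder hρ hμ).one 0) ≠ 0 := by
    refine ⟨constVec hρ hμ _ hs1, ?_,
      Ladder.lev_affine_smul_one hν (mul_sqrt_div_eq hρ hμ), fun h => ?_⟩
    · have h1 := represents_constVec hρ hμ _ hs1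
      have h2 : stateE1 ρ μ = fun (N : ℕ) _ => √(ρ / μ) * (N : ℝ) - √(μ / ρ) := by
        funext N v
        rw [stateE1, Pplus_stateE0, stateE0, mul_one]
      rw [h2]
      exact h1
    -- On level zero `e1` is the nonzero constant `-√(μ/ρ)`, whereas the other eigenvector vanishes
    -- there.
    · have h1 := (inner_constVec_zero hρ hμ _ hs1).symm.trans h
      refine mul_ne_zero ?_ (weight_pos hρ hμ 0).ne' h1
      rw [Nat.cast_zero, mul_zero, zero_sub]
      exact neg_ne_zero.2 (Real.sqrt_pos.2 hν).ne'
  have he1 : e1 ∈ eigenspace (generator ρ μ lam hρ hμ) (-ρ) := hA.mem_eigenspace_iff.2 hlev1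
  have hne : e1 ≠ 0 := fun h => h10 (by rw [h]; exact inner_zero_left _)
  have hgreat := hA.isGreatest_rayleighValues hρ hν hνρ hlam (weight_pos hρ hμ)
    (fun n => weight_succ n) (hasSum_weight ρ μ) he0 he1 hne
  have hgap : gap (generator ρ μ lam hρ hμ) (Submodule.span ℝ {e0}) = -ρ := hgreat.csSup_eq
  refine ⟨hA.dense hν, hA.isSelfAdjoint hν hνρ,
    hA.inner_apply_nonpos hρ hν hνρ hlam (weight_pos hρ hμ) (fun n => weight_succ n)
      (hasSum_weight ρ μ) he0,
    e0, e1, chiVec hρ hμ (√(ρ / (2 * μ))), hr0, hr1,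
    (represents_iff hρ hμ).2 (coe_chiVec hρ hμ _), ?_, hgap, ?_, ?_⟩
  -- The maximum is attained, so `gap` is a genuine supremum and not the default value of `sSup`.
  · rw [hgap]; exact hgreat.isLUB
  · rw [hgap]
    exact fun h => hne ((Submodule.mem_bot ℝ).1 (h ▸ he1))
  · rw [hgap]
    exact hA.eigenspace_eq_span hρ hν hνρ hlam hlev1 h10 (chiVec_zero hρ hμ _)
      (B_chiVec hρ hμ _) (C_chiVec hρ hμ _) (K_chiVec hρ hμ _) (exists_eq_smul_chiVec hρ hμ hκ)
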